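/- Let $k$ be a field and let $R=\bigoplus_{i\ge 0}R_i$ be a standard graded $k$-algebra ($R_0=k$, $\dim_k R_1<\infty$, $R=k[R_1]$) which is a domain of Krull dimension $s$, with maximal homogeneous ideal $\mathfrak m=\bigoplus_{i>0}R_i$. Let $I\neq 0$ be an ideal of $R$ generated by forms of degree $d$, and consider the $k$-subalgebras $A=k[I_d]\subseteq B=k[R_d]$ of $R$, where $I_d=I\cap R_d$. Let $\mathcal R(I)=R[It]\subseteq R[t]$ be the Rees algebra and $\mathcal G=\operatorname{gr}_I(R)=\mathcal R(I)/I\mathcal R(I)$ the associated graded ring of $I$. For an ideal $\mathfrak a$ of a Noetherian ring $S$ and a finitely generated $S$-module $M$ of Krull dimension $r$ such that all $M/\mathfrak a^nM$ have finite length, put $e_{\mathfrak a}(M)=r!\lim_{n\to\infty}\lambda_S(M/\mathfrak a^nM)/n^{r}$. The multiplicity $e(S)$ of a local ring $S$ is taken with respect to its maximal ideal, and $e(A)$ is taken with respect to $A\cap\mathfrak m$. Let $\mathfrak M=\mathfrak m\mathcal G+\mathcal G_+$ and $N=0:_{\mathcal G}\mathfrak m^{\infty}=\bigcup_n(0:_{\mathcal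 G}\mathfrak m^n\mathcal G)$; the $j$-multiplicity of $I$ is $$j(I)=s!\lim_{n\to\infty}\frac{\lambda_{\mathcal G}(N/\mathfrak M^nN)}{n^{s}},$$ that is, $j(I)=e_{\mathfrak M}(N)$ if $\dim N=s$, and $j(I)=0$ if $\dim N<s$. Finally $[B:A]$ denotes the degree $[\operatorname{Quot}(B):\operatorname{Quot}(A)]$ of the extension of quotient fields. If $A$ has Krull dimension $s$, then $\mathfrak m\mathcal R(I)$ is a prime ideal, $[B:A]$ is finite, the multiplicities below exist, and $$e\bigl(\mathcal R(I)_{\mathfrak m\mathcal R(I)}\bigr)=[B:A]\qquad\text{and}\qquad j(I)=d\cdot[B:A]\cdot e(A).$$ -/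

import Mathlib

open Filter Topology Nat Polynomial

noncomputable section

/-- A grading `𝒜` of a `k`-algebra `R` makes `R` a *standard graded* `k`-algebra: the degree zero
part is `k`, the degree one part is finite-dimensional, and it generates `R` as a `k`-algebra. -/
structure IsStandardGraded {k R : Type*} [Field k] [CommRing R] [Algebra k R]
    (𝒜 : ℕ → Submodule k R) [GradedAlgebra 𝒜] : Prop where
  algebraMap_injective : Function.Injective (algebraMap k R)
  degree_zero : 𝒜 0 = LinearMap.range (Algebra.linearMap k R)
  degree_one_finite : Module.Finite k (𝒜 1)
  generated : Algebra.adjoin k (𝒜 1 : Set R) = ⊤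

/-- The maximal homogeneous ideal `𝔪 = ⨁_{i > 0} R_i` of a standard graded algebra. -/
abbrev homogeneousMaximalIdeal {k R : Type*} [Field k] [CommRing R] [Algebra k R]
    (𝒜 : ℕ → Submodule k R) [GradedAlgebra 𝒜] : Ideal R :=
  (HomogeneousIdeal.irrelevant 𝒜).toIdeal

/-- `I` is generated by (a set of) forms of degree `d`. -/
def IsGeneratedByForms {k R : Type*} [Field k] [CommRing R] [Algebra k R]
    (𝒜 : ℕ → Submodule k R) (I : Ideal R) (d : ℕ) : Prop :=
  ∃ F : Set R, F ⊆ (𝒜 d : Set R) ∧ I = Ideal.span F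

/-- All lengths `λ(M / 𝔞ⁿ M)` are finite and `e = lim s! λ(M / 𝔞ⁿ M) / nˢ`. -/
def HasSamuelLimit (S : Type*) [CommRing S] (𝔞 : Ideal S) (M : Type*) [AddCommGroup M]
    [Module S M] (s : ℕ) (e : ℝ) : Prop :=
  (∀ n : ℕ, Module.length S (M ⧸ (𝔞 ^ n • ⊤ : Submodule S M)) ≠ ⊤) ∧
  Tendsto (fun n : ℕ =>
      (s ! : ℝ) * ((Module.length S (M ⧸ (𝔞 ^ n • ⊤ : Submodule S M))).toNat : ℝ) / (n : ℝ) ^ s)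
    atTop (𝓝 e)

/-- `e_𝔞(M) = e`: the multiplicity of `M` with respect to `𝔞` exists and equals `e`; the limit is
normalised by the Krull dimension `s` of `M`. -/
def IsMultiplicity (S : Type*) [CommRing S] (𝔞 : Ideal S) (M : Type*) [AddCommGroup M]
    [Module S M] (e : ℝ) : Prop :=
  ∃ s : ℕ, Module.supportDim S M = s ∧ HasSamuelLimit S 𝔞 M s e

/-- The saturation `J : 𝔞^∞ = ⋃ n, (J : 𝔞ⁿ)`. -/
def idealSaturation {S : Type*} [CommRing S] (J 𝔞 : Ideal S) : Ideal S :=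
  ⨆ n : ℕ, J.colon ((𝔞 ^ n : Ideal S) : Set S)

section Rees

variable {R : Type*} [CommRing R]

/-- The extension `J 𝓡(I)` of an ideal `J` of `R` to the Rees algebra `𝓡(I) = R[It]`. -/
abbrev extendToRees (I J : Ideal R) : Ideal (reesAlgebra I) :=
  J.map (algebraMap R (reesAlgebra I))

/-- The associated graded ring `gr_I(R) = 𝓡(I) / I 𝓡(I)`. -/
abbrev assocGraded (I : Ideal R) : Type _ := reesAlgebra I ⧸ extendToRees I I

/-- The ideal `𝔪 + 𝓡(I)₊` of the Rees algebra: the elements with constant coefficient in `𝔪`. -/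
def reesHomogeneousMaximalIdeal (I 𝔪 : Ideal R) : Ideal (reesAlgebra I) :=
  𝔪.comap ((Polynomial.constantCoeff (R := R)).comp (reesAlgebra I).val.toRingHom)

/-- The (maximal homogeneous) ideal `𝔪 gr_I(R) + gr_I(R)₊` of the associated graded ring. -/
def grHomogeneousMaximalIdeal (I 𝔪 : Ideal R) : Ideal (assocGraded I) :=
  (reesHomogeneousMaximalIdeal I 𝔪).map (Ideal.Quotient.mk (extendToRees I I))

/-- The ideal `0 :_{gr_I(R)} 𝔪^∞` of the associated graded ring. -/
def grTorsion (I 𝔪 : Ideal R) : Ideal (assocGraded I) :=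
  idealSaturation ⊥ (𝔪.map (algebraMap R (assocGraded I)))

/-- `j(I) = e`: the `j`-multiplicity of `I` is the multiplicity of the `gr_I(R)`-module
`0 :_{gr_I(R)} 𝔪^∞`, normalised (as usual for `j`-multiplicities) by the dimension of `R`, so that
it is `0` when the dimension of this module is less than `dim R`. -/
def IsJMultiplicity (𝔪 I : Ideal R) (e : ℝ) : Prop :=
  ∃ s : ℕ, ringKrullDim R = s ∧
    HasSamuelLimit (assocGraded I) (grHomogeneousMaximalIdeal I 𝔪) (grTorsion I 𝔪) s e

end Rees

section Subalgebras

variable {k R : Type*} [Field k] [CommRing R] [Algebra k R] (𝒜 : ℕ → Submodule k R)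

/-- The ring `A = k[I_d]`. -/
def formSubalgebra (I : Ideal R) (d : ℕ) : Subalgebra k R :=
  Algebra.adjoin k {x | x ∈ I ∧ x ∈ 𝒜 d}

/-- The Veronese ring `B = k[R_d]`. -/
def veroneseSubalgebra (d : ℕ) : Subalgebra k R :=
  Algebra.adjoin k (𝒜 d : Set R)

theorem formSubalgebra_le_veroneseSubalgebra (I : Ideal R) (d : ℕ) :
    formSubalgebra 𝒜 I d ≤ veroneseSubalgebra 𝒜 d :=
  Algebra.adjoin_mono fun _ hx => hx.2

/-- The maximal homogeneous ideal `A ∩ 𝔪` of a graded subalgebra `A` of `R`. -/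
def subalgebraMaximalIdeal [GradedAlgebra 𝒜] (A : Subalgebra k R) : Ideal A :=
  (homogeneousMaximalIdeal 𝒜).comap (algebraMap A R)

/-- The degree `[L : K]` of a homomorphism of fields `f : K → L`. -/
def fieldDegree {K L : Type*} [Field K] [Field L] (f : K →+* L) : Cardinal :=
  letI : Algebra K L := f.toAlgebra
  Module.rank K L

/-- For subalgebras `A ≤ B` of a domain `R`, the degree `[B : A] = [Quot B : Quot A]` of the
extension of quotient fields induced by the inclusion. -/
def quotDegree [IsDomain R] (A B : Subalgebra k R) (h : A ≤ B) : Cardinal :=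
  fieldDegree (IsFractionRing.map (K := FractionRing A) (L := FractionRing B)
    (j := (Subalgebra.inclusion h).toRingHom) (Subalgebra.inclusion_injective h))

end Subalgebras

end

/-! Put `V = I_d`, so that `A = k[V]`, and suppose first that `s > 0`, which forces `d > 0`. The
Rees algebra is bigraded with pieces `R_j V^i X^i`, where `j + i d` is the degree in `R`. For fixed
`j` they add up to a copy of the `A`-module `A R_j`, and `𝔪^m 𝓡(I)` consists of the pieces with `m ≤
j`. Hence `𝓡(I)/𝔪𝓡(I)` is `k[VX] ≅ A`, a domain, and `𝔪^n 𝓡(I)/𝔪^(n+1) 𝓡(I)` is `A R_n`.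

Let `h(j)` be the rank of `A R_j` over `A` (`submoduleRank`). Equality of dimensions makes `R`
algebraic over `A`, so `[B : A]` is finite. Powers of a linear form move `R_j` into `B`, and powers
of a form in `V` move any element of `B` into `A R_j` for suitable large `j`; therefore `h(j) = [B :
A]` for `j ≫ 0` (`exists_forall_submoduleRank_eq`).

Local ring: after localizing at `P = 𝔪𝓡(I)`, the quotient `P^n/P^(n+1)` has dimension `h(n)` over
the residue field, so the Samuel function is `∑_{j<n} h(j)`. For a nonzero `f ∈ V` and `j ≫ 0`,
multiplication by `f` from `A R_j` to `A R_{j+d}` is surjective up to torsion, so a power of `P`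
lies in `(f)` locally. Krull's principal ideal theorem gives dimension one, and the multiplicity is
`lim h(j) = [B : A]` (`isMultiplicity_localization_extendToRees`).

`j`-multiplicity: the piece of `𝒢` at `(j, i)` is `R_j V^i / R_{j-d} V^(i+1)`. The sum over `i < n`
of `dim R_j V^i` grows like `h(j) e n^s`, where `s! e = e(A)` (`tendsto_sum_finrank_mul_pow`), so
the length of `𝒢/(𝔪^J + 𝔐^n)` grows like `∑_{j<J} (h(j) - h(j-d)) e n^s`, which telescopes to `d [B
: A] e n^s` for large `J`. The torsion `N` has the same growth as `𝒢/𝔪^J 𝒢`: by Artin–Rees `N ∩ 𝔪^J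
𝒢 = 0`, which bounds `N` above, while `N` contains the class of some `b X^e` with `0 ≠ b ∈ V^e`,
modulo which `𝒢/𝔪^J 𝒢` has growth `o(n^s)` (`hasSamuelLimit_grTorsion`).

If `s = 0`, then `R = k`, `d = 0` and `𝒢 = 0`, and everything is checked directly. -/

/-! ### Krull dimension and transcendence degree -/

/-- Going-up, started at a prime over the bottom of a chain, lifts the chain to `S`; incomparability
makes contraction of primes strictly monotone. -/
theorem ringKrullDim_eq_of_isIntegral_of_injective {R S : Type*} [CommRing R] [CommRing S]
    [Algebra R S] [Algebra.IsIntegral R S] (hinj : Function.Injective (algebraMap R S)) :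
    ringKrullDim R = ringKrullDim S := by
  apply le_antisymm
  · have : FaithfulSMul R S := (faithfulSMul_iff_algebraMap_injective R S).2 hinj
    refine iSup_le fun l => ?_
    obtain ⟨Q, -, hQ, hQl⟩ := Ideal.exists_ideal_over_prime_of_isIntegral (S := S)
      (RelSeries.head l).asIdeal ⊥ (by
        rw [← RingHom.ker_eq_comap_bot, (RingHom.injective_iff_ker_eq_bot _).1 hinj]; exact bot_le)
    have : Q.LiesOver (RelSeries.head l).asIdeal := ⟨hQl.symm⟩
    obtain ⟨L, hL, -, -⟩ := Ideal.exists_ltSeries_of_hasGoingUp l Q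
    rw [← hL]
    exact le_iSup (fun p : LTSeries (PrimeSpectrum S) => (p.length : WithBot ℕ∞)) L
  · refine Order.krullDim_le_of_strictMono (PrimeSpectrum.comap (algebraMap R S)) ?_
    intro p q hpq
    exact Ideal.IsIntegral.comap_lt_comap (R := R) (I := p.asIdeal) (J := q.asIdeal) hpq

/-- Noether normalization over a polynomial ring whose number of variables is the dimension. -/
theorem exists_finite_injective_of_ringKrullDim_eq {k A : Type*} [Field k] [CommRing A]
    [Nontrivial A] [Algebra k A] [Algebra.FiniteType k A] {s : ℕ} (hs : ringKrullDim A = s) :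
    ∃ g : MvPolynomial (Fin s) k →ₐ[k] A, Function.Injective g ∧ g.Finite := by
  obtain ⟨n, g, hg, hfin⟩ := exists_finite_inj_algHom_of_fg k A
  have : n = s := by
    let _ : Algebra (MvPolynomial (Fin _) k) A := g.toRingHom.toAlgebra
    have : Algebra.IsIntegral (MvPolynomial (Fin n) k) A := ⟨hfin.to_isIntegral⟩
    have h := ringKrullDim_eq_of_isIntegral_of_injective (R := MvPolynomial (Fin n) k) (S := A) hg
    rw [MvPolynomial.ringKrullDim_of_isNoetherianRing, hs] at h
    simp at h
    exact_mod_cast h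
  subst this
  exact ⟨g, hg, hfin⟩

/-- Transcendence degree is additive along `k → k[X_1, …, X_s] → A`, and the second step of a
Noether normalization is integral. -/
theorem trdeg_eq_of_ringKrullDim_eq {k A : Type*} [Field k] [CommRing A]
    [IsDomain A] [Algebra k A] [Algebra.FiniteType k A] {s : ℕ} (hs : ringKrullDim A = s) :
    Algebra.trdeg k A = s := by
  obtain ⟨g, hg, hfin⟩ := exists_finite_injective_of_ringKrullDim_eq (k := k) hs
  let _ : Algebra (MvPolynomial (Fin _) k) A := g.toRingHom.toAlgebra
  have : Algebra.IsIntegral (MvPolynomial (Fin s) k) A := ⟨hfin.to_isIntegral⟩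
  have : FaithfulSMul (MvPolynomial (Fin s) k) A := (faithfulSMul_iff_algebraMap_injective _ _).2 hg
  have : IsScalarTower k (MvPolynomial (Fin s) k) A :=
    IsScalarTower.of_algebraMap_eq fun x => (g.commutes x).symm
  have h := lift_trdeg_add_eq k (MvPolynomial (Fin s) k) A
  rw [MvPolynomial.trdeg_of_isDomain, trdeg_eq_zero (R := MvPolynomial (Fin s) k)] at h
  simp at h
  exact h.symm

theorem isAlgebraic_of_ringKrullDim_eq {k R : Type*} [Field k] [CommRing R] [IsDomain R]
    [Algebra k R] [Algebra.FiniteType k R] (A : Subalgebra k R) [Algebra.FiniteType k A] {s : ℕ}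
    (hA : ringKrullDim A = s) (hR : ringKrullDim R = s) : Algebra.IsAlgebraic A R := by
  have h : _ = Algebra.trdeg k R := trdeg_add_eq k A
  rw [trdeg_eq_of_ringKrullDim_eq hA, trdeg_eq_of_ringKrullDim_eq hR] at h
  have : FaithfulSMul A R := (faithfulSMul_iff_algebraMap_injective _ _).2 Subtype.val_injective
  rw [← trdeg_eq_zero_iff]
  -- Once the second summand is known to be finite, the equation `s + trdeg = s` can be solved in
  -- `ℕ`.
  have h' : Algebra.trdeg A R < Cardinal.aleph0 := by
    refine lt_of_le_of_lt (le_add_left le_rfl) (h ▸ Cardinal.natCast_lt_aleph0)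
  obtain ⟨m, hm⟩ := Cardinal.lt_aleph0.1 h'
  rw [hm] at h ⊢
  have : s + m = s := by exact_mod_cast h
  simp; omega

/-! ### Growth of finitely generated algebras -/

theorem Submodule.finrank_mul_le {k A : Type*} [Field k] [CommRing A] [Algebra k A]
    (M N : Submodule k A) [Module.Finite k M] [Module.Finite k N] :
    Module.finrank k ↥(M * N) ≤ Module.finrank k M * Module.finrank k N := by
  have h : M * N = LinearMap.range (Submodule.mulMap M N) := (Submodule.mulMap_range M N).symm
  rw [h, ← Module.finrank_tensorProduct (R := k)]
  exact LinearMap.finrank_range_le _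

theorem MvPolynomial.restrictDegree_mul_le {k : Type*} [Field k] {s : ℕ} (a b : ℕ) :
    MvPolynomial.restrictDegree (Fin s) k a * MvPolynomial.restrictDegree (Fin s) k b ≤
      MvPolynomial.restrictDegree (Fin s) k (a + b) := by
  rw [Submodule.mul_le]
  intro p hp q hq
  rw [MvPolynomial.mem_restrictDegree] at hp hq ⊢
  intro m hm i
  exact (MvPolynomial.degreeOf_le_iff.1 le_rfl m hm).trans ((MvPolynomial.degreeOf_mul_le i p q).trans
    (Nat.add_le_add (MvPolynomial.degreeOf_le_iff.2 fun m hm => hp m hm i)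
      (MvPolynomial.degreeOf_le_iff.2 fun m hm => hq m hm i)))

theorem MvPolynomial.finrank_restrictDegree_le {k : Type*} [Field k] {s : ℕ} (a : ℕ) :
    Module.finrank k (MvPolynomial.restrictDegree (Fin s) k a) ≤ (a + 1) ^ s := by
  have b := MvPolynomial.basisRestrictSupport k {n : Fin s →₀ ℕ | ∀ i, n i ≤ a}
  let f : {n : Fin s →₀ ℕ | ∀ i, n i ≤ a} → (Fin s → Fin (a + 1)) :=
    fun n i => ⟨n.1 i, Nat.lt_succ_of_le (n.2 i)⟩
  have hf : Function.Injective f := by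
    intro n m h
    ext i
    exact congrArg Fin.val (congrFun h i)
  have := Fintype.ofInjective f hf
  unfold MvPolynomial.restrictDegree
  rw [Module.finrank_eq_card_basis b]
  simpa using Fintype.card_le_of_injective f hf

/-- The growth of a finitely generated algebra is bounded by its Krull dimension. -/
theorem exists_finrank_pow_le {k A : Type*} [Field k] [CommRing A]
    [Nontrivial A] [Algebra k A] [Algebra.FiniteType k A] {s : ℕ} (hs : ringKrullDim A = s)
    (W : Submodule k A) [Module.Finite k W] :
    ∃ C : ℕ, ∀ n : ℕ, 1 ≤ n → Module.finrank k ↥(W ^ n) ≤ C * n ^ s := by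
  obtain ⟨g, hg, hfin⟩ := exists_finite_injective_of_ringKrullDim_eq (k := k) hs
  let _ : Algebra (MvPolynomial (Fin _) k) A := g.toRingHom.toAlgebra
  have hfinite : Module.Finite (MvPolynomial (Fin s) k) A := hfin
  obtain ⟨w, hw⟩ := hfinite.fg_top
  -- The element `1` is added to the module generators so that `W ^ n ≤ W ^ n * U`.
  let U : Submodule k A := Submodule.span k (insert 1 (w : Set A))
  have hU : Module.Finite k U := Module.Finite.span_of_finite k (w.finite_toSet.insert 1)
  let F : ℕ → Submodule k A := fun m => (MvPolynomial.restrictDegree (Fin s) k m).map g.toLinearMap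
  have hFmono : Monotone F := fun a b h => Submodule.map_mono fun p hp => by
    rw [MvPolynomial.mem_restrictDegree] at hp ⊢
    exact fun m hm i => (hp m hm i).trans h
  have hFmul : ∀ a b, F a * F b ≤ F (a + b) := fun a b => by
    rw [← Submodule.map_mul]
    exact Submodule.map_mono (MvPolynomial.restrictDegree_mul_le a b)
  have hex : ∀ x : A, ∃ m, x ∈ F m * U := by
    intro x
    have hx : x ∈ Submodule.span (MvPolynomial (Fin s) k) (w : Set A) := hw ▸ Submodule.mem_top
    induction hx using Submodule.span_induction with
    | mem x hx =>
      refine ⟨0, ?_⟩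
      have h1 : (1 : A) ∈ F 0 := ⟨1, by
        rw [SetLike.mem_coe, MvPolynomial.mem_restrictDegree]
        intro m hm i
        have := MvPolynomial.degreeOf_le_iff.1 (MvPolynomial.degreeOf_one (R := k) i).le m hm
        exact this, by simp⟩
      simpa using Submodule.mul_mem_mul h1
        (Submodule.subset_span (Set.mem_insert_of_mem 1 hx) : x ∈ U)
    | zero => exact ⟨0, zero_mem _⟩
    | add x y _ _ hx hy =>
      obtain ⟨a, ha⟩ := hx
      obtain ⟨b, hb⟩ := hy
      exact ⟨max a b, add_mem (mul_le_mul_left (hFmono (le_max_left _ _)) _ ha)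
        (mul_le_mul_left (hFmono (le_max_right _ _)) _ hb)⟩
    | smul c x _ hx =>
      obtain ⟨a, ha⟩ := hx
      refine ⟨c.totalDegree + a, ?_⟩
      have hc : g c ∈ F c.totalDegree := Submodule.mem_map_of_mem (f := g.toLinearMap) (by
        rw [MvPolynomial.mem_restrictDegree]
        intro m hm i
        exact (MvPolynomial.degreeOf_le_iff.1 le_rfl m hm).trans
          (MvPolynomial.degreeOf_le_totalDegree c i))
      have : c • x = g c * x := Algebra.smul_def c x
      rw [this]
      have h2 := Submodule.mul_mem_mul hc ha
      rw [← mul_assoc] at h2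
      exact mul_le_mul_left (hFmul _ _) _ h2
  -- `A` is the union of the subspaces `F m * U`, so the finitely generated `W * U` lies in one of
  -- them. Each further factor `W` then costs `D` in the degree.
  obtain ⟨D, hD⟩ : ∃ D, W * U ≤ F D * U := by
    have hfg : (W * U).FG := (Module.Finite.iff_fg.1 ‹_›).mul (Module.Finite.iff_fg.1 hU)
    obtain ⟨T, hT⟩ := hfg
    choose m hm using hex
    refine ⟨T.sup m, ?_⟩
    rw [← hT, Submodule.span_le]
    intro x hx
    exact mul_le_mul_left (hFmono (Finset.le_sup hx)) _ (hm x)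
  have hpow : ∀ n, W ^ n * U ≤ F (n * D) * U := by
    intro n
    induction n with
    | zero =>
      simp only [pow_zero, one_mul, zero_mul]
      intro u hu
      have h1 : (1 : A) ∈ F 0 := ⟨1, by
        rw [SetLike.mem_coe, MvPolynomial.mem_restrictDegree]
        intro m hm i
        exact MvPolynomial.degreeOf_le_iff.1 (MvPolynomial.degreeOf_one (R := k) i).le m hm,
        by simp⟩
      simpa using Submodule.mul_mem_mul h1 hu
    | succ n ih =>
      calc W ^ (n + 1) * U = W ^ n * (W * U) := by rw [pow_succ, mul_assoc]
        _ ≤ W ^ n * (F D * U) := mul_le_mul_right hD _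
        _ = F D * (W ^ n * U) := by rw [← mul_assoc, ← mul_assoc, mul_comm (F D)]
        _ ≤ F D * (F (n * D) * U) := mul_le_mul_right ih _
        _ = (F D * F (n * D)) * U := by rw [mul_assoc]
        _ ≤ F ((n + 1) * D) * U := mul_le_mul_left ((hFmul _ _).trans_eq (by ring_nf)) _
  have hFfin : ∀ m, Module.Finite k (F m) := fun m => inferInstance
  refine ⟨(D + 1) ^ s * Module.finrank k U, fun n hn => ?_⟩
  have hle : W ^ n ≤ F (n * D) * U := fun x hx => hpow n (by
    simpa using Submodule.mul_mem_mul hx (Submodule.subset_span (Set.mem_insert 1 _) : (1:A) ∈ U))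
  have : Module.Finite k ↥(F (n * D) * U) := Module.Finite.iff_fg.2
    ((Module.Finite.iff_fg.1 (hFfin _)).mul (Module.Finite.iff_fg.1 hU))
  calc Module.finrank k ↥(W ^ n) ≤ Module.finrank k ↥(F (n * D) * U) := Submodule.finrank_mono hle
    _ ≤ Module.finrank k (F (n * D)) * Module.finrank k U := Submodule.finrank_mul_le _ _
    _ ≤ (n * D + 1) ^ s * Module.finrank k U := Nat.mul_le_mul_right _
        ((Submodule.finrank_map_le _ _).trans (MvPolynomial.finrank_restrictDegree_le _))
    _ ≤ (n * (D + 1)) ^ s * Module.finrank k U := Nat.mul_le_mul_right _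
        (Nat.pow_le_pow_left (by nlinarith) s)
    _ = (D + 1) ^ s * Module.finrank k U * n ^ s := by rw [mul_pow]; ring

/-! ### Eventually polynomial functions -/

/-- Functions on `ℕ` that eventually agree with a polynomial. -/
def IsEventuallyPolynomial (H : ℕ → ℚ) : Prop :=
  ∃ p : ℚ[X], ∀ᶠ n : ℕ in atTop, H n = p.eval (n : ℚ)

theorem Polynomial.exists_eval_succ_sub_eval (p : ℚ[X]) :
    ∃ q : ℚ[X], ∀ n : ℕ, q.eval ((n + 1 : ℕ) : ℚ) - q.eval (n : ℚ) = p.eval (n : ℚ) := by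
  induction p using Polynomial.induction_on' with
  | add p q hp hq =>
    obtain ⟨p', hp'⟩ := hp
    obtain ⟨q', hq'⟩ := hq
    refine ⟨p' + q', fun n => ?_⟩
    rw [eval_add, eval_add, eval_add, ← hp', ← hq']
    ring
  | monomial m a =>
    -- Bernoulli polynomials satisfy `B_{m+1}(n+1) - B_{m+1}(n) = (m+1) n^m`.
    refine ⟨C (a / (m + 1)) * Polynomial.bernoulli (m + 1), fun n => ?_⟩
    rw [eval_C_mul, eval_C_mul, Polynomial.bernoulli_succ_eval, Polynomial.bernoulli_succ_eval,
      Finset.sum_range_succ, eval_monomial]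
    have : (m + 1 : ℚ) ≠ 0 := by positivity
    field_simp
    ring

namespace IsEventuallyPolynomial

variable {F G : ℕ → ℚ}

theorem congr (hF : IsEventuallyPolynomial F) (h : ∀ᶠ n in atTop, G n = F n) :
    IsEventuallyPolynomial G := by
  obtain ⟨p, hp⟩ := hF
  exact ⟨p, by filter_upwards [hp, h] with n h1 h2 using h2.trans h1⟩

theorem sub (hF : IsEventuallyPolynomial F) (hG : IsEventuallyPolynomial G) :
    IsEventuallyPolynomial fun n => F n - G n := by
  obtain ⟨p, hp⟩ := hF
  obtain ⟨q, hq⟩ := hG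
  exact ⟨p - q, by filter_upwards [hp, hq] with n h1 h2; simp [h1, h2]⟩

theorem shift (hF : IsEventuallyPolynomial F) : IsEventuallyPolynomial fun n => F (n + 1) := by
  obtain ⟨p, hp⟩ := hF
  refine ⟨p.comp (X + 1), ?_⟩
  filter_upwards [(tendsto_add_atTop_nat 1).eventually hp] with n hn
  simp [hn]

theorem of_succ_sub (h : IsEventuallyPolynomial fun n => F (n + 1) - F n) :
    IsEventuallyPolynomial F := by
  obtain ⟨p, hp⟩ := h
  obtain ⟨q, hq⟩ := Polynomial.exists_eval_succ_sub_eval p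
  obtain ⟨N, hN⟩ := eventually_atTop.1 hp
  refine ⟨q + C (F N - q.eval (N : ℚ)), eventually_atTop.2 ⟨N, fun n hn => ?_⟩⟩
  induction n, hn using Nat.le_induction with
  | base => simp
  | succ n hn ih =>
    have h1 := hN n hn
    have h2 := hq n
    simp only [eval_add, eval_C] at ih ⊢
    linarith

/-- A function of growth `O(nˢ)` which is eventually polynomial is asymptotic to a multiple
of `nˢ`. -/
theorem exists_tendsto_div_pow (hF : IsEventuallyPolynomial F) {s C : ℕ}
    (hpos : ∀ n, 0 ≤ F n) (hC : ∀ n : ℕ, 1 ≤ n → F n ≤ C * (n : ℚ) ^ s) :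
    ∃ e : ℝ, Tendsto (fun n : ℕ => (F n : ℝ) / (n : ℝ) ^ s) atTop (𝓝 e) := by
  obtain ⟨p, hp⟩ := hF
  set P : ℝ[X] := p.map (algebraMap ℚ ℝ) with hP
  have hev : ∀ᶠ n : ℕ in atTop, (F n : ℝ) = P.eval (n : ℝ) := by
    filter_upwards [hp] with n hn
    rw [hn, hP]
    have := Polynomial.eval_map_algebraMap (B := ℝ) p (n : ℝ)
    rw [this]
    have h2 := Polynomial.aeval_algebraMap_apply ℝ (n : ℚ) p
    simpa using h2.symm
  have hbd : ∀ᶠ n : ℕ in atTop, |P.eval (n : ℝ) / (X ^ s : ℝ[X]).eval (n : ℝ)| ≤ C := by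
    filter_upwards [hev, eventually_ge_atTop 1] with n hn h1
    have h3 : (0 : ℝ) < (n : ℝ) ^ s := by positivity
    rw [← hn, eval_pow, eval_X, abs_div, abs_of_pos h3, div_le_iff₀ h3,
      abs_of_nonneg (by exact_mod_cast hpos n)]
    exact_mod_cast hC n h1
  -- The quotient of polynomials converges unless the numerator has the larger degree, and then it
  -- would be unbounded, against `hbd`.
  have key : ∃ e : ℝ, Tendsto (fun x : ℝ => P.eval x / (X ^ s : ℝ[X]).eval x) atTop (𝓝 e) := by
    rcases lt_trichotomy P.degree (X ^ s : ℝ[X]).degree with h | h | h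
    · exact ⟨0, Polynomial.div_tendsto_atTop_zero_of_degree_lt _ _ h⟩
    · exact ⟨_, Polynomial.div_tendsto_atTop_leadingCoeff_div_of_degree_eq _ _ h⟩
    · have h1 := (Polynomial.abs_div_tendsto_atTop_atTop_of_degree_gt _ _ h
        (by simp)).comp tendsto_natCast_atTop_atTop
      obtain ⟨n, hn1, hn2⟩ := (hbd.and (h1.eventually (eventually_gt_atTop (C : ℝ)))).exists
      exact absurd hn1 (not_le.2 hn2)
  obtain ⟨e, he⟩ := key
  refine ⟨e, (he.comp tendsto_natCast_atTop_atTop).congr' ?_⟩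
  filter_upwards [hev] with n hn
  simp [hn]

end IsEventuallyPolynomial

/-! ### The Hilbert–Serre theorem -/

/-- The family of projections of a grading of a vector space by `ℕ`. -/
structure IsGradingProjection {k M : Type*} [Field k] [AddCommGroup M] [Module k M]
    (p : ℕ → M →ₗ[k] M) : Prop where
  apply_apply : ∀ n m y, p n (p m y) = if n = m then p n y else 0
  exists_sum : ∀ y, ∃ N, y = ∑ n ∈ Finset.range N, p n y

theorem IsGradingProjection.eventually_eq_zero {k M : Type*} [Field k] [AddCommGroup M] [Module k M]
    {p : ℕ → M →ₗ[k] M} (hp : IsGradingProjection p) (y : M) :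
    ∀ᶠ n in atTop, p n y = 0 := by
  obtain ⟨N, hN⟩ := hp.exists_sum y
  filter_upwards [eventually_ge_atTop N] with n hn
  rw [hN, map_sum]
  refine Finset.sum_eq_zero fun m hm => ?_
  rw [hp.apply_apply, if_neg]
  have := Finset.mem_range.1 hm
  omega

theorem IsGradingProjection.eventually_eq_zero_of_finite {k M : Type*} [Field k] [AddCommGroup M]
    [Module k M] [Module.Finite k M]
    {p : ℕ → M →ₗ[k] M} (hp : IsGradingProjection p) : ∀ᶠ n in atTop, p n = 0 := by
  obtain ⟨T, hT⟩ := (‹Module.Finite k M›).fg_top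
  have : ∀ᶠ n in atTop, ∀ y ∈ T, p n y = 0 :=
    (Finset.eventually_all T).2 fun y _ => hp.eventually_eq_zero y
  filter_upwards [this] with n hn
  exact LinearMap.ext_on (s := (T : Set M)) hT fun y hy => by simpa using hn y hy

-- This is the Euler characteristic of the strand `0 → K_n → M_n → M_{n+1} → C_{n+1} → 0` of a map
-- `f` of degree one; `pK` and `pC` are the projections induced on its kernel and cokernel.
open LinearMap in
theorem finrank_range_add_finrank_range {k M : Type*} [Field k] [AddCommGroup M] [Module k M]
    {p : ℕ → M →ₗ[k] M} (hp : IsGradingProjection p) [∀ n, Module.Finite k (range (p n))]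
    (f : M →ₗ[k] M) (hf : ∀ n y, p (n + 1) (f y) = f (p n y))
    (n : ℕ) (pK : ker f →ₗ[k] ker f) (hK : ∀ y, (pK y : M) = p n y)
    (pC : M ⧸ range f →ₗ[k] M ⧸ range f)
    (hC : ∀ y, pC (Submodule.Quotient.mk y) = Submodule.Quotient.mk (p (n + 1) y)) :
    Module.finrank k (range (p (n + 1))) + Module.finrank k (range pK) =
      Module.finrank k (range pC) + Module.finrank k (range (p n)) := by
  have hid : ∀ m, ∀ y ∈ range (p m), p m y = y := by
    rintro m _ ⟨y, rfl⟩
    simp [hp.apply_apply]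
  let f' : range (p n) →ₗ[k] range (p (n + 1)) := f.restrict fun y hy => by
    obtain ⟨z, rfl⟩ := hy
    exact ⟨f z, hf n z⟩
  have h1 := LinearMap.finrank_range_add_finrank_ker f'
  have h2 := Submodule.finrank_quotient_add_finrank (range f')
  have e1 : Module.finrank k (ker f') = Module.finrank k (range pK) := by
    have : (ker f').map (range (p n)).subtype = (range pK).map (ker f).subtype := by
      ext y
      simp only [Submodule.mem_map, Submodule.subtype_apply, Subtype.exists, LinearMap.mem_ker,
        LinearMap.mem_range]
      constructor
      · rintro ⟨z, hz, hz2, rfl⟩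
        have hz3 : f z = 0 := congrArg Subtype.val hz2
        exact ⟨z, hz3, ⟨z, hz3, Subtype.ext ((hK _).trans (hid n z hz))⟩, rfl⟩
      · rintro ⟨z, hz, ⟨w, hw, hw2⟩, rfl⟩
        have h3 : p n w = z := (hK ⟨w, hw⟩).symm.trans (congrArg Subtype.val hw2)
        exact ⟨z, ⟨w, h3⟩, Subtype.ext hz, rfl⟩
    rw [← Submodule.finrank_map_subtype_eq, this, Submodule.finrank_map_subtype_eq]
  have e2 : Module.finrank k (range (p (n + 1)) ⧸ range f') = Module.finrank k (range pC) := by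
    let ψ : range (p (n + 1)) →ₗ[k] range pC :=
      LinearMap.codRestrict _ ((range f).mkQ ∘ₗ (range (p (n + 1))).subtype) fun y => by
        obtain ⟨y, z, rfl⟩ := y
        exact ⟨Submodule.Quotient.mk z, hC z⟩
    have hker : ker ψ = range f' := by
      ext ⟨y, hy⟩
      simp only [ψ, LinearMap.mem_ker, LinearMap.mem_range, Subtype.ext_iff,
        LinearMap.codRestrict_apply, LinearMap.comp_apply, Submodule.mkQ_apply,
        Submodule.subtype_apply, ZeroMemClass.coe_zero, Submodule.Quotient.mk_eq_zero]
      constructor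
      · rintro ⟨z, hz⟩
        refine ⟨⟨p n z, z, rfl⟩, ?_⟩
        rw [← hid _ y hy, ← hz, hf]
        rfl
      · rintro ⟨z, hz⟩
        exact ⟨z, hz⟩
    have hs : range ψ = ⊤ := by
      rw [LinearMap.range_eq_top]
      rintro ⟨_, z, rfl⟩
      obtain ⟨z, rfl⟩ := Submodule.Quotient.mk_surjective _ z
      exact ⟨⟨p (n + 1) z, z, rfl⟩, Subtype.ext (hC z).symm⟩
    rw [← hker, (ψ.quotKerEquivRange).finrank_eq, hs, finrank_top]
  omega

/-- Base case of Hilbert–Serre: all algebra generators act as zero, so `S` acts through scalars of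
`k` and generators over `S` generate over `k`. -/
theorem finite_of_forall_smul_eq_zero {k S M : Type*} [Field k] [CommRing S] [Algebra k S]
    [AddCommGroup M] [Module k M] [Module S M] [IsScalarTower k S M] [Module.Finite S M]
    {X : Set S} (hX : Algebra.adjoin k X = ⊤) (h : ∀ x ∈ X, ∀ y : M, x • y = 0) :
    Module.Finite k M := by
  have hs : ∀ a : S, ∃ c : k, ∀ y : M, a • y = c • y := by
    intro a
    have ha : a ∈ Algebra.adjoin k X := hX ▸ Algebra.mem_top
    induction ha using Algebra.adjoin_induction with
    | mem x hx => exact ⟨0, fun y => by simp [h x hx y]⟩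
    | algebraMap r => exact ⟨r, fun y => algebraMap_smul S r y⟩
    | add a b _ _ ha hb =>
      obtain ⟨c, hc⟩ := ha
      obtain ⟨e, he⟩ := hb
      exact ⟨c + e, fun y => by rw [add_smul, add_smul, hc, he]⟩
    | mul a b _ _ ha hb =>
      obtain ⟨c, hc⟩ := ha
      obtain ⟨e, he⟩ := hb
      exact ⟨c * e, fun y => by rw [mul_smul, mul_smul, he, hc]⟩
  obtain ⟨T, hT⟩ := (‹Module.Finite S M›).fg_top
  refine ⟨T, ?_⟩
  rw [eq_top_iff]
  intro y _
  have hy : y ∈ Submodule.span S (T : Set M) := hT ▸ Submodule.mem_top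
  induction hy using Submodule.span_induction with
  | mem x hx => exact Submodule.subset_span hx
  | zero => exact zero_mem _
  | add x y _ _ hx hy => exact add_mem (hx trivial) (hy trivial)
  | smul a x _ hx =>
    obtain ⟨c, hc⟩ := hs a
    rw [hc]
    exact Submodule.smul_mem _ c (hx trivial)

open LinearMap in
/-- **Hilbert–Serre**: the Hilbert function of a finitely generated graded module over a
Noetherian algebra generated by elements of degree one is eventually polynomial. -/
theorem isEventuallyPolynomial_finrank {k S : Type*} [Field k] [CommRing S] [Algebra k S]
    [IsNoetherianRing S] {X : Set S} (hX : Algebra.adjoin k X = ⊤) (T : Finset S)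
    (M : Type*) [AddCommGroup M] [Module k M] [Module S M]
    [IsScalarTower k S M] [Module.Finite S M] (p : ℕ → M →ₗ[k] M) (hp : IsGradingProjection p)
    (hfin : ∀ n, Module.Finite k (range (p n)))
    (hT : ∀ x ∈ T, (∀ n y, p (n + 1) (x • y) = x • p n y) ∧ ∀ y, p 0 (x • y) = 0)
    (hkill : ∀ x ∈ X, x ∉ T → ∀ y : M, x • y = 0) :
    IsEventuallyPolynomial fun n => (Module.finrank k (range (p n)) : ℚ) := by
  classical
  -- `T` contains all generators that may act nontrivially on `M`. The kernel and the cokernel of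
  -- multiplication by `t` are both killed by `t`, so the induction hypothesis applies to them with
  -- `t` removed.
  induction T using Finset.induction_on generalizing M with
  | empty =>
    have : Module.Finite k M := finite_of_forall_smul_eq_zero hX fun x hx => hkill x hx (by simp)
    refine ⟨0, ?_⟩
    filter_upwards [hp.eventually_eq_zero_of_finite] with n hn
    simp [hn]
  | insert t T ht ih =>
    have hft := (hT t (Finset.mem_insert_self _ _))
    let f : M →ₗ[S] M := LinearMap.lsmul S M t
    let fk : M →ₗ[k] M := f.restrictScalars k
    have hinv : ∀ n, ∀ y ∈ ker f, p n y ∈ ker f := fun n y hy => by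
      change t • y = 0 at hy
      change t • p n y = 0
      rw [← hft.1, hy, map_zero]
    let pK : ℕ → ker f →ₗ[k] ker f := fun n => (p n).restrict (p := (ker f).restrictScalars k)
      (q := (ker f).restrictScalars k) (hinv n)
    have hinv2 : ∀ n, (range f).restrictScalars k ≤ ((range f).restrictScalars k).comap (p n) := by
      rintro n _ ⟨y, rfl⟩
      change p n (t • y) ∈ range f
      cases n with
      | zero => rw [hft.2]; exact zero_mem _
      | succ n => rw [hft.1]; exact ⟨p n y, rfl⟩
    let pC : ℕ → (M ⧸ range f) →ₗ[k] (M ⧸ range f) := fun n =>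
      Submodule.mapQ ((range f).restrictScalars k) ((range f).restrictScalars k) (p n) (hinv2 n)
    have hpK : IsGradingProjection pK := by
      constructor
      · intro n m y
        apply Subtype.ext
        have := hp.apply_apply n m y
        split_ifs with h
        · rw [if_pos h] at this
          exact this
        · rw [if_neg h] at this
          exact this
      · rintro ⟨y, hy⟩
        obtain ⟨N, hN⟩ := hp.exists_sum y
        refine ⟨N, Subtype.ext ?_⟩
        rw [AddSubmonoidClass.coe_finsetSum]
        exact hN
    have hpC : IsGradingProjection pC := by
      constructor
      · intro n m y
        obtain ⟨y, rfl⟩ := Submodule.Quotient.mk_surjective _ y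
        have := hp.apply_apply n m y
        change Submodule.Quotient.mk (p n (p m y)) = _
        rw [this]
        split_ifs with h
        · rfl
        · rfl
      · intro y
        obtain ⟨y, rfl⟩ := Submodule.Quotient.mk_surjective _ y
        obtain ⟨N, hN⟩ := hp.exists_sum y
        refine ⟨N, ?_⟩
        conv_lhs => rw [hN]
        exact map_sum (range f).mkQ _ _
    have hnoeth : IsNoetherian S M := isNoetherian_of_isNoetherianRing_of_finite S M
    have hKfin : ∀ n, Module.Finite k (range (pK n)) := fun n => by
      let i : range (pK n) →ₗ[k] range (p n) :=
        LinearMap.codRestrict _ (((ker f).restrictScalars k).subtype ∘ₗ (range (pK n)).subtype) (by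
          rintro ⟨_, y, rfl⟩
          exact ⟨y, rfl⟩)
      refine Module.Finite.of_injective i fun a b h => ?_
      have h' : ((a : ker f) : M) = (b : ker f) := congrArg (Subtype.val : range (p n) → M) h
      exact Subtype.ext (Subtype.ext h')
    have hCfin : ∀ n, Module.Finite k (range (pC n)) := fun n => by
      let i : range (p n) →ₗ[k] range (pC n) :=
        LinearMap.codRestrict _ (((range f).restrictScalars k).mkQ ∘ₗ (range (p n)).subtype) (by
          rintro ⟨_, y, rfl⟩
          exact ⟨Submodule.Quotient.mk y, rfl⟩)
      refine Module.Finite.of_surjective i ?_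
      rintro ⟨_, y, rfl⟩
      obtain ⟨y, rfl⟩ := Submodule.Quotient.mk_surjective _ y
      exact ⟨⟨p n y, y, rfl⟩, rfl⟩
    have IK := ih (ker f) pK hpK hKfin (fun x hx => by
        have h := hT x (Finset.mem_insert_of_mem hx)
        exact ⟨fun n y => Subtype.ext (h.1 n y), fun y => Subtype.ext (h.2 y)⟩) (by
        rintro x hx hxT ⟨y, hy⟩
        by_cases hxt : x = t
        · subst hxt; exact Subtype.ext hy
        · exact Subtype.ext (hkill x hx (by simp [hxt, hxT]) y))
    have IC := ih (M ⧸ range f) pC hpC hCfin (fun x hx => by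
        have h := hT x (Finset.mem_insert_of_mem hx)
        refine ⟨fun n y => ?_, fun y => ?_⟩
        · obtain ⟨y, rfl⟩ := Submodule.Quotient.mk_surjective _ y
          exact congrArg Submodule.Quotient.mk (h.1 n y)
        · obtain ⟨y, rfl⟩ := Submodule.Quotient.mk_surjective _ y
          exact congrArg Submodule.Quotient.mk (h.2 y)) (by
        intro x hx hxT y
        obtain ⟨y, rfl⟩ := Submodule.Quotient.mk_surjective _ y
        by_cases hxt : x = t
        · subst hxt
          rw [← Submodule.Quotient.mk_smul]
          exact (Submodule.Quotient.mk_eq_zero _).2 ⟨y, rfl⟩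
        · rw [← Submodule.Quotient.mk_smul, hkill x hx (by simp [hxt, hxT]) y]
          rfl)
    -- The first difference at `n` is the Hilbert function of the cokernel at `n + 1` minus that of
    -- the kernel at `n`.
    refine IsEventuallyPolynomial.of_succ_sub ((IC.shift.sub IK).congr (Eventually.of_forall
      fun n => ?_))
    have h := finrank_range_add_finrank_range hp fk (fun n y => hft.1 n y) n (pK n)
      (fun _ => rfl) (pC (n + 1)) (fun _ => rfl)
    have h' : (Module.finrank k (range (p (n + 1))) : ℚ) + Module.finrank k (range (pK n)) =
      Module.finrank k (range (pC (n + 1))) + Module.finrank k (range (p n)) := by exact_mod_cast h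
    linarith

/-! ### Lengths as vector space dimensions -/

/-- As `S = k + 𝔪` and `𝔪` kills `M`, the `S`-submodules of `M` are exactly its `k`-subspaces. -/
theorem Module.length_eq_length_of_smul_eq_zero {k S : Type*} [Field k] [CommRing S] [Algebra k S]
    {𝔪 : Ideal S} (hS : ∀ x : S, ∃ c : k, x - algebraMap k S c ∈ 𝔪) (M : Type*) [AddCommGroup M]
    [Module k M] [Module S M] [IsScalarTower k S M] (h : ∀ a ∈ 𝔪, ∀ y : M, a • y = 0) :
    Module.length S M = Module.length k M := by
  have hs : ∀ a : S, ∃ c : k, ∀ y : M, a • y = c • y := fun a => by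
    obtain ⟨c, hc⟩ := hS a
    refine ⟨c, fun y => ?_⟩
    have := h _ hc y
    rwa [sub_smul, algebraMap_smul, sub_eq_zero] at this
  let e : Submodule S M ≃o Submodule k M :=
    { toFun := Submodule.restrictScalars k
      invFun := fun U => { U.toAddSubmonoid with
        smul_mem' := fun a y hy => by
          obtain ⟨c, hc⟩ := hs a
          rw [hc]
          exact U.smul_mem c hy }
      left_inv := fun _ => rfl
      right_inv := fun _ => rfl
      map_rel_iff' := Iff.rfl }
  apply WithBot.coe_injective
  rw [Module.coe_length, Module.coe_length, Order.krullDim_eq_of_orderIso e]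

/-- If `S = k + 𝔪`, then the length of an `S`-module killed by a power of `𝔪` is its dimension. -/
theorem Module.length_eq_length_of_pow_smul_eq_zero {k S : Type*} [Field k] [CommRing S]
    [Algebra k S] {𝔪 : Ideal S} (hS : ∀ x : S, ∃ c : k, x - algebraMap k S c ∈ 𝔪) (n : ℕ)
    (M : Type*) [AddCommGroup M] [Module k M] [Module S M] [IsScalarTower k S M]
    (h : ∀ a ∈ 𝔪 ^ n, ∀ y : M, a • y = 0) :
    Module.length S M = Module.length k M := by
  induction n generalizing M with
  | zero =>
    have : Subsingleton M := ⟨fun x y => by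
      rw [← one_smul S x, ← one_smul S y, h 1 (by simp), h 1 (by simp)]⟩
    rw [Module.length_eq_zero, Module.length_eq_zero]
  | succ n ih =>
    -- `𝔪 ^ n M` is killed by `𝔪` and its quotient by `𝔪 ^ n`; both lengths are additive.
    let N : Submodule S M := 𝔪 ^ n • ⊤
    have e1 := Module.length_eq_add_of_exact N.subtype N.mkQ N.injective_subtype
      N.mkQ_surjective (LinearMap.exact_subtype_mkQ N)
    have e2 := Module.length_eq_add_of_exact (N.subtype.restrictScalars k)
      (N.mkQ.restrictScalars k) N.injective_subtype
      N.mkQ_surjective (LinearMap.exact_subtype_mkQ N)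
    rw [e1, e2, ih (M ⧸ N)]
    · rw [Module.length_eq_length_of_smul_eq_zero hS N]
      rintro a ha ⟨y, hy⟩
      apply Subtype.ext
      change a • y = 0
      induction hy using Submodule.smul_induction_on' with
      | smul b hb y _ =>
        rw [← mul_smul]
        refine h _ ?_ y
        rw [_root_.pow_succ']
        exact Ideal.mul_mem_mul ha hb
      | add x _ y _ hx hy => rw [smul_add, hx, hy, add_zero]
    · intro a ha y
      obtain ⟨y, rfl⟩ := Submodule.Quotient.mk_surjective _ y
      rw [← Submodule.Quotient.mk_smul]
      exact (Submodule.Quotient.mk_eq_zero _).2 (Submodule.smul_mem_smul ha trivial)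

/-! ### Comparison of Samuel functions by Artin–Rees -/

theorem Module.length_quotient_le_of_le {S M : Type*} [CommRing S] [AddCommGroup M] [Module S M]
    {N N' : Submodule S M} (h : N ≤ N') : Module.length S (M ⧸ N') ≤ Module.length S (M ⧸ N) :=
  Module.length_le_of_surjective (Submodule.factor h) (Submodule.factor_surjective h)

/-- Comparison, by the Artin–Rees lemma, of the Samuel function of an ideal `N` with those of
quotient rings in which `N` is almost everything. -/
theorem exists_length_quotient_pow_smul_le {G : Type*} [CommRing G] [IsNoetherianRing G]
    (𝔞 M N : Ideal G) {J : ℕ} (hN : N ⊓ 𝔞 ^ J = ⊥) :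
    ∃ c : ℕ, ∀ n : ℕ, Module.length G (N ⧸ (M ^ n • ⊤ : Submodule G N)) ≤
      Module.length G (G ⧸ (𝔞 ^ J ⊔ M ^ (n + c))) := by
  -- `N` embeds into `G/𝔞^J` because `N ∩ 𝔞^J = 0`, and Artin–Rees is applied to its image there.
  let f : N →ₗ[G] G ⧸ 𝔞 ^ J := (Submodule.mkQ (𝔞 ^ J)) ∘ₗ Submodule.subtype N
  have hf : Function.Injective f := by
    rw [← LinearMap.ker_eq_bot, LinearMap.ker_eq_bot']
    rintro ⟨x, hx⟩ h
    have h1 : x ∈ 𝔞 ^ J := (Submodule.Quotient.mk_eq_zero _).1 h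
    have h2 : x ∈ N ⊓ 𝔞 ^ J := ⟨hx, h1⟩
    rw [hN] at h2
    exact Subtype.ext h2
  obtain ⟨c, hc⟩ := Ideal.exists_pow_inf_eq_pow_smul M (LinearMap.range f)
  refine ⟨c, fun n => ?_⟩
  let g : N →ₗ[G] G ⧸ (𝔞 ^ J ⊔ M ^ (n + c)) := (Submodule.mkQ _) ∘ₗ Submodule.subtype N
  -- An element of `N` in `𝔞^J + M^(n+c)` has image in `M^(n+c) (G/𝔞^J)`, hence in `M^n` times the
  -- image of `N`.
  have hker : LinearMap.ker g ≤ M ^ n • ⊤ := by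
    rintro ⟨x, hx⟩ h
    have h1 : x ∈ 𝔞 ^ J ⊔ M ^ (n + c) := (Submodule.Quotient.mk_eq_zero _).1 h
    obtain ⟨y, hy, z, hz, hyz⟩ := Submodule.mem_sup.1 h1
    have h2 : f ⟨x, hx⟩ ∈ M ^ (n + c) • (⊤ : Submodule G (G ⧸ 𝔞 ^ J)) ⊓ LinearMap.range f := by
      refine ⟨?_, ⟨_, rfl⟩⟩
      have : f ⟨x, hx⟩ = z • (Submodule.Quotient.mk 1 : G ⧸ 𝔞 ^ J) := by
        rw [← Submodule.Quotient.mk_smul, smul_eq_mul, mul_one]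
        refine (Submodule.Quotient.eq _).2 ?_
        change x - z ∈ _
        rwa [← hyz, add_sub_cancel_right]
      rw [this]
      exact Submodule.smul_mem_smul hz trivial
    rw [hc (n + c) (by omega), Nat.add_sub_cancel] at h2
    have h3 : f ⟨x, hx⟩ ∈ M ^ n • (⊤ : Submodule G N).map f := by
      rw [Submodule.map_top]
      exact Submodule.smul_mono le_rfl inf_le_right h2
    rw [← Submodule.map_smul''] at h3
    obtain ⟨w, hw, hw2⟩ := h3
    rwa [← hf hw2]
  calc _ ≤ Module.length G (N ⧸ LinearMap.ker g) := Module.length_quotient_le_of_le hker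
    _ ≤ _ := Module.length_le_of_injective _ (LinearMap.ker_eq_bot.1 (Submodule.ker_liftQ_eq_bot'
        _ g rfl))

/-- The reverse comparison: `N/M^n N` maps to `G/(K + M^n)`, and since `a ∈ N` the cokernel is a
quotient of `G/(K + M^n + (a))`. -/
theorem length_quotient_sup_pow_le {G : Type*} [CommRing G]
    (K M N : Ideal G) {a : G} (ha : a ∈ N) (n : ℕ) :
    Module.length G (G ⧸ (K ⊔ M ^ n)) ≤ Module.length G (N ⧸ (M ^ n • ⊤ : Submodule G N)) +
      Module.length G (G ⧸ (K ⊔ M ^ n ⊔ Ideal.span {a})) := by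
  let g : N →ₗ[G] G ⧸ (K ⊔ M ^ n) := (Submodule.mkQ _) ∘ₗ Submodule.subtype N
  have hg : (M ^ n • ⊤ : Submodule G N) ≤ LinearMap.ker g := by
    rw [Submodule.smul_le]
    intro r hr y _
    exact (Submodule.Quotient.mk_eq_zero _).2
      ((le_sup_right : M ^ n ≤ K ⊔ M ^ n) (Ideal.mul_mem_right _ _ hr))
  let g' := Submodule.liftQ _ g hg
  let L := LinearMap.range g'
  rw [Module.length_eq_add_of_exact L.subtype L.mkQ L.injective_subtype
      L.mkQ_surjective (LinearMap.exact_subtype_mkQ L)]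
  refine add_le_add ?_ ?_
  · exact Module.length_le_of_surjective g'.rangeRestrict g'.surjective_rangeRestrict
  · let q : G →ₗ[G] (G ⧸ (K ⊔ M ^ n)) ⧸ L := L.mkQ ∘ₗ Submodule.mkQ _
    have hq : (K ⊔ M ^ n ⊔ Ideal.span {a} : Ideal G) ≤ LinearMap.ker q := by
      refine sup_le (fun x hx => ?_) ?_
      · change L.mkQ (Submodule.Quotient.mk x) = 0
        rw [(Submodule.Quotient.mk_eq_zero _).2 hx, map_zero]
      · rw [Ideal.span_singleton_le_iff_mem]
        refine (Submodule.Quotient.mk_eq_zero _).2 ?_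
        exact ⟨Submodule.Quotient.mk ⟨a, ha⟩, rfl⟩
    refine Module.length_le_of_surjective (Submodule.liftQ _ q hq) ?_
    intro y
    obtain ⟨y, rfl⟩ := L.mkQ_surjective y
    obtain ⟨y, rfl⟩ := Submodule.mkQ_surjective _ y
    exact ⟨Submodule.Quotient.mk y, rfl⟩

/-! ### The degree of the extension of quotient fields -/

/-- The degree of the extension of quotient fields of an algebraic extension of finite type is
finite, and it is the rank of the extension of rings. -/
theorem exists_fieldDegree_eq {A B K L : Type*} [CommRing A] [CommRing B] [IsDomain A] [IsDomain B]
    [Field K] [Field L] [Algebra A B] [Algebra.FiniteType A B] [Algebra.IsAlgebraic A B]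
    [FaithfulSMul A B] [Algebra A K] [IsFractionRing A K] [Algebra B L] [IsFractionRing B L]
    (g : K →+* L) (hg : ∀ x, g (algebraMap A K x) = algebraMap B L (algebraMap A B x)) :
    ∃ r : ℕ, fieldDegree g = r ∧
      Cardinal.lift.{u_4} (Module.rank A B) = r := by
  let _ : Algebra K L := g.toAlgebra
  let _ : Algebra A L := ((algebraMap B L).comp (algebraMap A B)).toAlgebra
  have h1 : IsScalarTower A B L := IsScalarTower.of_algebraMap_eq fun _ => rfl
  have h2 : IsScalarTower A K L := IsScalarTower.of_algebraMap_eq fun x => (hg x).symm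
  have e1 : Algebra.EssFiniteType B L :=
    Algebra.EssFiniteType.of_isLocalization _ (nonZeroDivisors B)
  have e2 : Algebra.EssFiniteType A L := Algebra.EssFiniteType.comp A B _
  have e3 : Algebra.EssFiniteType K L := Algebra.EssFiniteType.of_comp A _ _
  have halg2 : Algebra.IsAlgebraic K L := by
    have : Algebra.IsAlgebraic A L := by
      have : Algebra.IsAlgebraic B L := IsLocalization.isAlgebraic _ (nonZeroDivisors B)
      exact Algebra.IsAlgebraic.trans A B _
    exact Algebra.IsAlgebraic.extendScalars (IsFractionRing.injective A K)
  -- `L` is essentially of finite type over `K`, so it is generated as a field by finitely many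
  -- elements, all of them algebraic.
  have hfd : FiniteDimensional K L := by
    obtain ⟨T, hT⟩ := IntermediateField.fg_top (F := K) (E := L)
    have := IntermediateField.finiteDimensional_adjoin (K := K) (S := (T : Set L))
      fun x _ => (Algebra.IsAlgebraic.isAlgebraic x).isIntegral
    rw [hT] at this
    exact Module.Finite.of_surjective (IntermediateField.topEquiv (F := K)
      (E := L)).toLinearMap (IntermediateField.topEquiv).surjective
  have hrank := Algebra.IsAlgebraic.lift_rank_of_isFractionRing A K B L
  obtain ⟨r, hr⟩ : ∃ r : ℕ, Module.rank K L = r :=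
    Cardinal.lt_aleph0.1 (Module.rank_lt_aleph0 _ _)
  refine ⟨r, hr, ?_⟩
  rw [← hrank, hr, Cardinal.lift_natCast]

/-- The degree `[B : A]` is finite if `R` is algebraic over `A`; it is the maximal number of
`A`-linearly independent elements of `B`. -/
theorem exists_quotDegree_eq {k R : Type*} [Field k] [CommRing R] [IsDomain R] [Algebra k R]
    (A B : Subalgebra k R) (h : A ≤ B) [Algebra.FiniteType k B] [Algebra.IsAlgebraic A R] :
    ∃ r : ℕ, quotDegree A B h = r ∧
      (∃ b : Fin r → R, (∀ i, b i ∈ B) ∧ LinearIndependent A b) ∧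
      ∀ (ι : Type) [Fintype ι] (b : ι → R), (∀ i, b i ∈ B) → LinearIndependent A b →
        Fintype.card ι ≤ r := by
  let f : A →+* B := (Subalgebra.inclusion h).toRingHom
  have hf : Function.Injective f := Subalgebra.inclusion_injective h
  let _ : Algebra A B := f.toAlgebra
  have : FaithfulSMul A B := (faithfulSMul_iff_algebraMap_injective _ _).2 hf
  have : IsScalarTower k A B := IsScalarTower.of_algebraMap_eq fun _ => rfl
  have hsc : IsScalarTower A B R := IsScalarTower.of_algebraMap_eq fun _ => rfl
  have halg : Algebra.IsAlgebraic A B := by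
    refine ⟨fun x => ?_⟩
    have hx : IsAlgebraic A (algebraMap B R x) := Algebra.IsAlgebraic.isAlgebraic _
    exact (isAlgebraic_algebraMap_iff Subtype.val_injective).1 hx
  have hft : Algebra.FiniteType A B := Algebra.FiniteType.of_restrictScalars_finiteType k A B
  obtain ⟨r, hr, hrank⟩ := exists_fieldDegree_eq (A := A) (B := B)
    (IsFractionRing.map (K := FractionRing A) (L := FractionRing B) (j := f) hf)
    (fun x => IsLocalization.map_eq _ x)
  rw [Cardinal.lift_id] at hrank
  refine ⟨r, hr, ?_, ?_⟩
  · obtain ⟨S, hS, hli⟩ := exists_set_linearIndependent_of_isDomain A B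
    rw [hrank] at hS
    obtain ⟨e⟩ : Nonempty (Fin r ≃ S) := by
      rw [← Cardinal.lift_mk_eq', hS]
      simp
    refine ⟨fun i => ((e i : B) : R), fun i => (e i : B).2, ?_⟩
    exact (hli.comp e e.injective).map' (IsScalarTower.toAlgHom A B R).toLinearMap
      (LinearMap.ker_eq_bot.2 Subtype.val_injective)
  · intro ι _ b hb hli
    have h1 : LinearIndependent A (fun i => (⟨b i, hb i⟩ : B)) :=
      LinearIndependent.of_comp (IsScalarTower.toAlgHom A B R).toLinearMap hli
    have h2 := h1.cardinal_lift_le_rank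
    rw [hrank] at h2
    simpa using h2

/-! ### Homogeneous components of `k[V]` -/

theorem Algebra.mem_adjoin_iff_mem_iSup_pow {k R : Type*} [Field k] [CommRing R] [Algebra k R]
    (V : Submodule k R) (x : R) :
    x ∈ Algebra.adjoin k (V : Set R) ↔ x ∈ ⨆ n : ℕ, V ^ n := by
  constructor
  · intro hx
    induction hx using Algebra.adjoin_induction with
    | mem x hx => exact Submodule.mem_iSup_of_mem 1 (by simpa using hx)
    | algebraMap r =>
      refine Submodule.mem_iSup_of_mem 0 ?_
      rw [_root_.pow_zero, Submodule.one_eq_range]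
      exact ⟨r, rfl⟩
    | add x y _ _ hx hy => exact add_mem hx hy
    | mul x y _ _ hx hy =>
      have h : (⨆ n : ℕ, V ^ n) * (⨆ n : ℕ, V ^ n) ≤ ⨆ n : ℕ, V ^ n := by
        rw [Submodule.iSup_mul]
        refine iSup_le fun n => ?_
        rw [Submodule.mul_iSup]
        refine iSup_le fun m => ?_
        rw [← _root_.pow_add]
        exact le_iSup (fun n : ℕ => V ^ n) (n + m)
      exact h (Submodule.mul_mem_mul hx hy)
  · intro hx
    have h : (⨆ n : ℕ, V ^ n) ≤ Subalgebra.toSubmodule (Algebra.adjoin k (V : Set R)) := by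
      refine iSup_le fun n => ?_
      induction n with
      | zero =>
        rw [_root_.pow_zero, Submodule.one_le]
        exact one_mem (Algebra.adjoin k (V : Set R))
      | succ n ih =>
        rw [_root_.pow_succ, Submodule.mul_le]
        exact fun x hx y hy => mul_mem (S := Subalgebra k R) (ih hx) (Algebra.subset_adjoin hy)
    exact h hx

theorem Algebra.pow_le_adjoin {k R : Type*} [Field k] [CommRing R] [Algebra k R]
    (V : Submodule k R) (n : ℕ) {x : R} (hx : x ∈ V ^ n) : x ∈ Algebra.adjoin k (V : Set R) :=
  (Algebra.mem_adjoin_iff_mem_iSup_pow V x).2 (Submodule.mem_iSup_of_mem n hx)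

section Graded

variable {k R : Type*} [Field k] [CommRing R] [Algebra k R] (𝒜 : ℕ → Submodule k R)
  [GradedAlgebra 𝒜]

open GradedAlgebra (proj)

theorem proj_of_mem {n : ℕ} {x : R} (hx : x ∈ 𝒜 n) : proj 𝒜 n x = x :=
  DirectSum.decompose_of_mem_same 𝒜 hx

theorem proj_of_mem_ne {n m : ℕ} {x : R} (hx : x ∈ 𝒜 n) (h : n ≠ m) : proj 𝒜 m x = 0 :=
  DirectSum.decompose_of_mem_ne 𝒜 hx h

theorem proj_mem (n : ℕ) (x : R) : proj 𝒜 n x ∈ 𝒜 n := SetLike.coe_mem _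

theorem proj_mul_of_mem {m : ℕ} {y : R} (hy : y ∈ 𝒜 m) (n : ℕ) (x : R) :
    proj 𝒜 (n + m) (x * y) = proj 𝒜 n x * y :=
  DirectSum.coe_decompose_mul_add_of_right_mem 𝒜 hy

theorem eq_zero_of_proj_eq_zero {x : R} (h : ∀ n, proj 𝒜 n x = 0) : x = 0 := by
  apply (DirectSum.decompose 𝒜).injective
  rw [DirectSum.decompose_zero]
  ext n
  exact h n

theorem graded_mul_le (a b : ℕ) : 𝒜 a * 𝒜 b ≤ 𝒜 (a + b) :=
  Submodule.mul_le.2 fun _ hx _ hy => SetLike.mul_mem_graded hx hy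

variable {𝒜}

theorem pow_le_graded {V : Submodule k R} {d : ℕ} (hV : V ≤ 𝒜 d) (n : ℕ) : V ^ n ≤ 𝒜 (n * d) := by
  induction n with
  | zero =>
    rw [_root_.pow_zero, zero_mul, Submodule.one_le]
    exact SetLike.one_mem_graded 𝒜
  | succ n ih =>
    rw [_root_.pow_succ, Nat.succ_mul]
    exact (mul_le_mul' ih hV).trans (graded_mul_le 𝒜 _ _)

/-- Since `0 < d`, the powers of `V` lie in pairwise different degrees, so only `V ^ n` contributes
to degree `n * d`. -/
theorem proj_mem_pow {V : Submodule k R} {d : ℕ} (hd : 0 < d) (hV : V ≤ 𝒜 d) {x : R}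
    (hx : x ∈ Algebra.adjoin k (V : Set R)) (n : ℕ) : proj 𝒜 (n * d) x ∈ V ^ n := by
  rw [Algebra.mem_adjoin_iff_mem_iSup_pow] at hx
  refine Submodule.iSup_induction _ (motive := fun x => proj 𝒜 (n * d) x ∈ V ^ n) hx ?_ ?_ ?_
  · intro m x hx
    by_cases h : m = n
    · subst h
      rwa [proj_of_mem 𝒜 (pow_le_graded hV m hx)]
    · rw [proj_of_mem_ne 𝒜 (pow_le_graded hV m hx)]
      · exact zero_mem _
      · exact fun h' => h (Nat.eq_of_mul_eq_mul_right hd h')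
  · simp
  · intro x y hx hy
    rw [map_add]
    exact add_mem hx hy

theorem exists_proj_ne_zero {V : Submodule k R} {d : ℕ} (hV : V ≤ 𝒜 d) {x : R}
    (hx : x ∈ Algebra.adjoin k (V : Set R)) (h0 : x ≠ 0) : ∃ n, proj 𝒜 (n * d) x ≠ 0 := by
  by_contra! h
  refine h0 (eq_zero_of_proj_eq_zero 𝒜 fun m => ?_)
  by_cases hm : ∃ n, n * d = m
  · obtain ⟨n, rfl⟩ := hm
    exact h n
  · rw [Algebra.mem_adjoin_iff_mem_iSup_pow] at hx
    refine Submodule.iSup_induction _ (motive := fun x => proj 𝒜 m x = 0) hx ?_ ?_ ?_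
    · intro n x hx
      exact proj_of_mem_ne 𝒜 (pow_le_graded hV n hx) fun h' => hm ⟨n, h'⟩
    · simp
    · intro x y hx hy
      rw [map_add, hx, hy, add_zero]

/-- A torsion relation `a r = ∑ c_i g_i` among forms can be made homogeneous: all of `r` and `g_i`
have degree `j`, so its component of degree `e d + j` involves only the components of `a` and `c_i`
in `V^e`. The exponent `e` is chosen so that this component of `a` is nonzero. -/
theorem exists_mem_pow_mul_mem {V : Submodule k R} {d : ℕ} (hd : 0 < d) (hV : V ≤ 𝒜 d) {m j : ℕ} {g : Fin m → R}
    (hg : ∀ i, g i ∈ 𝒜 j) {r a : R} (hr : r ∈ 𝒜 j) (ha : a ∈ Algebra.adjoin k (V : Set R))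
    (ha0 : a ≠ 0) (h : a * r ∈ Submodule.span (Algebra.adjoin k (V : Set R)) (Set.range g)) :
    ∃ e, ∃ b ∈ V ^ e, b ≠ 0 ∧ b * r ∈ V ^ e * Submodule.span k (Set.range g) := by
  obtain ⟨e, he⟩ := exists_proj_ne_zero hV ha ha0
  refine ⟨e, _, proj_mem_pow hd hV ha e, he, ?_⟩
  rw [← proj_mul_of_mem 𝒜 hr]
  obtain ⟨c, hc⟩ := (Submodule.mem_span_range_iff_exists_fun _).1 h
  rw [← hc, map_sum]
  refine sum_mem fun i _ => ?_
  change proj 𝒜 (e * d + j) ((c i : R) * g i) ∈ _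
  rw [proj_mul_of_mem 𝒜 (hg i)]
  exact Submodule.mul_mem_mul (proj_mem_pow hd hV (c i).2 e)
    (Submodule.subset_span (Set.mem_range_self i))

end Graded

/-! ### Standard graded algebras -/

namespace IsStandardGraded

variable {k R : Type*} [Field k] [CommRing R] [Algebra k R] {𝒜 : ℕ → Submodule k R}
  [GradedAlgebra 𝒜] (hstd : IsStandardGraded 𝒜)

include hstd

theorem pow_one (n : ℕ) : 𝒜 1 ^ n = 𝒜 n := by
  refine le_antisymm ((pow_le_graded (𝒜 := 𝒜) le_rfl n).trans_eq (by rw [mul_one])) fun x hx => ?_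
  have h := proj_mem_pow (𝒜 := 𝒜) one_pos le_rfl (x := x)
    (by rw [hstd.generated]; exact Algebra.mem_top) n
  rwa [mul_one, proj_of_mem 𝒜 hx] at h

theorem mul_eq (a b : ℕ) : 𝒜 a * 𝒜 b = 𝒜 (a + b) := by
  rw [← hstd.pow_one, ← hstd.pow_one b, ← _root_.pow_add, hstd.pow_one]

theorem pow_eq (a b : ℕ) : 𝒜 a ^ b = 𝒜 (a * b) := by
  rw [← hstd.pow_one, ← _root_.pow_mul, hstd.pow_one]

theorem fg (n : ℕ) : (𝒜 n).FG := by
  rw [← hstd.pow_one]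
  exact (Module.Finite.iff_fg.1 hstd.degree_one_finite).pow n

theorem finite (n : ℕ) : Module.Finite k (𝒜 n) := Module.Finite.iff_fg.2 (hstd.fg n)

theorem fg_of_le {n : ℕ} {W : Submodule k R} (h : W ≤ 𝒜 n) : W.FG := by
  have := hstd.finite n
  exact Module.Finite.iff_fg.1 (Submodule.finiteDimensional_of_le h)

end IsStandardGraded

theorem finiteType_adjoin {k R : Type*} [Field k] [CommRing R] [Algebra k R]
    {V : Submodule k R} (hV : V.FG) : Algebra.FiniteType k (Algebra.adjoin k (V : Set R)) := by
  obtain ⟨T, hT⟩ := hV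
  rw [← Subalgebra.fg_iff_finiteType]
  refine ⟨T, ?_⟩
  rw [← hT, Algebra.adjoin_span]

/-! ### Rank over a subalgebra -/

/-- The maximal number of elements of `W` which are linearly independent over `A`. -/
noncomputable def submoduleRank {k R : Type*} [Field k] [CommRing R] [Algebra k R]
    (A : Subalgebra k R) (W : Submodule k R) : ℕ :=
  sSup {m | ∃ g : Fin m → R, (∀ i, g i ∈ W) ∧ LinearIndependent A g}

section Rank

variable {k R : Type*} [Field k] [CommRing R] [IsDomain R] [Algebra k R] {A : Subalgebra k R}

/-- This bounds the set whose supremum is `submoduleRank`, so that the supremum is attained. -/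
theorem le_finrank_of_linearIndependent {W : Submodule k R} (hW : W.FG) {m : ℕ} {g : Fin m → R}
    (hg : ∀ i, g i ∈ W) (hli : LinearIndependent A g) : m ≤ Module.finrank k W := by
  have := Module.Finite.iff_fg.2 hW
  have h1 : LinearIndependent k g := hli.restrict_scalars (by
    intro a b h
    have h' : algebraMap k R a = algebraMap k R b := by
      simpa [Algebra.smul_def] using congrArg (Subtype.val : A → R) h
    exact (algebraMap k R).injective h')
  have h2 : LinearIndependent k (fun i => (⟨g i, hg i⟩ : W)) :=
    LinearIndependent.of_comp W.subtype h1
  simpa using h2.fintype_card_le_finrank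

theorem le_submoduleRank {W : Submodule k R} (hW : W.FG) {m : ℕ} {g : Fin m → R}
    (hg : ∀ i, g i ∈ W) (hli : LinearIndependent A g) : m ≤ submoduleRank A W :=
  le_csSup ⟨_, fun _ ⟨_, hg, hli⟩ => le_finrank_of_linearIndependent hW hg hli⟩ ⟨g, hg, hli⟩

theorem exists_linearIndependent_submoduleRank (A : Subalgebra k R) {W : Submodule k R}
    (hW : W.FG) :
    ∃ g : Fin (submoduleRank A W) → R, (∀ i, g i ∈ W) ∧ LinearIndependent A g := by
  have : submoduleRank A W ∈ {m | ∃ g : Fin m → R, (∀ i, g i ∈ W) ∧ LinearIndependent A g} := by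
    refine Nat.sSup_mem ⟨0, Fin.elim0, fun i => i.elim0, linearIndependent_empty_type⟩
      ⟨_, fun _ ⟨_, hg, hli⟩ => le_finrank_of_linearIndependent hW hg hli⟩
  exact this

/-- A maximal independent family spans up to torsion. -/
theorem exists_mul_mem_span {W : Submodule k R} (hW : W.FG) {g : Fin (submoduleRank A W) → R}
    (hg : ∀ i, g i ∈ W) (hli : LinearIndependent A g) {r : R} (hr : r ∈ W) :
    ∃ a ∈ A, a ≠ 0 ∧ a * r ∈ Submodule.span A (Set.range g) := by
  by_contra! h
  have h1 : LinearIndependent A (Fin.cons r g : Fin (submoduleRank A W + 1) → R) := by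
    refine LinearIndependent.finCons' r g hli fun c y hy hcy => ?_
    by_contra hc
    refine h c c.2 (fun h0 => hc (Subtype.ext h0)) ?_
    have : (c : R) * r = -y := eq_neg_of_add_eq_zero_left hcy
    rw [this]
    exact neg_mem hy
  have h2 := le_submoduleRank hW (fun i => by
    refine Fin.cases ?_ (fun i => ?_) i
    · simpa using hr
    · simpa using hg i) h1
  omega

theorem linearIndependent_mul {ι : Type*} {g : ι → R} {x : R} (hx : x ≠ 0)
    (hli : LinearIndependent A g) : LinearIndependent A fun i => x * g i := by
  refine hli.map' (LinearMap.mulLeft A x) (LinearMap.ker_eq_bot.2 ?_)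
  exact mul_right_injective₀ hx

end Rank

/-! ### The rank of `A R_j` -/

section GradedRank

variable {k R : Type*} [Field k] [CommRing R] [IsDomain R] [Algebra k R] {𝒜 : ℕ → Submodule k R}
  [GradedAlgebra 𝒜] {V : Submodule k R} {d : ℕ}

open GradedAlgebra (proj)

/-- A common denominator for finitely many generators is the product of their denominators; the
exponents add up, so the product is again homogeneous. -/
theorem exists_mem_pow_forall_mul_mem {W U : Submodule k R} (hW : W.FG)
    (h : ∀ r ∈ W, ∃ e, ∃ b ∈ V ^ e, b ≠ 0 ∧ b * r ∈ V ^ e * U) :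
    ∃ e, ∃ b ∈ V ^ e, b ≠ 0 ∧ ∀ r ∈ W, b * r ∈ V ^ e * U := by
  classical
  obtain ⟨T, hT⟩ := hW
  have key : ∀ T' ⊆ T, ∃ e, ∃ b ∈ V ^ e, b ≠ 0 ∧ ∀ r ∈ T', b * r ∈ V ^ e * U := by
    intro T'
    induction T' using Finset.induction_on with
    | empty => exact fun _ => ⟨0, 1, by simp [Submodule.one_le.1 le_rfl], one_ne_zero, by simp⟩
    | insert t T' _ ih =>
      intro hsub
      obtain ⟨e, b, hb, hb0, hbr⟩ := ih ((Finset.subset_insert _ _).trans hsub)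
      obtain ⟨e', b', hb', hb0', hbr'⟩ := h t (hT ▸ Submodule.subset_span
        (hsub (Finset.mem_insert_self t T')))
      refine ⟨e + e', b * b', ?_, mul_ne_zero hb0 hb0', fun r hr => ?_⟩
      · rw [_root_.pow_add]
        exact Submodule.mul_mem_mul hb hb'
      · rcases Finset.mem_insert.1 hr with rfl | hr
        · rw [mul_assoc, _root_.pow_add, mul_assoc]
          exact Submodule.mul_mem_mul hb hbr'
        · rw [mul_comm b, mul_assoc, add_comm, _root_.pow_add, mul_assoc]
          exact Submodule.mul_mem_mul hb' (hbr r hr)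
  obtain ⟨e, b, hb, hb0, hbr⟩ := key T subset_rfl
  refine ⟨e, b, hb, hb0, fun r hr => ?_⟩
  have : W ≤ (V ^ e * U).comap (LinearMap.mulLeft k b) := by
    rw [← hT, Submodule.span_le]
    exact hbr
  exact this hr

/-- One form `b` of `A` moves all of `R_j` into the free `A`-module on a maximal independent family.
Both the growth of `A R_j` and the localized Rees algebra are controlled by this `b`. -/
theorem exists_denominator (hd : 0 < d) (hV : V ≤ 𝒜 d) {j : ℕ} (hfg : (𝒜 j).FG)
    {g : Fin (submoduleRank (Algebra.adjoin k (V : Set R)) (𝒜 j)) → R}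
    (hg : ∀ i, g i ∈ 𝒜 j) (hli : LinearIndependent (Algebra.adjoin k (V : Set R)) g) :
    ∃ e, ∃ b ∈ V ^ e, b ≠ 0 ∧ ∀ r ∈ 𝒜 j, b * r ∈ V ^ e * Submodule.span k (Set.range g) :=
  exists_mem_pow_forall_mul_mem hfg fun r hr => by
    obtain ⟨a, ha, ha0, har⟩ := exists_mul_mem_span hfg hg hli hr
    exact exists_mem_pow_mul_mem hd hV hg hr ha ha0 har

/-- The rank, defined with elements of `W`, also bounds independent families in the `A`-module `A
W`: a common denominator `a` moves `A W` into the span of `submoduleRank A W` elements. -/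
theorem card_le_submoduleRank {A : Subalgebra k R} {W : Submodule k R} (hW : W.FG) {m : ℕ}
    {b : Fin m → R} (hb : ∀ i, b i ∈ Submodule.span A (W : Set R)) (hli : LinearIndependent A b) :
    m ≤ submoduleRank A W := by
  obtain ⟨g, hg, hgli⟩ := exists_linearIndependent_submoduleRank A hW
  obtain ⟨a, ha0, ha⟩ : ∃ a : A, a ≠ 0 ∧ ∀ r ∈ W, a • r ∈ Submodule.span A (Set.range g) := by
    classical
    obtain ⟨T, hT⟩ := hW
    have key : ∀ T' ⊆ T, ∃ a : A, a ≠ 0 ∧ ∀ r ∈ T', a • r ∈ Submodule.span A (Set.range g) := by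
      intro T'
      induction T' using Finset.induction_on with
      | empty => exact fun _ => ⟨1, one_ne_zero, by simp⟩
      | insert t T' _ ih =>
        intro hsub
        obtain ⟨a, ha0, ha⟩ := ih ((Finset.subset_insert _ _).trans hsub)
        obtain ⟨b, hb, hb0, hbr⟩ := exists_mul_mem_span (A := A) ⟨T, hT⟩ hg hgli
          (hT ▸ Submodule.subset_span (hsub (Finset.mem_insert_self t T')) : t ∈ W)
        refine ⟨a * ⟨b, hb⟩, mul_ne_zero ha0 fun h => hb0 (congrArg Subtype.val h),
          fun r hr => ?_⟩
        rcases Finset.mem_insert.1 hr with rfl | hr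
        · rw [mul_smul]
          exact Submodule.smul_mem _ a hbr
        · rw [mul_comm, mul_smul]
          exact Submodule.smul_mem _ _ (ha r hr)
    obtain ⟨a, ha0, ha⟩ := key T subset_rfl
    refine ⟨a, ha0, fun r hr => ?_⟩
    have : W ≤ ((Submodule.span A (Set.range g)).restrictScalars k).comap
        (LinearMap.mulLeft k (a : R)) := by
      exact hT.ge.trans (Submodule.span_le.2 ha)
    exact this hr
  have h1 : ∀ y ∈ Submodule.span A (W : Set R), (a : R) * y ∈ Submodule.span A (Set.range g) := by
    intro y hy
    have : Submodule.span A (W : Set R) ≤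
        (Submodule.span A (Set.range g)).comap (LinearMap.mulLeft A (a : R)) := by
      rw [Submodule.span_le]
      exact ha
    exact this hy
  have h2 := linearIndependent_mul (A := A) (x := (a : R)) (fun h => ha0 (Subtype.ext h)) hli
  have h3 : LinearIndependent A
      (fun i => (⟨(a : R) * b i, h1 _ (hb i)⟩ : Submodule.span A (Set.range g))) :=
    LinearIndependent.of_comp (Submodule.span A (Set.range g)).subtype h2
  have : Module.Finite A (Submodule.span A (Set.range g)) :=
    Module.Finite.span_of_finite A (Set.finite_range g)
  have h4 := h3.fintype_card_le_finrank
  have h5 := finrank_range_le_card (R := A) g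
  unfold Set.finrank at h5
  simp only [Fintype.card_fin] at h4 h5
  exact h4.trans h5

variable (hstd : IsStandardGraded 𝒜)

include hstd

/-- The rank over `A` of the `A`-module generated by `R_j` is `[B : A]` for `j ≫ 0`. -/
theorem exists_forall_submoduleRank_eq (hd : 0 < d) (hV : V ≤ 𝒜 d) (hV0 : V ≠ ⊥) {r : ℕ}
    (h1 : ∃ b : Fin r → R, (∀ i, b i ∈ veroneseSubalgebra 𝒜 d) ∧
      LinearIndependent (Algebra.adjoin k (V : Set R)) b)
    (h2 : ∀ (m : ℕ) (b : Fin m → R), (∀ i, b i ∈ veroneseSubalgebra 𝒜 d) →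
      LinearIndependent (Algebra.adjoin k (V : Set R)) b → m ≤ r) :
    (∀ j, submoduleRank (Algebra.adjoin k (V : Set R)) (𝒜 j) ≤ r) ∧
    ∃ j₀, ∀ j, j₀ ≤ j → submoduleRank (Algebra.adjoin k (V : Set R)) (𝒜 j) = r := by
  obtain ⟨f, hf, hf0⟩ := Submodule.exists_mem_ne_zero_of_ne_bot hV0
  have hpow : ∀ n, f ^ n ∈ 𝒜 (n * d) := fun n =>
    pow_le_graded hV n (Submodule.pow_mem_pow _ hf n)
  obtain ⟨x, hx, hx0⟩ : ∃ x ∈ 𝒜 1, x ≠ 0 := by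
    refine Submodule.exists_mem_ne_zero_of_ne_bot fun h => hf0 ?_
    have := hV hf
    rw [← hstd.pow_one, h, ← Submodule.zero_eq_bot, zero_pow hd.ne'] at this
    exact this
  have hxpow : ∀ n, x ^ n ∈ 𝒜 n := fun n => by
    have := Submodule.pow_mem_pow _ hx n
    rwa [hstd.pow_one] at this
  have hle : ∀ j, submoduleRank (Algebra.adjoin k (V : Set R)) (𝒜 j) ≤ r := by
    intro j
    obtain ⟨g, hg, hli⟩ := exists_linearIndependent_submoduleRank
      (Algebra.adjoin k (V : Set R)) (hstd.fg j)
    -- The factor `x ^ (d * j - j)` moves `R_j` into `R_{dj} = (R_d)^j ⊆ B`.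
    refine h2 _ _ (fun i => ?_) (linearIndependent_mul (pow_ne_zero (d * j - j) hx0) hli)
    have hm : x ^ (d * j - j) * g i ∈ 𝒜 d ^ j := by
      rw [hstd.pow_eq]
      have := SetLike.mul_mem_graded (hxpow (d * j - j)) (hg i)
      rwa [Nat.sub_add_cancel (Nat.le_mul_of_pos_left j hd)] at this
    exact Algebra.pow_le_adjoin _ j hm
  refine ⟨hle, ?_⟩
  obtain ⟨b, hb, hli⟩ := h1
  -- For `y ∈ (R_d)^n` and `n ≤ m`, write `f^m y = f^n (f^(m-n) y)`, with `f^n ∈ A` and `f^(m-n) y`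
  -- homogeneous of degree `m d`.
  have hex : ∀ y ∈ veroneseSubalgebra 𝒜 d, ∃ m₀, ∀ m, m₀ ≤ m →
      f ^ m * y ∈ Submodule.span (Algebra.adjoin k (V : Set R)) (𝒜 (m * d) : Set R) := by
    intro y hy
    rw [veroneseSubalgebra, Algebra.mem_adjoin_iff_mem_iSup_pow] at hy
    refine Submodule.iSup_induction _ (motive := fun y => ∃ m₀, ∀ m, m₀ ≤ m →
      f ^ m * y ∈ Submodule.span (Algebra.adjoin k (V : Set R)) (𝒜 (m * d) : Set R)) hy ?_ ?_ ?_
    · intro n y hy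
      refine ⟨n, fun m hm => ?_⟩
      have hy' : f ^ (m - n) * y ∈ 𝒜 (m * d) := by
        have := SetLike.mul_mem_graded (hpow (m - n)) (pow_le_graded (𝒜 := 𝒜) le_rfl n hy)
        rwa [← add_mul, Nat.sub_add_cancel hm] at this
      have e : f ^ m * y = f ^ n * (f ^ (m - n) * y) := by
        rw [← mul_assoc, ← _root_.pow_add, Nat.add_sub_cancel' hm]
      rw [e]
      exact Submodule.smul_mem _ (⟨f ^ n, pow_mem (Algebra.subset_adjoin hf) n⟩ :
        Algebra.adjoin k (V : Set R)) (Submodule.subset_span hy')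
    · exact ⟨0, by simp⟩
    · rintro y z ⟨a, ha⟩ ⟨b, hb⟩
      refine ⟨max a b, fun m hm => ?_⟩
      rw [mul_add]
      exact add_mem (ha m (le_of_max_le_left hm)) (hb m (le_of_max_le_right hm))
  choose m₀ hm₀ using fun i => hex (b i) (hb i)
  let m := Finset.univ.sup m₀
  refine ⟨m * d, fun j hj => le_antisymm (hle j) ?_⟩
  -- The power of `f` brings the basis of `B` into `A R_{md}`, and the power of the linear form `x`
  -- then reaches degrees `j` not divisible by `d`.
  refine card_le_submoduleRank (hstd.fg j) (b := fun i => x ^ (j - m * d) * (f ^ m * b i))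
    (fun i => ?_) (linearIndependent_mul (pow_ne_zero _ hx0)
      (linearIndependent_mul (pow_ne_zero m hf0) hli))
  have h3 := hm₀ i m (Finset.le_sup (Finset.mem_univ i))
  have h4 : Submodule.span (Algebra.adjoin k (V : Set R)) (𝒜 (m * d) : Set R) ≤
      (Submodule.span (Algebra.adjoin k (V : Set R)) (𝒜 j : Set R)).comap
        (LinearMap.mulLeft _ (x ^ (j - m * d))) := by
    rw [Submodule.span_le]
    intro y hy
    refine Submodule.subset_span ?_
    have := SetLike.mul_mem_graded (hxpow (j - m * d)) hy
    rwa [Nat.sub_add_cancel hj] at this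
  exact h4 h3

/-- For `j ≫ 0`, multiplication by `f ∈ V` is surjective up to torsion from `A R_j`
to `A R_{j + d}`. -/
theorem exists_mem_pow_mul_mem_mul (hd : 0 < d) (hV : V ≤ 𝒜 d) {f : R} (hf : f ∈ V) (hf0 : f ≠ 0)
    {j : ℕ} (hj : submoduleRank (Algebra.adjoin k (V : Set R)) (𝒜 (j + d)) =
      submoduleRank (Algebra.adjoin k (V : Set R)) (𝒜 j)) :
    ∃ e, ∃ b ∈ V ^ e, b ≠ 0 ∧ ∀ r ∈ 𝒜 (j + d), b * r ∈ V ^ e * (𝒜 j).map (LinearMap.mulLeft k f) := by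
  obtain ⟨g, hg, hli⟩ := exists_linearIndependent_submoduleRank
      (Algebra.adjoin k (V : Set R)) (hstd.fg j)
  have hli' := linearIndependent_mul hf0 hli
  have hg' : ∀ i, f * g i ∈ 𝒜 (j + d) := fun i => by
    rw [add_comm]
    exact SetLike.mul_mem_graded (hV hf) (hg i)
  -- As the ranks in degrees `j` and `j + d` agree, the elements `f * g i` form a maximal
  -- independent family of `R_{j+d}`.
  obtain ⟨e, b, hb, hb0, hbr⟩ := exists_denominator hd hV (hstd.fg (j + d))
    (g := fun i => f * g (Fin.cast hj i)) (fun i => hg' _)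
    (hli'.comp (Fin.cast hj) (Fin.cast_injective hj))
  refine ⟨e, b, hb, hb0, fun r hr => ?_⟩
  refine (mul_le_mul' le_rfl (Submodule.span_le.2 ?_) : _ ≤ _) (hbr r hr)
  rintro _ ⟨i, rfl⟩
  exact ⟨_, hg (Fin.cast hj i), rfl⟩

end GradedRank

/-! ### Ideals generated by subspaces -/

theorem Ideal.restrictScalars_span_submodule {k S : Type*} [Field k] [CommRing S] [Algebra k S]
    (U : Submodule k S) : (Ideal.span (U : Set S)).restrictScalars k = ⊤ * U := by
  apply le_antisymm
  · intro x hx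
    replace hx : x ∈ Ideal.span (U : Set S) := hx
    induction hx using Submodule.span_induction with
    | mem x hx =>
      have := Submodule.mul_mem_mul (Submodule.mem_top : (1 : S) ∈ (⊤ : Submodule k S)) hx
      rwa [one_mul] at this
    | zero => exact zero_mem _
    | add x y _ _ hx hy => exact add_mem hx hy
    | smul a x _ hx =>
      have h : (⊤ : Submodule k S) * (⊤ * U) ≤ ⊤ * U := by
        rw [← mul_assoc]
        exact mul_le_mul' le_top le_rfl
      exact h (Submodule.mul_mem_mul (Submodule.mem_top : a ∈ (⊤ : Submodule k S)) hx)
  · rw [Submodule.mul_le]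
    exact fun a _ u hu => Ideal.mul_mem_left _ a (Ideal.subset_span hu)

theorem Ideal.span_submodule_mul {k S : Type*} [Field k] [CommRing S] [Algebra k S]
    (U U' : Submodule k S) : Ideal.span (U : Set S) * Ideal.span (U' : Set S) =
      Ideal.span ((U * U' : Submodule k S) : Set S) := by
  apply le_antisymm
  · rw [Ideal.span_mul_span', Ideal.span_le]
    rintro _ ⟨x, hx, y, hy, rfl⟩
    exact Ideal.subset_span (Submodule.mul_mem_mul hx hy)
  · rw [Ideal.span_le]
    have : U * U' ≤
        (Ideal.span (U : Set S) * Ideal.span (U' : Set S)).restrictScalars k := by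
      rw [Submodule.mul_le]
      exact fun x hx y hy => Ideal.mul_mem_mul (Ideal.subset_span hx) (Ideal.subset_span hy)
    exact this

theorem Ideal.span_submodule_pow {k S : Type*} [Field k] [CommRing S] [Algebra k S]
    (U : Submodule k S) (n : ℕ) : Ideal.span (U : Set S) ^ n =
      Ideal.span ((U ^ n : Submodule k S) : Set S) := by
  induction n with
  | zero =>
    rw [_root_.pow_zero, _root_.pow_zero, Ideal.one_eq_top, eq_comm, Ideal.eq_top_iff_one]
    exact Ideal.subset_span (Submodule.one_le.1 le_rfl)
  | succ n ih => rw [_root_.pow_succ, ih, Ideal.span_submodule_mul, _root_.pow_succ]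

theorem Submodule.fg_one {k S : Type*} [Field k] [CommRing S] [Algebra k S] :
    (1 : Submodule k S).FG := by
  rw [Submodule.one_eq_span]
  exact Submodule.fg_span_singleton 1

/-! ### Limits under shifts of the index -/

section Growth

theorem tendsto_add_div_pow {s : ℕ} {a : ℕ → ℝ} {L : ℝ}
    (h : Tendsto (fun n : ℕ => a n / (n : ℝ) ^ s) atTop (𝓝 L)) (c : ℕ) :
    Tendsto (fun n : ℕ => a (n + c) / (n : ℝ) ^ s) atTop (𝓝 L) := by
  have h1 := h.comp (tendsto_add_atTop_nat c)
  have h2 : Tendsto (fun n : ℕ => (((n + c : ℕ) : ℝ) / (n : ℝ)) ^ s) atTop (𝓝 (1 ^ s)) := by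
    apply Tendsto.pow
    have h3 : Tendsto (fun n : ℕ => 1 + (c : ℝ) / (n : ℝ)) atTop (𝓝 (1 + 0)) :=
      tendsto_const_nhds.add (tendsto_const_div_atTop_nhds_zero_nat _)
    rw [add_zero] at h3
    refine h3.congr' ?_
    filter_upwards [eventually_gt_atTop 0] with n hn
    have : (n : ℝ) ≠ 0 := by positivity
    push_cast
    field_simp
  have h4 := h1.mul h2
  rw [one_pow, mul_one] at h4
  refine h4.congr' ?_
  filter_upwards [eventually_gt_atTop 0] with n hn
  have h5 : (n : ℝ) ≠ 0 := by positivity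
  have h6 : ((n + c : ℕ) : ℝ) ≠ 0 := by positivity
  simp only [Function.comp_apply, div_pow]
  field_simp

theorem tendsto_sub_div_pow {s : ℕ} {a : ℕ → ℝ} {L : ℝ}
    (h : Tendsto (fun n : ℕ => a n / (n : ℝ) ^ s) atTop (𝓝 L)) (c : ℕ) :
    Tendsto (fun n : ℕ => a (n - c) / (n : ℝ) ^ s) atTop (𝓝 L) := by
  rw [← tendsto_add_atTop_iff_nat c]
  have h2 : Tendsto (fun n : ℕ => ((n : ℝ) / ((n + c : ℕ) : ℝ)) ^ s) atTop (𝓝 (1 ^ s)) := by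
    apply Tendsto.pow
    have h3 : Tendsto (fun n : ℕ => 1 + (c : ℝ) / (n : ℝ)) atTop (𝓝 (1 + 0)) :=
      tendsto_const_nhds.add (tendsto_const_div_atTop_nhds_zero_nat _)
    have h4 := h3.inv₀ (by norm_num)
    rw [add_zero, inv_one] at h4
    refine h4.congr' ?_
    filter_upwards [eventually_gt_atTop 0] with n hn
    have : (n : ℝ) ≠ 0 := by positivity
    push_cast
    field_simp
  have h4 := h.mul h2
  rw [one_pow, mul_one] at h4
  refine h4.congr' ?_
  filter_upwards [eventually_gt_atTop 0] with n hn
  have h5 : (n : ℝ) ≠ 0 := by positivity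
  have h6 : ((n + c : ℕ) : ℝ) ≠ 0 := by positivity
  rw [Nat.add_sub_cancel, div_pow]
  field_simp

end Growth

/-! ### The Hilbert function of `k[V]` -/

section Adjoin

variable {k R : Type*} [Field k] [CommRing R] [Algebra k R] {𝒜 : ℕ → Submodule k R}
  [GradedAlgebra 𝒜] {V : Submodule k R} {d : ℕ}

open GradedAlgebra (proj)

/-- The projections of the graded algebra `k[V]` onto its homogeneous components. -/
noncomputable def adjoinProj (hd : 0 < d) (hV : V ≤ 𝒜 d) (n : ℕ) :
    Algebra.adjoin k (V : Set R) →ₗ[k] Algebra.adjoin k (V : Set R) :=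
  (proj 𝒜 (n * d)).restrict (p := Subalgebra.toSubmodule (Algebra.adjoin k (V : Set R)))
    (q := Subalgebra.toSubmodule (Algebra.adjoin k (V : Set R)))
    fun _ hx => Algebra.pow_le_adjoin V n (proj_mem_pow hd hV hx n)

theorem coe_adjoinProj (hd : 0 < d) (hV : V ≤ 𝒜 d) (n : ℕ) (x : Algebra.adjoin k (V : Set R)) :
    (adjoinProj hd hV n x : R) = proj 𝒜 (n * d) x := rfl

theorem isGradingProjection_adjoinProj (hd : 0 < d) (hV : V ≤ 𝒜 d) :
    IsGradingProjection (adjoinProj hd hV) := by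
  constructor
  · intro n m x
    apply Subtype.ext
    rw [coe_adjoinProj, coe_adjoinProj]
    split_ifs with h
    · rw [h, proj_of_mem 𝒜 (proj_mem 𝒜 _ _), coe_adjoinProj]
    · rw [proj_of_mem_ne 𝒜 (proj_mem 𝒜 (m * d) _)]
      · rfl
      · exact fun h' => h (Nat.eq_of_mul_eq_mul_right hd h').symm
  · rintro ⟨x, hx⟩
    have hx' := (Algebra.mem_adjoin_iff_mem_iSup_pow V x).1 hx
    obtain ⟨N, hN⟩ : ∃ N, ∀ N' ≥ N, x = ∑ n ∈ Finset.range N', proj 𝒜 (n * d) x := by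
      refine Submodule.iSup_induction _ (motive := fun x => ∃ N, ∀ N' ≥ N,
        x = ∑ n ∈ Finset.range N', proj 𝒜 (n * d) x) hx' ?_ ?_ ?_
      · intro m y hy
        have hy' := pow_le_graded hV m hy
        refine ⟨m + 1, fun N' hN' => ?_⟩
        rw [Finset.sum_eq_single m]
        · rw [proj_of_mem 𝒜 hy']
        · intro n _ hn
          exact proj_of_mem_ne 𝒜 hy' fun h' => hn (Nat.eq_of_mul_eq_mul_right hd h').symm
        · intro h
          exact absurd (Finset.mem_range.2 (by omega)) h
      · exact ⟨0, by simp⟩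
      · rintro y z ⟨a, ha⟩ ⟨b, hb⟩
        refine ⟨max a b, fun N' hN' => ?_⟩
        simp only [map_add, Finset.sum_add_distrib]
        rw [← ha N' (le_of_max_le_left hN'), ← hb N' (le_of_max_le_right hN')]
    refine ⟨N, Subtype.ext ?_⟩
    rw [AddSubmonoidClass.coe_finsetSum]
    exact hN N le_rfl

theorem map_range_adjoinProj (hd : 0 < d) (hV : V ≤ 𝒜 d) (n : ℕ) :
    (LinearMap.range (adjoinProj hd hV n)).map (Algebra.adjoin k (V : Set R)).val.toLinearMap =
      V ^ n := by
  ext x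
  constructor
  · rintro ⟨_, ⟨y, rfl⟩, rfl⟩
    exact proj_mem_pow hd hV y.2 n
  · intro hx
    refine ⟨⟨x, Algebra.pow_le_adjoin V n hx⟩, ⟨⟨x, Algebra.pow_le_adjoin V n hx⟩, ?_⟩, rfl⟩
    exact Subtype.ext (proj_of_mem 𝒜 (pow_le_graded hV n hx))

theorem finrank_range_adjoinProj (hd : 0 < d) (hV : V ≤ 𝒜 d) (n : ℕ) :
    Module.finrank k (LinearMap.range (adjoinProj hd hV n)) = Module.finrank k ↥(V ^ n) := by
  rw [← map_range_adjoinProj hd hV n]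
  exact (LinearEquiv.finrank_eq (Submodule.equivMapOfInjective _ Subtype.val_injective _))

/-- Hilbert–Serre for `k[V]` as a module over itself, regraded so that `V` has degree one. -/
theorem isEventuallyPolynomial_finrank_pow (hd : 0 < d) (hV : V ≤ 𝒜 d) (hfg : V.FG) :
    IsEventuallyPolynomial fun n => (Module.finrank k ↥(V ^ n) : ℚ) := by
  classical
  obtain ⟨T, hT⟩ := hfg
  have hft : Algebra.FiniteType k (Algebra.adjoin k (V : Set R)) := finiteType_adjoin ⟨T, hT⟩
  have hnoeth : IsNoetherianRing (Algebra.adjoin k (V : Set R)) :=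
    Algebra.FiniteType.isNoetherianRing k _
  have hTV : ∀ x ∈ T, x ∈ V := fun x hx => hT ▸ Submodule.subset_span hx
  have hadj : Algebra.adjoin k (V : Set R) = Algebra.adjoin k (T : Set R) := by
    rw [← hT, Algebra.adjoin_span]
  let T' : Finset (Algebra.adjoin k (V : Set R)) :=
    Finset.image (fun x : {x // x ∈ T} => ⟨x, Algebra.subset_adjoin (hTV x x.2)⟩) T.attach
  have hT' : Algebra.adjoin k (T' : Set (Algebra.adjoin k (V : Set R))) = ⊤ := by
    rw [← (Subalgebra.map_injective (f := (Algebra.adjoin k (V : Set R)).val)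
      Subtype.val_injective).eq_iff, ← Algebra.adjoin_image, Algebra.map_top, Subalgebra.range_val]
    refine Eq.trans (congrArg _ ?_) hadj.symm
    ext x
    simp only [T', Finset.coe_image, Set.mem_image, Finset.mem_coe, Finset.mem_attach, true_and]
    constructor
    · rintro ⟨_, ⟨y, rfl⟩, rfl⟩
      exact y.2
    · exact fun hx => ⟨_, ⟨⟨x, hx⟩, rfl⟩, rfl⟩
  have := isEventuallyPolynomial_finrank hT' T' (Algebra.adjoin k (V : Set R)) (adjoinProj hd hV)
    (isGradingProjection_adjoinProj hd hV) (fun n => by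
      have h1 : Module.Finite k ↥(V ^ n) := Module.Finite.iff_fg.2 (Submodule.FG.pow ⟨T, hT⟩ n)
      rw [← map_range_adjoinProj hd hV n] at h1
      exact Module.Finite.equiv (Submodule.equivMapOfInjective
        (Algebra.adjoin k (V : Set R)).val.toLinearMap Subtype.val_injective _).symm)
    (fun x hx => by
      obtain ⟨y, -, rfl⟩ := Finset.mem_image.1 hx
      have hy := hV (hTV y y.2)
      refine ⟨fun n z => Subtype.ext ?_, fun z => Subtype.ext ?_⟩
      · change proj 𝒜 ((n + 1) * d) ((y : R) * z) = (y : R) * proj 𝒜 (n * d) z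
        rw [mul_comm (y : R), Nat.succ_mul, proj_mul_of_mem 𝒜 hy, mul_comm]
      · change proj 𝒜 (0 * d) ((y : R) * z) = 0
        rw [zero_mul]
        exact DirectSum.coe_decompose_mul_of_left_mem_of_not_le 𝒜 hy (by omega))
    (fun x hx hx' => absurd hx hx')
  exact this.congr (Eventually.of_forall fun n => by simp only [finrank_range_adjoinProj])

/-- The spaces `V^i` with `i < n` all lie in `(k + V)^n` and have different degrees. The right-hand
side is the function bounded by `exists_finrank_pow_le`. -/
theorem sum_finrank_pow_le (hd : 0 < d) (hV : V ≤ 𝒜 d) (hfg : V.FG) (n : ℕ) :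
    ∑ i ∈ Finset.range n, Module.finrank k ↥(V ^ i) ≤ Module.finrank k ↥((1 ⊔ V) ^ n) := by
  have hfin : ∀ i, Module.Finite k ↥(V ^ i) := fun i => Module.Finite.iff_fg.2 (hfg.pow i)
  have hfin' : Module.Finite k ↥((1 ⊔ V) ^ n) :=
    Module.Finite.iff_fg.2 (Submodule.FG.pow (Submodule.FG.sup Submodule.fg_one hfg) n)
  have hle : ∀ i < n, V ^ i ≤ (1 ⊔ V) ^ n := fun i hi => by
    calc V ^ i = V ^ i * 1 ^ (n - i) := by rw [one_pow, mul_one]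
      _ ≤ (1 ⊔ V) ^ i * (1 ⊔ V) ^ (n - i) :=
        mul_le_mul' (pow_le_pow_left' le_sup_right _) (pow_le_pow_left' le_sup_left _)
      _ = (1 ⊔ V) ^ n := by rw [← _root_.pow_add, Nat.add_sub_cancel' hi.le]
  have hsum : ∑ i ∈ Finset.range n, Module.finrank k ↥(V ^ i) =
      Module.finrank k ((i : Fin n) → ↥(V ^ (i : ℕ))) := by
    rw [Module.finrank_pi_fintype, Finset.sum_range]
  rw [hsum]
  have hA : ((1 ⊔ V) ^ n : Submodule k R) ≤ Subalgebra.toSubmodule (Algebra.adjoin k (V : Set R)) := by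
    have h1 : (1 ⊔ V : Submodule k R) ≤ Subalgebra.toSubmodule (Algebra.adjoin k (V : Set R)) :=
      sup_le (Submodule.one_le.2 (one_mem (Algebra.adjoin k (V : Set R)))) Algebra.subset_adjoin
    have h2 : ∀ m : ℕ, (1 ⊔ V) ^ m ≤ Subalgebra.toSubmodule (Algebra.adjoin k (V : Set R)) := by
      intro m
      induction m with
      | zero =>
        rw [_root_.pow_zero]
        exact Submodule.one_le.2 (one_mem (Algebra.adjoin k (V : Set R)))
      | succ m ih =>
        rw [_root_.pow_succ, Submodule.mul_le]
        exact fun x hx y hy => mul_mem (S := Subalgebra k R) (ih hx) (h1 hy)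
    exact h2 n
  let ψ : ↥((1 ⊔ V) ^ n) →ₗ[k] ((i : Fin n) → ↥(V ^ (i : ℕ))) := LinearMap.pi fun i =>
    (proj 𝒜 (i * d)).restrict fun x hx => proj_mem_pow hd hV (hA hx) i
  refine LinearMap.finrank_le_finrank_of_surjective (f := ψ) fun v => ?_
  refine ⟨⟨∑ i, (v i : R), sum_mem fun i _ => hle i i.2 (v i).2⟩, ?_⟩
  ext i
  change proj 𝒜 (i * d) (∑ j, (v j : R)) = v i
  rw [map_sum, Finset.sum_eq_single i]
  · exact proj_of_mem 𝒜 (pow_le_graded hV i (v i).2)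
  · intro j _ hj
    exact proj_of_mem_ne 𝒜 (pow_le_graded hV j (v j).2)
      fun h => hj (Fin.ext (Nat.eq_of_mul_eq_mul_right hd h))
  · simp

/-- The Hilbert–Samuel limit of the graded algebra `k[V]`. -/
theorem exists_tendsto_sum_finrank_pow [Nontrivial R] (hd : 0 < d) (hV : V ≤ 𝒜 d) (hfg : V.FG)
    {s : ℕ} (hs : ringKrullDim (Algebra.adjoin k (V : Set R)) = s) :
    ∃ e : ℝ, Tendsto (fun n : ℕ =>
      (∑ i ∈ Finset.range n, (Module.finrank k ↥(V ^ i) : ℝ)) / (n : ℝ) ^ s) atTop (𝓝 e) := by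
  have hft := finiteType_adjoin hfg
  let ι := (Algebra.adjoin k (V : Set R)).val.toLinearMap
  -- The growth bound is applied inside `k[V]`, the algebra whose dimension is `s`; `V'` is the copy
  -- of `V` there.
  let V' : Submodule k (Algebra.adjoin k (V : Set R)) := V.comap ι
  have hV' : V'.map ι = V := by
    rw [Submodule.map_comap_eq, inf_eq_right]
    exact fun x hx => ⟨⟨x, Algebra.subset_adjoin hx⟩, rfl⟩
  have hfg' : V'.FG := (Submodule.fg_map_iff _ Subtype.val_injective).1 (hV' ▸ hfg)
  have hW : Module.Finite k ↥(1 ⊔ V') := Module.Finite.iff_fg.2 (Submodule.FG.sup Submodule.fg_one hfg')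
  obtain ⟨C, hC⟩ := exists_finrank_pow_le hs (1 ⊔ V')
  have hpoly : IsEventuallyPolynomial
      fun n => ∑ i ∈ Finset.range n, (Module.finrank k ↥(V ^ i) : ℚ) :=
    IsEventuallyPolynomial.of_succ_sub ((isEventuallyPolynomial_finrank_pow hd hV hfg).congr
      (Eventually.of_forall fun n => by simp [Finset.sum_range_succ]))
  obtain ⟨e, he⟩ := hpoly.exists_tendsto_div_pow (s := s) (C := C)
    (fun n => Finset.sum_nonneg fun _ _ => by positivity) (fun n hn => by
      have h1 := (sum_finrank_pow_le hd hV hfg n)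
      have h2 : ((1 ⊔ V) ^ n : Submodule k R) = ((1 ⊔ V') ^ n).map ι := by
        rw [Submodule.map_pow (f := (Algebra.adjoin k (V : Set R)).val), Submodule.map_sup,
          Submodule.map_one]
        congr 2
        exact hV'.symm
      rw [h2, ← LinearEquiv.finrank_eq (Submodule.equivMapOfInjective ι Subtype.val_injective _)]
        at h1
      exact_mod_cast h1.trans (hC n hn))
  exact ⟨e, he.congr fun n => by push_cast; rfl⟩

end Adjoin

/-! ### Growth of the `A`-modules `A R_j` -/

section RankGrowth

variable {k R : Type*} [Field k] [CommRing R] [IsDomain R] [Algebra k R] {𝒜 : ℕ → Submodule k R}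
  [GradedAlgebra 𝒜] {V : Submodule k R} {d : ℕ}

/-- Independence of `g` embeds the direct sum of copies of `V^i`, one for each `g l`, into `W V^i`.
-/
theorem mul_finrank_pow_le {A : Subalgebra k R} {W : Submodule k R}
    (hfg : V.FG) (hWfg : W.FG) (i : ℕ) (hVA : V ^ i ≤ Subalgebra.toSubmodule A) :
    submoduleRank A W * Module.finrank k ↥(V ^ i) ≤ Module.finrank k ↥(W * V ^ i) := by
  obtain ⟨g, hg, hli⟩ := exists_linearIndependent_submoduleRank A hWfg
  have h1 : Module.Finite k ↥(W * V ^ i) := Module.Finite.iff_fg.2 (hWfg.mul (hfg.pow i))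
  have h2 : Module.Finite k ↥(V ^ i) := Module.Finite.iff_fg.2 (hfg.pow i)
  let f : (Fin (submoduleRank A W) → ↥(V ^ i)) →ₗ[k] R :=
    ∑ l, (LinearMap.mulLeft k (g l)) ∘ₗ (V ^ i).subtype ∘ₗ LinearMap.proj l
  have hf : ∀ c, f c = ∑ l, g l * (c l : R) := fun c => by simp [f, LinearMap.sum_apply]
  let f' : (Fin (submoduleRank A W) → ↥(V ^ i)) →ₗ[k] ↥(W * V ^ i) :=
    f.codRestrict _ fun c => by
      rw [hf]
      exact sum_mem fun l _ => Submodule.mul_mem_mul (hg l) (c l).2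
  have hinj : Function.Injective f' := by
    rw [← LinearMap.ker_eq_bot, LinearMap.ker_eq_bot']
    intro c hc
    have hc' : f c = 0 := congrArg Subtype.val hc
    rw [hf] at hc'
    have := Fintype.linearIndependent_iff.1 hli (fun l => ⟨c l, hVA (c l).2⟩) (by
      rw [← hc']
      exact Finset.sum_congr rfl fun l _ => mul_comm _ _)
    ext l
    exact congrArg (Subtype.val : A → R) (this l)
  have h3 := LinearMap.finrank_le_finrank_of_injective hinj
  rwa [Module.finrank_pi_fintype, Finset.sum_const, Finset.card_univ, Fintype.card_fin,
    smul_eq_mul] at h3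

/-- Multiplication by a denominator `b ∈ V^e` embeds `R_j V^i` into `⟨g⟩ V^(i+e)`. Up to the shift
`e`, which is harmless in the limit, this matches the lower bound of `mul_finrank_pow_le`. -/
theorem exists_finrank_mul_pow_le (hd : 0 < d) (hV : V ≤ 𝒜 d) (hfg : V.FG) {j : ℕ}
    (hj : (𝒜 j).FG) : ∃ e, ∀ i, Module.finrank k ↥(𝒜 j * V ^ i) ≤
      submoduleRank (Algebra.adjoin k (V : Set R)) (𝒜 j) * Module.finrank k ↥(V ^ (i + e)) := by
  obtain ⟨g, hg, hli⟩ := exists_linearIndependent_submoduleRank (Algebra.adjoin k (V : Set R)) hj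
  obtain ⟨e, b, hb, hb0, hbr⟩ := exists_denominator hd hV hj hg hli
  refine ⟨e, fun i => ?_⟩
  have h2 : Module.Finite k ↥(V ^ (i + e)) := Module.Finite.iff_fg.2 (hfg.pow _)
  have h3 : Module.Finite k (Submodule.span k (Set.range g)) :=
    Module.Finite.span_of_finite k (Set.finite_range g)
  have h4 : Module.Finite k ↥(Submodule.span k (Set.range g) * V ^ (i + e)) :=
    Module.Finite.iff_fg.2 ((Module.Finite.iff_fg.1 h3).mul (hfg.pow _))
  have hinj : Function.Injective (LinearMap.mulLeft k b) := mul_right_injective₀ hb0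
  have hle : (𝒜 j * V ^ i).map (LinearMap.mulLeft k b) ≤
      Submodule.span k (Set.range g) * V ^ (i + e) := by
    rw [Submodule.map_le_iff_le_comap, Submodule.mul_le]
    intro r hr v hv
    change b * (r * v) ∈ Submodule.span k (Set.range g) * V ^ (i + e)
    rw [← mul_assoc, _root_.pow_add, mul_comm (V ^ i), ← mul_assoc,
      mul_comm (Submodule.span k (Set.range g))]
    exact Submodule.mul_mem_mul (hbr r hr) hv
  calc Module.finrank k ↥(𝒜 j * V ^ i)
      = Module.finrank k ↥((𝒜 j * V ^ i).map (LinearMap.mulLeft k b)) :=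
        LinearEquiv.finrank_eq (Submodule.equivMapOfInjective _ hinj _)
    _ ≤ Module.finrank k ↥(Submodule.span k (Set.range g) * V ^ (i + e)) :=
        Submodule.finrank_mono hle
    _ ≤ Module.finrank k (Submodule.span k (Set.range g)) * Module.finrank k ↥(V ^ (i + e)) :=
        Submodule.finrank_mul_le _ _
    _ ≤ _ := Nat.mul_le_mul_right _ (by
        have := finrank_range_le_card (R := k) g
        rw [Fintype.card_fin] at this
        exact this)

/-- The growth of the `A`-module `A R_j` is its rank times the growth of `A`. -/
theorem tendsto_sum_finrank_mul_pow (hd : 0 < d) (hV : V ≤ 𝒜 d) (hfg : V.FG) {j : ℕ}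
    (hj : (𝒜 j).FG) {s : ℕ} {e : ℝ} (he : Tendsto (fun n : ℕ =>
      (∑ i ∈ Finset.range n, (Module.finrank k ↥(V ^ i) : ℝ)) / (n : ℝ) ^ s) atTop (𝓝 e)) :
    Tendsto (fun n : ℕ =>
      (∑ i ∈ Finset.range n, (Module.finrank k ↥(𝒜 j * V ^ i) : ℝ)) / (n : ℝ) ^ s) atTop
      (𝓝 (submoduleRank (Algebra.adjoin k (V : Set R)) (𝒜 j) * e)) := by
  set h := submoduleRank (Algebra.adjoin k (V : Set R)) (𝒜 j) with hh
  obtain ⟨c, hc⟩ := exists_finrank_mul_pow_le hd hV hfg hj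
  have hup := (tendsto_add_div_pow he c).const_mul (h : ℝ)
  refine tendsto_of_tendsto_of_tendsto_of_le_of_le (he.const_mul (h : ℝ)) hup ?_ ?_
  · intro n
    beta_reduce
    rw [← mul_div_assoc, Finset.mul_sum]
    gcongr with i _
    exact_mod_cast mul_finrank_pow_le hfg hj i fun x hx => Algebra.pow_le_adjoin V i hx
  · intro n
    beta_reduce
    rw [← mul_div_assoc]
    gcongr
    calc ∑ i ∈ Finset.range n, (Module.finrank k ↥(𝒜 j * V ^ i) : ℝ)
        ≤ ∑ i ∈ Finset.range n, (h : ℝ) * (Module.finrank k ↥(V ^ (i + c)) : ℝ) :=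
          Finset.sum_le_sum fun i _ => by exact_mod_cast hc i
      _ = h * ∑ i ∈ Finset.range n, (Module.finrank k ↥(V ^ (i + c)) : ℝ) := by
          rw [Finset.mul_sum]
      _ ≤ h * ∑ i ∈ Finset.range (n + c), (Module.finrank k ↥(V ^ i) : ℝ) := by
          gcongr
          rw [add_comm n c, Finset.sum_range_add]
          rw [Finset.sum_congr rfl fun i _ => by rw [add_comm i c]]
          exact le_add_of_nonneg_left (Finset.sum_nonneg fun _ _ => by positivity)

end RankGrowth

/-! ### Samuel limits and the multiplicity of `k[V]` -/

/-- The length of a quotient of `S = k + 𝔪` by an ideal containing a power of `𝔪`. -/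
theorem length_quotient_eq_finrank {k S P : Type*} [Field k] [CommRing S] [Algebra k S]
    {𝔪 : Ideal S} (hS : ∀ x : S, ∃ c : k, x - algebraMap k S c ∈ 𝔪) {n : ℕ} {J : Ideal S}
    (hJ : 𝔪 ^ n ≤ J) [AddCommGroup P] [Module k P] [Module.Finite k P] (ψ : S →ₗ[k] P)
    (hψ : Function.Surjective ψ) (hker : ∀ x, ψ x = 0 ↔ x ∈ J) :
    Module.length S (S ⧸ J) = Module.finrank k P := by
  rw [Module.length_eq_length_of_pow_smul_eq_zero hS n]
  · have h : LinearMap.ker ψ = J.restrictScalars k := by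
      ext x
      exact hker x
    have e := ψ.quotKerEquivOfSurjective hψ
    rw [h] at e
    have e' : (S ⧸ J) ≃ₗ[k] P := e
    rw [e'.length_eq, Module.length_eq_finrank]
  · intro a ha y
    obtain ⟨y, rfl⟩ := Submodule.Quotient.mk_surjective _ y
    rw [← Submodule.Quotient.mk_smul]
    exact (Submodule.Quotient.mk_eq_zero _).2 (Ideal.mul_mem_right _ _ (hJ ha))

theorem hasSamuelLimit_of_tendsto {S : Type*} [CommRing S] {𝔞 : Ideal S} {s : ℕ} {e : ℝ}
    {l : ℕ → ℕ} (hl : ∀ n, Module.length S (S ⧸ 𝔞 ^ n) = l n)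
    (he : Tendsto (fun n : ℕ => (l n : ℝ) / (n : ℝ) ^ s) atTop (𝓝 e)) :
    HasSamuelLimit S 𝔞 S s (s ! * e) := by
  have h : ∀ n : ℕ, Module.length S (S ⧸ (𝔞 ^ n • ⊤ : Submodule S S)) = l n := fun n => by
    rw [← hl, Ideal.smul_top_eq_map, Algebra.algebraMap_self, Ideal.map_id]
    rfl
  refine ⟨fun n => ?_, ?_⟩
  · rw [h]
    exact ENat.natCast_ne_top _
  · refine (he.const_mul (s ! : ℝ)).congr fun n => ?_
    rw [h, ENat.toNat_natCast, mul_div_assoc]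

theorem hasSamuelLimit_of_linearMap {k S : Type*} [Field k] [CommRing S] [Algebra k S]
    {𝔪 : Ideal S} (hS : ∀ x : S, ∃ c : k, x - algebraMap k S c ∈ 𝔪) {s : ℕ} {e : ℝ}
    {P : ℕ → Type*} [∀ n, AddCommGroup (P n)] [∀ n, Module k (P n)] [∀ n, Module.Finite k (P n)]
    (ψ : ∀ n, S →ₗ[k] P n) (hψ : ∀ n, Function.Surjective (ψ n))
    (hker : ∀ n x, ψ n x = 0 ↔ x ∈ 𝔪 ^ n)
    (he : Tendsto (fun n : ℕ => (Module.finrank k (P n) : ℝ) / (n : ℝ) ^ s) atTop (𝓝 e)) :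
    HasSamuelLimit S 𝔪 S s (s ! * e) :=
  hasSamuelLimit_of_tendsto
    (fun n => length_quotient_eq_finrank hS le_rfl (ψ n) (hψ n) (hker n)) he

section AdjoinMultiplicity

variable {k R : Type*} [Field k] [CommRing R] [Algebra k R] {𝒜 : ℕ → Submodule k R}
  [GradedAlgebra 𝒜] {V : Submodule k R} {d : ℕ}

open GradedAlgebra (proj)

theorem mem_homogeneousMaximalIdeal_iff {x : R} :
    x ∈ homogeneousMaximalIdeal 𝒜 ↔ proj 𝒜 0 x = 0 := by
  rw [homogeneousMaximalIdeal, HomogeneousIdeal.toIdeal_irrelevant]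
  rfl

theorem adjoin_eq_algebraMap_add (hd : 0 < d) (hV : V ≤ 𝒜 d)
    (x : Algebra.adjoin k (V : Set R)) : ∃ c : k,
      x - algebraMap k _ c ∈ subalgebraMaximalIdeal 𝒜 (Algebra.adjoin k (V : Set R)) := by
  have h := proj_mem_pow hd hV x.2 0
  rw [_root_.pow_zero, zero_mul, Submodule.one_eq_range] at h
  obtain ⟨c, hc⟩ := h
  refine ⟨c, ?_⟩
  rw [subalgebraMaximalIdeal, Ideal.mem_comap, mem_homogeneousMaximalIdeal_iff]
  change proj 𝒜 0 ((x : R) - algebraMap k R c) = 0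
  have h1 : algebraMap k R c ∈ 𝒜 0 := SetLike.algebraMap_mem_graded 𝒜 c
  rw [map_sub, proj_of_mem 𝒜 h1, ← hc]
  exact sub_self _

theorem subalgebraMaximalIdeal_eq_span (hd : 0 < d) (hV : V ≤ 𝒜 d) :
    subalgebraMaximalIdeal 𝒜 (Algebra.adjoin k (V : Set R)) =
      Ideal.span ((V.comap (Algebra.adjoin k (V : Set R)).val.toLinearMap : Submodule k _) :
        Set (Algebra.adjoin k (V : Set R))) := by
  apply le_antisymm
  · intro x hx
    rw [subalgebraMaximalIdeal, Ideal.mem_comap, mem_homogeneousMaximalIdeal_iff] at hx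
    obtain ⟨N, hN⟩ := (isGradingProjection_adjoinProj hd hV).exists_sum x
    rw [hN]
    refine sum_mem fun n _ => ?_
    cases n with
    | zero =>
      have : adjoinProj hd hV 0 x = 0 := Subtype.ext (by
        rw [coe_adjoinProj, zero_mul]
        exact hx)
      rw [this]
      exact zero_mem _
    | succ n =>
      have h1 : (adjoinProj hd hV (n + 1) x : R) ∈ V ^ n * V := by
        rw [← _root_.pow_succ]
        exact proj_mem_pow hd hV x.2 _
      have h2 : ∀ y ∈ V ^ n * V, ∀ hy : y ∈ Algebra.adjoin k (V : Set R),
          (⟨y, hy⟩ : Algebra.adjoin k (V : Set R)) ∈ Ideal.span ((V.comap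
            (Algebra.adjoin k (V : Set R)).val.toLinearMap : Submodule k _) :
            Set (Algebra.adjoin k (V : Set R))) := by
        intro y hy
        induction hy using Submodule.mul_induction_on' with
        | mem_mul_mem u hu v hv =>
          intro _
          have : (⟨v, Algebra.subset_adjoin hv⟩ : Algebra.adjoin k (V : Set R)) ∈
            Ideal.span ((V.comap (Algebra.adjoin k (V : Set R)).val.toLinearMap :
              Submodule k _) : Set (Algebra.adjoin k (V : Set R))) := Ideal.subset_span hv
          exact Ideal.mul_mem_left _ ⟨u, Algebra.pow_le_adjoin V n hu⟩ this
        | add y hy z hz ihy ihz =>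
          intro _
          have hle : ∀ w ∈ V ^ n * V, w ∈ Algebra.adjoin k (V : Set R) := fun w hw =>
            Algebra.pow_le_adjoin V (n + 1) (by rwa [_root_.pow_succ])
          exact add_mem (ihy (hle y hy)) (ihz (hle z hz))
      exact h2 _ h1 _
  · rw [Ideal.span_le]
    intro x hx
    rw [SetLike.mem_coe, subalgebraMaximalIdeal, Ideal.mem_comap, mem_homogeneousMaximalIdeal_iff]
    exact proj_of_mem_ne 𝒜 (hV hx) hd.ne'

/-- The maximal homogeneous ideal is generated by `V`, so its `n`-th power is the sum of the `V^m`
with `n ≤ m`. -/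
theorem mem_subalgebraMaximalIdeal_pow_iff (hd : 0 < d) (hV : V ≤ 𝒜 d) (n : ℕ)
    (x : Algebra.adjoin k (V : Set R)) :
    x ∈ subalgebraMaximalIdeal 𝒜 (Algebra.adjoin k (V : Set R)) ^ n ↔
      ∀ i < n, proj 𝒜 (i * d) (x : R) = 0 := by
  rw [subalgebraMaximalIdeal_eq_span hd hV, Ideal.span_submodule_pow]
  set V' := V.comap (Algebra.adjoin k (V : Set R)).val.toLinearMap with hV'
  have hmap : ∀ m, (V' ^ m).map (Algebra.adjoin k (V : Set R)).val.toLinearMap = V ^ m := by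
    intro m
    rw [Submodule.map_pow (f := (Algebra.adjoin k (V : Set R)).val)]
    congr 1
    rw [Submodule.map_comap_eq, inf_eq_right]
    exact fun x hx => ⟨⟨x, Algebra.subset_adjoin hx⟩, rfl⟩
  constructor
  · intro hx
    have hx' : x ∈ (⊤ : Submodule k _) * V' ^ n := by
      rw [← Ideal.restrictScalars_span_submodule]
      exact hx
    induction hx' using Submodule.mul_induction_on' with
    | mem_mul_mem u hu v hv =>
      intro i hi
      have hv' : (v : R) ∈ 𝒜 (n * d) := pow_le_graded hV n (by
        rw [← hmap]
        exact ⟨v, hv, rfl⟩)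
      exact DirectSum.coe_decompose_mul_of_right_mem_of_not_le 𝒜 hv'
        (not_le.2 (Nat.mul_lt_mul_of_pos_right hi hd))
    | add y hy z hz ihy ihz =>
      intro i hi
      have h1 : ∀ w ∈ (⊤ : Submodule k _) * V' ^ n, w ∈ Ideal.span ((V' ^ n : Submodule k _) :
          Set (Algebra.adjoin k (V : Set R))) := fun w hw => by
        rw [← Ideal.restrictScalars_span_submodule] at hw
        exact hw
      change proj 𝒜 (i * d) ((y : R) + z) = 0
      rw [map_add, ihy (h1 y hy) i hi, ihz (h1 z hz) i hi, add_zero]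
  · intro h
    obtain ⟨N, hN⟩ := (isGradingProjection_adjoinProj hd hV).exists_sum x
    rw [hN]
    refine sum_mem fun m _ => ?_
    by_cases hm : m < n
    · have : adjoinProj hd hV m x = 0 := Subtype.ext (h m hm)
      rw [this]
      exact zero_mem _
    · have h1 : adjoinProj hd hV m x ∈ V' ^ (m - n) * V' ^ n := by
        rw [← _root_.pow_add, Nat.sub_add_cancel (not_lt.1 hm)]
        have := proj_mem_pow hd hV x.2 m
        rw [← hmap] at this
        obtain ⟨y, hy, hy2⟩ := this
        have : y = adjoinProj hd hV m x := Subtype.ext hy2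
        rwa [← this]
      have h2 : adjoinProj hd hV m x ∈ (⊤ : Submodule k _) * V' ^ n :=
        (mul_le_mul' le_top le_rfl : V' ^ (m - n) * V' ^ n ≤ ⊤ * V' ^ n) h1
      rw [← Ideal.restrictScalars_span_submodule] at h2
      exact h2

/-- The components of an element of `k[V]` in degrees less than `n`. -/
def truncation (hd : 0 < d) (hV : V ≤ 𝒜 d) (n : ℕ) :
    Algebra.adjoin k (V : Set R) →ₗ[k] ((i : Fin n) → ↥(V ^ (i : ℕ))) :=
  LinearMap.pi fun i => LinearMap.codRestrict _
      ((proj 𝒜 (i * d)) ∘ₗ (Algebra.adjoin k (V : Set R)).val.toLinearMap)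
      fun x => proj_mem_pow hd hV x.2 i

theorem truncation_apply (hd : 0 < d) (hV : V ≤ 𝒜 d) (n : ℕ)
    (x : Algebra.adjoin k (V : Set R)) (i : Fin n) :
    (truncation hd hV n x i : R) = proj 𝒜 (i * d) (x : R) := rfl

theorem truncation_surjective (hd : 0 < d) (hV : V ≤ 𝒜 d) (n : ℕ) :
    Function.Surjective (truncation hd hV n) := by
  intro v
  refine ⟨⟨∑ i, (v i : R), sum_mem fun i _ => Algebra.pow_le_adjoin V i (v i).2⟩, ?_⟩
  refine funext fun i => Subtype.ext ?_
  rw [truncation_apply, map_sum, Finset.sum_eq_single i]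
  · exact proj_of_mem 𝒜 (pow_le_graded hV i (v i).2)
  · intro j _ hj
    exact proj_of_mem_ne 𝒜 (pow_le_graded hV j (v j).2)
      fun h => hj (Fin.ext (Nat.eq_of_mul_eq_mul_right hd h))
  · simp

theorem truncation_eq_zero_iff (hd : 0 < d) (hV : V ≤ 𝒜 d) (n : ℕ)
    (x : Algebra.adjoin k (V : Set R)) :
    truncation hd hV n x = 0 ↔ ∀ i < n, proj 𝒜 (i * d) (x : R) = 0 := by
  constructor
  · intro h i hi
    rw [← truncation_apply hd hV n x ⟨i, hi⟩, h]
    rfl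
  · intro h
    refine funext fun i => Subtype.ext ?_
    rw [truncation_apply, h i i.2]
    rfl

-- Truncation identifies `k[V]` modulo the `n`-th power of its maximal ideal with the product of the
-- `V^i` for `i < n`.
set_option maxHeartbeats 4000000 in
theorem isMultiplicity_adjoin (hd : 0 < d) (hV : V ≤ 𝒜 d) (hfg : V.FG) {s : ℕ}
    (hs : ringKrullDim (Algebra.adjoin k (V : Set R)) = s) {e : ℝ} (he : Tendsto (fun n : ℕ =>
      (∑ i ∈ Finset.range n, (Module.finrank k ↥(V ^ i) : ℝ)) / (n : ℝ) ^ s) atTop (𝓝 e)) :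
    IsMultiplicity (Algebra.adjoin k (V : Set R))
      (subalgebraMaximalIdeal 𝒜 (Algebra.adjoin k (V : Set R)))
      (Algebra.adjoin k (V : Set R)) (s ! * e) := by
  refine ⟨s, by rw [Module.supportDim_self_eq_ringKrullDim, hs], ?_⟩
  have hfin : ∀ i, Module.Finite k ↥(V ^ i) := fun i => Module.Finite.iff_fg.2 (hfg.pow i)
  refine hasSamuelLimit_of_linearMap (adjoin_eq_algebraMap_add hd hV) (truncation hd hV)
    (truncation_surjective hd hV) (fun n x => ?_) (he.congr fun n => ?_)
  · exact (truncation_eq_zero_iff hd hV n x).trans (mem_subalgebraMaximalIdeal_pow_iff hd hV n x).symm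
  · rw [Module.finrank_pi_fintype, Finset.sum_range]
    push_cast
    rfl

end AdjoinMultiplicity

/-! ### Ideals of a subalgebra as subspaces of the ambient algebra -/

section SubalgebraIdeals

variable {k R T : Type*} [CommRing k] [CommRing R] [CommRing T] [Algebra k R] [Algebra R T]
  [Algebra k T] [IsScalarTower k R T] {S : Subalgebra R T}

variable (k) in
/-- An ideal of a subalgebra as a submodule of the ambient algebra. -/
def Ideal.toSubmodule (𝔮 : Ideal S) : Submodule k T where
  carrier := {F | ∃ h : F ∈ S, (⟨F, h⟩ : S) ∈ 𝔮}
  zero_mem' := ⟨zero_mem _, 𝔮.zero_mem⟩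
  add_mem' := fun ⟨h, hF⟩ ⟨h', hG⟩ => ⟨add_mem h h', 𝔮.add_mem hF hG⟩
  smul_mem' := fun c F ⟨h, hF⟩ => by
    have e : c • F = algebraMap R T (algebraMap k R c) * F := by
      rw [← Algebra.smul_def, algebraMap_smul]
    rw [e]
    exact ⟨mul_mem (Subalgebra.algebraMap_mem _ _) h,
      𝔮.mul_mem_left ⟨_, Subalgebra.algebraMap_mem _ _⟩ hF⟩

variable {𝔮 𝔭 : Ideal S} {F G : T}

theorem Ideal.coe_mem_toSubmodule {F : S} : (F : T) ∈ 𝔮.toSubmodule k ↔ F ∈ 𝔮 :=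
  ⟨fun ⟨_, h⟩ => h, fun h => ⟨F.2, h⟩⟩

theorem Ideal.mul_mem_toSubmodule_mul (hF : F ∈ 𝔮.toSubmodule k) (hG : G ∈ 𝔭.toSubmodule k) :
    F * G ∈ (𝔮 * 𝔭).toSubmodule k :=
  ⟨mul_mem hF.1 hG.1, Ideal.mul_mem_mul hF.2 hG.2⟩

theorem Ideal.mul_mem_toSubmodule (hF : F ∈ S) (hG : G ∈ 𝔮.toSubmodule k) :
    F * G ∈ 𝔮.toSubmodule k :=
  ⟨mul_mem hF hG.1, 𝔮.mul_mem_left ⟨F, hF⟩ hG.2⟩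

theorem Ideal.toSubmodule_mono (h : 𝔮 ≤ 𝔭) : 𝔮.toSubmodule k ≤ 𝔭.toSubmodule k :=
  fun _ hF => ⟨hF.1, h hF.2⟩

theorem Ideal.toSubmodule_sup : (𝔮 ⊔ 𝔭).toSubmodule k = 𝔮.toSubmodule k ⊔ 𝔭.toSubmodule k := by
  refine le_antisymm ?_ (sup_le (toSubmodule_mono le_sup_left) (toSubmodule_mono le_sup_right))
  rintro F ⟨h, hF⟩
  obtain ⟨y, hy, z, hz, e⟩ := Submodule.mem_sup.1 hF
  have : F = (y : T) + z := (congrArg Subtype.val e).symm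
  rw [this]
  exact Submodule.add_mem_sup (coe_mem_toSubmodule.2 hy) (coe_mem_toSubmodule.2 hz)

theorem Ideal.toSubmodule_span_le {U : Submodule k T} {s : Set S} (h : ∀ F ∈ s, (F : T) ∈ U)
    (hmul : ∀ F ∈ S, ∀ G ∈ U, F * G ∈ U) : (Ideal.span s).toSubmodule k ≤ U := by
  rintro _ ⟨_, hF⟩
  suffices ∀ F ∈ Ideal.span s, (F : T) ∈ U from this _ hF
  clear hF
  intro F hF
  induction hF using Submodule.span_induction with
  | mem F hF => exact h F hF
  | zero => exact zero_mem _
  | add F G _ _ hF hG => exact add_mem hF hG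
  | smul G F _ hF => exact hmul _ G.2 _ hF

theorem Ideal.toSubmodule_mul_le {U : Submodule k T}
    (h : ∀ F ∈ 𝔮.toSubmodule k, ∀ G ∈ 𝔭.toSubmodule k, F * G ∈ U) :
    (𝔮 * 𝔭).toSubmodule k ≤ U := by
  rintro _ ⟨_, hF⟩
  suffices ∀ F ∈ 𝔮 * 𝔭, (F : T) ∈ U from this _ hF
  clear hF
  intro F hF
  induction hF using Submodule.mul_induction_on' with
  | mem_mul_mem F hF G hG => exact h _ (coe_mem_toSubmodule.2 hF) _ (coe_mem_toSubmodule.2 hG)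
  | add F _ G _ hF hG => exact add_mem hF hG

end SubalgebraIdeals

/-! ### The bigrading of the Rees algebra -/

section ReesPart

variable {k R : Type*} [Field k] [CommRing R] [Algebra k R] {𝒜 : ℕ → Submodule k R}
  {V : Submodule k R} {d : ℕ}

variable (𝒜 V d) in
/-- The part of the Rees algebra of `V R` of degree `n` in `R` and of degree `i` in `X`. -/
def reesPart (n i : ℕ) : Submodule k R :=
  if i * d ≤ n then 𝒜 (n - i * d) * V ^ i else ⊥

theorem reesPart_add (j i : ℕ) : reesPart 𝒜 V d (j + i * d) i = 𝒜 j * V ^ i := by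
  rw [reesPart, if_pos (Nat.le_add_left _ _), Nat.add_sub_cancel]

theorem reesPart_of_lt {n i : ℕ} (h : n < i * d) : reesPart 𝒜 V d n i = ⊥ :=
  if_neg (not_le.2 h)

/-- Case analysis for the parts of the Rees algebra. -/
theorem reesPart_cases (d n i : ℕ) : n < i * d ∨ ∃ j, n = j + i * d := by
  rcases lt_or_ge n (i * d) with h | h
  · exact Or.inl h
  · exact Or.inr ⟨n - i * d, (Nat.sub_add_cancel h).symm⟩

end ReesPart

section Bigraded

variable {k R : Type*} [Field k] [CommRing R] [Algebra k R] {𝒜 : ℕ → Submodule k R}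
  [GradedAlgebra 𝒜] {V : Submodule k R} {d : ℕ} {I : Ideal R}

open GradedAlgebra (proj)

variable (𝒜) in
/-- The polynomials whose coefficient of `X ^ i` has its component of degree `n` in `Q n i`. -/
noncomputable def bigradedSubmodule (Q : ℕ → ℕ → Submodule k R) : Submodule k R[X] :=
  ⨅ n, ⨅ i, (Q n i).comap (proj 𝒜 n ∘ₗ (lcoeff R i).restrictScalars k)

variable {Q Q' Q'' : ℕ → ℕ → Submodule k R}

theorem mem_bigradedSubmodule {F : R[X]} :
    F ∈ bigradedSubmodule 𝒜 Q ↔ ∀ n i, proj 𝒜 n (F.coeff i) ∈ Q n i := by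
  simp only [bigradedSubmodule, Submodule.mem_iInf]
  rfl

theorem monomial_mem_bigradedSubmodule {n i : ℕ} (hQ : Q n i ≤ 𝒜 n) {x : R} (hx : x ∈ Q n i) :
    monomial i x ∈ bigradedSubmodule 𝒜 Q := by
  refine mem_bigradedSubmodule.2 fun m l => ?_
  rw [coeff_monomial]
  split_ifs with h
  · subst h
    by_cases hm : n = m
    · subst hm
      rwa [proj_of_mem 𝒜 (hQ hx)]
    · rw [proj_of_mem_ne 𝒜 (hQ hx) hm]
      exact zero_mem _
  · rw [map_zero]
    exact zero_mem _

/-- Reduces inclusions out of bigraded subspaces to homogeneous monomials. -/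
theorem mem_of_forall_monomial_mem {U : Submodule k R[X]} {F : R[X]}
    (h : ∀ n i : ℕ, monomial i (proj 𝒜 n (F.coeff i)) ∈ U) : F ∈ U := by
  classical
  rw [F.as_sum_support]
  refine sum_mem fun i _ => ?_
  rw [← DirectSum.sum_support_decompose 𝒜 (F.coeff i), map_sum]
  exact sum_mem fun n _ => h n i

theorem bigradedSubmodule_le {U : Submodule k R[X]}
    (h : ∀ n i, ∀ x ∈ Q n i, monomial i x ∈ U) : bigradedSubmodule 𝒜 Q ≤ U := fun _ hF =>
  mem_of_forall_monomial_mem fun n i => h n i _ (mem_bigradedSubmodule.1 hF n i)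

theorem bigradedSubmodule_mono (h : ∀ n i, Q n i ≤ Q' n i) :
    bigradedSubmodule 𝒜 Q ≤ bigradedSubmodule 𝒜 Q' := fun _ hF =>
  mem_bigradedSubmodule.2 fun n i => h n i (mem_bigradedSubmodule.1 hF n i)

theorem bigradedSubmodule_sup (hQ : ∀ n i, Q n i ≤ 𝒜 n) (hQ' : ∀ n i, Q' n i ≤ 𝒜 n) :
    bigradedSubmodule 𝒜 Q ⊔ bigradedSubmodule 𝒜 Q' =
      bigradedSubmodule 𝒜 fun n i => Q n i ⊔ Q' n i := by
  refine le_antisymm (sup_le (bigradedSubmodule_mono fun _ _ => le_sup_left)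
    (bigradedSubmodule_mono fun _ _ => le_sup_right)) (bigradedSubmodule_le fun n i x hx => ?_)
  obtain ⟨y, hy, z, hz, rfl⟩ := Submodule.mem_sup.1 hx
  rw [map_add]
  exact Submodule.add_mem_sup (monomial_mem_bigradedSubmodule (hQ n i) hy)
    (monomial_mem_bigradedSubmodule (hQ' n i) hz)

theorem mul_mem_bigradedSubmodule (hQ : ∀ n i, Q'' n i ≤ 𝒜 n)
    (h : ∀ n i m l, Q n i * Q' m l ≤ Q'' (n + m) (i + l)) {F G : R[X]}
    (hF : F ∈ bigradedSubmodule 𝒜 Q) (hG : G ∈ bigradedSubmodule 𝒜 Q') :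
    F * G ∈ bigradedSubmodule 𝒜 Q'' := by
  have key : ∀ n i, ∀ x ∈ Q n i, monomial i x * G ∈ bigradedSubmodule 𝒜 Q'' := by
    intro n i x hx
    suffices bigradedSubmodule 𝒜 Q' ≤ (bigradedSubmodule 𝒜 Q'').comap
      (LinearMap.mulLeft k (monomial i x)) from this hG
    refine bigradedSubmodule_le fun m l y hy => ?_
    change monomial i x * monomial l y ∈ bigradedSubmodule 𝒜 Q''
    rw [monomial_mul_monomial]
    exact monomial_mem_bigradedSubmodule (hQ _ _) (h n i m l (Submodule.mul_mem_mul hx hy))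
  have hle : bigradedSubmodule 𝒜 Q ≤ (bigradedSubmodule 𝒜 Q'').comap (LinearMap.mulRight k G) :=
    bigradedSubmodule_le key
  exact hle hF

theorem reesPart_le (hV : V ≤ 𝒜 d) (n i : ℕ) : reesPart 𝒜 V d n i ≤ 𝒜 n := by
  rcases reesPart_cases d n i with h | ⟨j, rfl⟩
  · rw [reesPart_of_lt h]
    exact bot_le
  · rw [reesPart_add]
    exact (mul_le_mul' le_rfl (pow_le_graded hV i)).trans (graded_mul_le 𝒜 _ _)

theorem reesPart_mul_le (n i m l : ℕ) :
    reesPart 𝒜 V d n i * reesPart 𝒜 V d m l ≤ reesPart 𝒜 V d (n + m) (i + l) := by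
  rcases reesPart_cases d n i with h | ⟨j, rfl⟩
  · rw [reesPart_of_lt h, Submodule.bot_mul]
    exact bot_le
  rcases reesPart_cases d m l with h | ⟨j', rfl⟩
  · rw [reesPart_of_lt h, Submodule.mul_bot]
    exact bot_le
  rw [show j + i * d + (j' + l * d) = (j + j') + (i + l) * d by ring, reesPart_add, reesPart_add,
    reesPart_add, mul_mul_mul_comm, ← _root_.pow_add]
  exact mul_le_mul' (graded_mul_le 𝒜 _ _) le_rfl

theorem reesPart_succ_le (hV : V ≤ 𝒜 d) (n i : ℕ) :
    reesPart 𝒜 V d n (i + 1) ≤ reesPart 𝒜 V d n i := by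
  rcases reesPart_cases d n (i + 1) with h | ⟨j, rfl⟩
  · rw [reesPart_of_lt h]
    exact bot_le
  · rw [show reesPart 𝒜 V d (j + (i + 1) * d) i = 𝒜 (j + d) * V ^ i by
      rw [show j + (i + 1) * d = (j + d) + i * d by ring, reesPart_add], reesPart_add,
      _root_.pow_succ', ← mul_assoc]
    exact mul_le_mul' ((mul_le_mul' le_rfl hV).trans (graded_mul_le 𝒜 _ _)) le_rfl

/-- `I^i` is generated by `V^i`, which sits in degree `i d`; so it is homogeneous, with part
`R_{n-id} V^i` in degree `n`. -/
theorem mem_pow_iff_proj_mem_reesPart (hV : V ≤ 𝒜 d) (hI : Ideal.span (V : Set R) = I) (i : ℕ)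
    (x : R) : x ∈ I ^ i ↔ ∀ n, proj 𝒜 n x ∈ reesPart 𝒜 V d n i := by
  classical
  have hmem : ∀ x, x ∈ I ^ i ↔ x ∈ (⊤ : Submodule k R) * V ^ i := fun x => by
    rw [← Ideal.restrictScalars_span_submodule, ← Ideal.span_submodule_pow, hI]
    rfl
  rw [hmem]
  constructor
  · intro hx n
    induction hx using Submodule.mul_induction_on' with
    | mem_mul_mem r _ v hv =>
      have hv' := pow_le_graded hV i hv
      rcases reesPart_cases d n i with h | ⟨j, rfl⟩
      · have h0 : proj 𝒜 n (r * v) = 0 :=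
          DirectSum.coe_decompose_mul_of_right_mem_of_not_le 𝒜 hv' (not_le.2 h)
        rw [h0]
        exact zero_mem _
      · rw [proj_mul_of_mem 𝒜 hv', reesPart_add]
        exact Submodule.mul_mem_mul (proj_mem 𝒜 _ _) hv
    | add y _ z _ ihy ihz =>
      rw [map_add]
      exact add_mem ihy ihz
  · intro h
    rw [← DirectSum.sum_support_decompose 𝒜 x]
    refine sum_mem fun n _ => ?_
    have hn := h n
    rcases reesPart_cases d n i with h | ⟨j, rfl⟩
    · rw [reesPart_of_lt h] at hn
      exact (bot_le : ⊥ ≤ (⊤ : Submodule k R) * V ^ i) hn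
    · rw [reesPart_add] at hn
      exact (mul_le_mul' le_top le_rfl : 𝒜 j * V ^ i ≤ ⊤ * V ^ i) hn

theorem mem_reesAlgebra_iff_mem_bigradedSubmodule (hV : V ≤ 𝒜 d)
    (hI : Ideal.span (V : Set R) = I) (F : R[X]) :
    F ∈ reesAlgebra I ↔ F ∈ bigradedSubmodule 𝒜 (reesPart 𝒜 V d) := by
  rw [mem_reesAlgebra_iff, mem_bigradedSubmodule]
  simp only [mem_pow_iff_proj_mem_reesPart hV hI]
  exact forall_comm

end Bigraded

section ReesFiltration

variable {k R : Type*} [Field k] [CommRing R] [Algebra k R] {𝒜 : ℕ → Submodule k R}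
  {V : Submodule k R} {d : ℕ}

variable (𝒜 V d) in
/-- The part of the Rees algebra of degree `n` in `R` and of degree `i` in `X`, provided that
`m + i * d ≤ n + a * i`. -/
def reesFiltration (a m n i : ℕ) : Submodule k R :=
  if m + i * d ≤ n + a * i then reesPart 𝒜 V d n i else ⊥

theorem reesFiltration_le_reesPart (a m n i : ℕ) :
    reesFiltration 𝒜 V d a m n i ≤ reesPart 𝒜 V d n i := by
  rw [reesFiltration]
  split_ifs
  exacts [le_rfl, bot_le]

theorem reesFiltration_zero (a n i : ℕ) :
    reesFiltration 𝒜 V d a 0 n i = reesPart 𝒜 V d n i := by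
  rw [reesFiltration]
  split_ifs with h
  · rfl
  · rw [reesPart_of_lt]
    omega

/-- In the coordinate `j = n - i d` the defining condition is `m ≤ j + a i`. The parameter `a`
treats two ideals at once: `a = 0` describes the powers of `𝔪𝓡(I)`, and `a = 1` those of `𝔪 +
𝓡(I)₊`. -/
theorem reesFiltration_add (a m j i : ℕ) :
    reesFiltration 𝒜 V d a m (j + i * d) i = if m ≤ j + a * i then 𝒜 j * V ^ i else ⊥ := by
  rw [reesFiltration, reesPart_add]
  refine if_congr ?_ rfl rfl
  omega

variable (𝒜 V d) in
/-- The part of degree `n` in `R` and of degree `i` in `X` of the multiples of `b X ^ e`. -/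
def reesMultiples (b : R) (e n i : ℕ) : Submodule k R :=
  if e ≤ i ∧ e * d ≤ n then Submodule.span k {b} * reesPart 𝒜 V d (n - e * d) (i - e) else ⊥

theorem reesMultiples_add (b : R) (e j i : ℕ) : reesMultiples 𝒜 V d b e (j + i * d) i =
    if e ≤ i then Submodule.span k {b} * (𝒜 j * V ^ (i - e)) else ⊥ := by
  rw [reesMultiples]
  by_cases h : e ≤ i
  · obtain ⟨l, rfl⟩ := Nat.exists_eq_add_of_le h
    rw [if_pos h, if_pos ⟨h, by nlinarith⟩, show j + (e + l) * d - e * d = j + l * d by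
      rw [Nat.sub_eq_iff_eq_add (by nlinarith)]; ring, Nat.add_sub_cancel_left, reesPart_add]
  · rw [if_neg h, if_neg fun h' => h h'.1]

theorem reesPart_succ_add (j i : ℕ) : reesPart 𝒜 V d (j + i * d) (i + 1) =
    if d ≤ j then 𝒜 (j - d) * V ^ (i + 1) else ⊥ := by
  rw [reesPart]
  refine if_ctx_congr ?_ (fun h => ?_) fun _ => rfl
  · rw [add_one_mul]
    omega
  · congr 2
    rw [add_one_mul]
    omega

theorem monomial_mem_of_mem_reesPart {U : Submodule k R[X]} {n i : ℕ} {x : R}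
    (hx : x ∈ reesPart 𝒜 V d n i)
    (h : ∀ j, n = j + i * d → ∀ a ∈ 𝒜 j, ∀ v ∈ V ^ i, C a * monomial i v ∈ U) :
    monomial i x ∈ U := by
  rcases reesPart_cases d n i with hn | ⟨j, rfl⟩
  · rw [reesPart_of_lt hn] at hx
    rw [(Submodule.mem_bot k).1 hx, map_zero]
    exact zero_mem _
  · rw [reesPart_add] at hx
    induction hx using Submodule.mul_induction_on' with
    | mem_mul_mem a ha v hv =>
      rw [← C_mul_monomial]
      exact h j rfl a ha v hv
    | add y _ z _ hy hz =>
      rw [map_add]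
      exact add_mem hy hz

end ReesFiltration

/-! ### Bigraded ideals of the Rees algebra -/

section ReesIdeals

variable {k R : Type*} [Field k] [CommRing R] [Algebra k R] {𝒜 : ℕ → Submodule k R}
  [GradedAlgebra 𝒜] {V : Submodule k R} {d : ℕ} {I : Ideal R}

open GradedAlgebra (proj)

theorem reesFiltration_le (hV : V ≤ 𝒜 d) (a m n i : ℕ) :
    reesFiltration 𝒜 V d a m n i ≤ 𝒜 n :=
  (reesFiltration_le_reesPart a m n i).trans (reesPart_le hV n i)

theorem reesFiltration_mul_le (a m m' n i n' i' : ℕ) :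
    reesFiltration 𝒜 V d a m n i * reesFiltration 𝒜 V d a m' n' i' ≤
      reesFiltration 𝒜 V d a (m + m') (n + n') (i + i') := by
  by_cases h : m + i * d ≤ n + a * i
  · by_cases h' : m' + i' * d ≤ n' + a * i'
    · rw [reesFiltration, if_pos h, reesFiltration, if_pos h', reesFiltration, if_pos]
      · exact reesPart_mul_le n i n' i'
      · rw [add_mul, mul_add]
        omega
    · rw [reesFiltration, reesFiltration, if_neg h', Submodule.mul_bot]
      exact bot_le
  · rw [reesFiltration, if_neg h, Submodule.bot_mul]
    exact bot_le

theorem reesMultiples_le (hV : V ≤ 𝒜 d) {b : R} {e : ℕ} (hb : b ∈ V ^ e) (n i : ℕ) :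
    reesMultiples 𝒜 V d b e n i ≤ 𝒜 n := by
  rw [reesMultiples]
  split_ifs with h
  · refine (mul_le_mul' ((Submodule.span_singleton_le_iff_mem _ _).2 (pow_le_graded hV e hb))
      (reesPart_le hV _ _)).trans ((graded_mul_le 𝒜 _ _).trans (le_of_eq ?_))
    rw [Nat.add_sub_cancel' h.2]
  · exact bot_le

theorem mem_pow_of_mem_pow (hI : Ideal.span (V : Set R) = I) {i : ℕ} {x : R} (hx : x ∈ V ^ i) :
    x ∈ I ^ i := by
  rw [← hI, Ideal.span_submodule_pow]
  exact Ideal.subset_span hx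

theorem C_mem_reesAlgebra (x : R) : C x ∈ reesAlgebra I :=
  Subalgebra.algebraMap_mem (reesAlgebra I) x

theorem toSubmodule_extendToRees_le {J : Ideal R} {U : Submodule k R[X]}
    (h : ∀ x ∈ J, C x ∈ U) (hmul : ∀ F ∈ reesAlgebra I, ∀ G ∈ U, F * G ∈ U) :
    (extendToRees I J).toSubmodule k ≤ U := by
  refine Ideal.toSubmodule_span_le ?_ hmul
  rintro _ ⟨x, hx, rfl⟩
  exact h x hx

theorem C_mem_toSubmodule_extendToRees {J : Ideal R} {x : R} (hx : x ∈ J) :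
    C x ∈ (extendToRees I J).toSubmodule k :=
  Ideal.coe_mem_toSubmodule.2 (Ideal.mem_map_of_mem (algebraMap R (reesAlgebra I)) hx)

theorem reesAlgebra_mul_mem (hV : V ≤ 𝒜 d) (hI : Ideal.span (V : Set R) = I)
    {Q : ℕ → ℕ → Submodule k R} (hQ : ∀ n i, Q n i ≤ 𝒜 n)
    (hmul : ∀ n i m l, reesPart 𝒜 V d n i * Q m l ≤ Q (n + m) (i + l)) :
    ∀ F ∈ reesAlgebra I, ∀ G ∈ bigradedSubmodule 𝒜 Q, F * G ∈ bigradedSubmodule 𝒜 Q :=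
  fun _ hF _ hG => mul_mem_bigradedSubmodule hQ hmul
    ((mem_reesAlgebra_iff_mem_bigradedSubmodule hV hI _).1 hF) hG

theorem reesPart_mul_reesFiltration_le (a m n i n' i' : ℕ) :
    reesPart 𝒜 V d n i * reesFiltration 𝒜 V d a m n' i' ≤
      reesFiltration 𝒜 V d a m (n + n') (i + i') := by
  have := reesFiltration_mul_le (𝒜 := 𝒜) (V := V) (d := d) a 0 m n i n' i'
  rwa [reesFiltration_zero, zero_add] at this

theorem toSubmodule_pow_le_reesFiltration (hV : V ≤ 𝒜 d) (hI : Ideal.span (V : Set R) = I)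
    {𝔮 : Ideal (reesAlgebra I)} {a : ℕ}
    (h : 𝔮.toSubmodule k ≤ bigradedSubmodule 𝒜 (reesFiltration 𝒜 V d a 1)) (m : ℕ) :
    (𝔮 ^ m).toSubmodule k ≤ bigradedSubmodule 𝒜 (reesFiltration 𝒜 V d a m) := by
  induction m with
  | zero =>
    intro F hF
    refine bigradedSubmodule_mono (fun n i => ?_)
      ((mem_reesAlgebra_iff_mem_bigradedSubmodule hV hI F).1 hF.1)
    rw [reesFiltration_zero]
  | succ m ih =>
    rw [_root_.pow_succ]
    have key : ∀ F ∈ bigradedSubmodule 𝒜 (reesFiltration 𝒜 V d a m),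
        ∀ G ∈ bigradedSubmodule 𝒜 (reesFiltration 𝒜 V d a 1),
        F * G ∈ bigradedSubmodule 𝒜 (reesFiltration 𝒜 V d a (m + 1)) := fun F hF G hG =>
      mul_mem_bigradedSubmodule (reesFiltration_le hV a (m + 1)) (reesFiltration_mul_le a m 1) hF hG
    exact Ideal.toSubmodule_mul_le fun F hF G hG => key F (ih hF) G (h hG)

theorem C_mem_toSubmodule_pow (hstd : IsStandardGraded 𝒜) {j : ℕ} {x : R} (hx : x ∈ 𝒜 j) :
    C x ∈ ((extendToRees I (homogeneousMaximalIdeal 𝒜)) ^ j).toSubmodule k := by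
  induction j generalizing x with
  | zero =>
    rw [_root_.pow_zero, Ideal.one_eq_top]
    exact ⟨C_mem_reesAlgebra x, Submodule.mem_top⟩
  | succ j ih =>
    rw [← hstd.mul_eq] at hx
    induction hx using Submodule.mul_induction_on' with
    | mem_mul_mem a ha v hv =>
      have hv' : C v ∈ (extendToRees I (homogeneousMaximalIdeal 𝒜)).toSubmodule k :=
        C_mem_toSubmodule_extendToRees
          (mem_homogeneousMaximalIdeal_iff.2 (proj_of_mem_ne 𝒜 hv one_ne_zero))
      rw [C_mul, _root_.pow_succ]
      exact Ideal.mul_mem_toSubmodule_mul (ih ha) hv'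
    | add y _ z _ hy hz =>
      rw [C_add]
      exact add_mem hy hz

/-- The filtration is multiplicative and contains `𝔪𝓡(I)` in level one; conversely `R_j ⊆ 𝔪^j`, as
`R` is standard graded, so the pieces with `m ≤ j` lie in `𝔪^m 𝓡(I)`. -/
theorem toSubmodule_extendToRees_pow (hstd : IsStandardGraded 𝒜) (hV : V ≤ 𝒜 d)
    (hI : Ideal.span (V : Set R) = I) (m : ℕ) :
    ((extendToRees I (homogeneousMaximalIdeal 𝒜)) ^ m).toSubmodule k =
      bigradedSubmodule 𝒜 (reesFiltration 𝒜 V d 0 m) := by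
  apply le_antisymm
  · refine toSubmodule_pow_le_reesFiltration hV hI (toSubmodule_extendToRees_le (fun x hx => ?_)
      (reesAlgebra_mul_mem hV hI (reesFiltration_le hV 0 1)
        (reesPart_mul_reesFiltration_le 0 1))) m
    refine mem_bigradedSubmodule.2 fun n i => ?_
    rw [coeff_C]
    split_ifs with h
    · subst h
      rw [reesFiltration]
      split_ifs with h
      · have := reesPart_add (𝒜 := 𝒜) (V := V) (d := d) n 0
        rw [zero_mul, add_zero] at this
        rw [this, _root_.pow_zero, mul_one]
        exact proj_mem 𝒜 n x
      · have : n = 0 := by omega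
        subst this
        exact (Submodule.mem_bot k).2 (mem_homogeneousMaximalIdeal_iff.1 hx)
    · rw [map_zero]
      exact zero_mem _
  · refine bigradedSubmodule_le fun n i x hx => ?_
    rw [reesFiltration] at hx
    split_ifs at hx with h
    · refine monomial_mem_of_mem_reesPart hx fun j hj a ha v hv => ?_
      rw [mul_comm]
      exact Ideal.mul_mem_toSubmodule (reesAlgebra.monomial_mem.2 (mem_pow_of_mem_pow hI hv))
        (Ideal.toSubmodule_mono (Ideal.pow_le_pow_right (by omega)) (C_mem_toSubmodule_pow hstd ha))
    · rw [(Submodule.mem_bot k).1 hx, map_zero]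
      exact zero_mem _

theorem mem_reesHomogeneousMaximalIdeal_iff {𝔪 : Ideal R} {F : reesAlgebra I} :
    F ∈ reesHomogeneousMaximalIdeal I 𝔪 ↔ (F : R[X]).coeff 0 ∈ 𝔪 := Iff.rfl

theorem monomial_mem_toSubmodule_pow (hI : Ideal.span (V : Set R) = I) (𝔪 : Ideal R) {i : ℕ}
    {v : R} (hv : v ∈ V ^ i) :
    monomial i v ∈ ((reesHomogeneousMaximalIdeal I 𝔪) ^ i).toSubmodule k := by
  induction i generalizing v with
  | zero =>
    rw [_root_.pow_zero, Ideal.one_eq_top]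
    exact ⟨C_mem_reesAlgebra v, Submodule.mem_top⟩
  | succ i ih =>
    rw [_root_.pow_succ] at hv
    induction hv using Submodule.mul_induction_on' with
    | mem_mul_mem a ha v hv =>
      rw [← monomial_mul_monomial, _root_.pow_succ]
      refine Ideal.mul_mem_toSubmodule_mul (ih ha) ⟨reesAlgebra.monomial_mem.2 ?_, ?_⟩
      · rw [_root_.pow_one, ← hI]
        exact Ideal.subset_span hv
      · rw [mem_reesHomogeneousMaximalIdeal_iff, coeff_monomial, if_neg one_ne_zero]
        exact zero_mem _
    | add y _ z _ hy hz =>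
      rw [map_add]
      exact add_mem hy hz

theorem extendToRees_le_reesHomogeneousMaximalIdeal (𝔪 : Ideal R) :
    extendToRees I 𝔪 ≤ reesHomogeneousMaximalIdeal I 𝔪 := by
  refine Ideal.map_le_iff_le_comap.2 fun x hx => ?_
  rw [Ideal.mem_comap, mem_reesHomogeneousMaximalIdeal_iff]
  change (C x).coeff 0 ∈ 𝔪
  rwa [coeff_C_zero]

/-- Here `V^i X^i` contributes as well: `R_j` lies in the `j`-th power of the ideal and `V^i X^i` in
the `i`-th. In level one only the bidegree `j = i = 0` is excluded. -/
theorem toSubmodule_reesHomogeneousMaximalIdeal_pow (hstd : IsStandardGraded 𝒜) (hV : V ≤ 𝒜 d)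
    (hI : Ideal.span (V : Set R) = I) (m : ℕ) :
    ((reesHomogeneousMaximalIdeal I (homogeneousMaximalIdeal 𝒜)) ^ m).toSubmodule k =
      bigradedSubmodule 𝒜 (reesFiltration 𝒜 V d 1 m) := by
  apply le_antisymm
  · refine toSubmodule_pow_le_reesFiltration hV hI (fun F hF => ?_) m
    refine mem_bigradedSubmodule.2 fun n i => ?_
    have h1 := mem_bigradedSubmodule.1
      ((mem_reesAlgebra_iff_mem_bigradedSubmodule hV hI F).1 hF.1) n i
    have h2 : proj 𝒜 0 (F.coeff 0) = 0 := mem_homogeneousMaximalIdeal_iff.1 hF.2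
    rcases reesPart_cases d n i with hn | ⟨j, rfl⟩
    · rw [reesPart_of_lt hn] at h1
      rw [(Submodule.mem_bot k).1 h1]
      exact zero_mem _
    · rw [reesPart_add] at h1
      rw [reesFiltration_add]
      split_ifs with h
      · exact h1
      · obtain ⟨rfl, rfl⟩ : j = 0 ∧ i = 0 := by omega
        rwa [zero_mul, zero_add, Submodule.mem_bot]
  · refine bigradedSubmodule_le fun n i x hx => ?_
    rw [reesFiltration] at hx
    split_ifs at hx with h
    · refine monomial_mem_of_mem_reesPart hx fun j hj a ha v hv => ?_
      refine Ideal.toSubmodule_mono (Ideal.pow_le_pow_right (show m ≤ j + i by omega)) ?_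
      rw [_root_.pow_add]
      exact Ideal.mul_mem_toSubmodule_mul (Ideal.toSubmodule_mono (Ideal.pow_right_mono
        (extendToRees_le_reesHomogeneousMaximalIdeal _) _) (C_mem_toSubmodule_pow hstd ha))
        (monomial_mem_toSubmodule_pow hI _ hv)
    · rw [(Submodule.mem_bot k).1 hx, map_zero]
      exact zero_mem _

/-- In `X`-degree `i` the ideal `I 𝓡(I)` is `I · I^i = I^(i+1)`, whence the shift of `i` by one. -/
theorem toSubmodule_extendToRees_self (hV : V ≤ 𝒜 d)
    (hI : Ideal.span (V : Set R) = I) : (extendToRees I I).toSubmodule k =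
      bigradedSubmodule 𝒜 fun n i => reesPart 𝒜 V d n (i + 1) := by
  apply le_antisymm
  · refine toSubmodule_extendToRees_le (fun x hx => mem_bigradedSubmodule.2 fun n i => ?_)
      (reesAlgebra_mul_mem hV hI (fun n i => reesPart_le hV n (i + 1))
        fun n i m l => reesPart_mul_le n i m (l + 1))
    rw [coeff_C]
    split_ifs with h
    · subst h
      rw [← _root_.pow_one I, mem_pow_iff_proj_mem_reesPart hV hI] at hx
      exact hx n
    · rw [map_zero]
      exact zero_mem _
  · refine bigradedSubmodule_le fun n i x hx => ?_
    suffices reesPart 𝒜 V d n (i + 1) ≤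
        ((extendToRees I I).toSubmodule k).comap ((monomial i).restrictScalars k) from this hx
    rcases reesPart_cases d n (i + 1) with hn | ⟨j, rfl⟩
    · rw [reesPart_of_lt hn]
      exact bot_le
    · rw [reesPart_add, _root_.pow_succ, ← mul_assoc, Submodule.mul_le]
      intro w hw v hv
      change monomial i (w * v) ∈ (extendToRees I I).toSubmodule k
      rw [mul_comm, ← C_mul_monomial, mul_comm]
      refine Ideal.mul_mem_toSubmodule ?_ (C_mem_toSubmodule_extendToRees
        (by rw [← hI]; exact Ideal.subset_span hv))
      rw [reesAlgebra.monomial_mem]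
      have h : 𝒜 j * V ^ i ≤ (I ^ i).restrictScalars k := by
        rw [Submodule.mul_le]
        exact fun y _ z hz => Ideal.mul_mem_left _ _ (mem_pow_of_mem_pow hI hz)
      exact h hw

theorem toSubmodule_span_singleton_monomial (hV : V ≤ 𝒜 d) (hI : Ideal.span (V : Set R) = I)
    {b : R} {e : ℕ} (hb : b ∈ V ^ e) (hmem : monomial e b ∈ reesAlgebra I) :
    (Ideal.span {(⟨monomial e b, hmem⟩ : reesAlgebra I)}).toSubmodule k =
      bigradedSubmodule 𝒜 (reesMultiples 𝒜 V d b e) := by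
  apply le_antisymm
  · rintro F ⟨hF, h⟩
    obtain ⟨G, hG⟩ := Ideal.mem_span_singleton'.1 h
    have : F = G * monomial e b := (congrArg Subtype.val hG).symm
    rw [this]
    suffices bigradedSubmodule 𝒜 (reesPart 𝒜 V d) ≤ (bigradedSubmodule 𝒜
        (reesMultiples 𝒜 V d b e)).comap (LinearMap.mulRight k (monomial e b)) from
      this ((mem_reesAlgebra_iff_mem_bigradedSubmodule hV hI _).1 G.2)
    refine bigradedSubmodule_le fun n i x hx => ?_
    change monomial i x * monomial e b ∈ bigradedSubmodule 𝒜 (reesMultiples 𝒜 V d b e)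
    rw [monomial_mul_monomial]
    refine monomial_mem_bigradedSubmodule (n := n + e * d) (reesMultiples_le hV hb _ _) ?_
    rw [reesMultiples, if_pos ⟨Nat.le_add_left _ _, Nat.le_add_left _ _⟩, Nat.add_sub_cancel,
      Nat.add_sub_cancel, mul_comm x]
    exact Submodule.mul_mem_mul (Submodule.mem_span_singleton_self b) hx
  · refine bigradedSubmodule_le fun n i x hx => ?_
    rw [reesMultiples] at hx
    split_ifs at hx with h
    · rw [Submodule.mem_span_singleton_mul] at hx
      obtain ⟨z, hz, rfl⟩ := hx
      rw [← Nat.add_sub_cancel' h.1, ← monomial_mul_monomial, mul_comm]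
      refine Ideal.mul_mem_toSubmodule ?_ ⟨hmem, Ideal.mem_span_singleton_self _⟩
      exact (mem_reesAlgebra_iff_mem_bigradedSubmodule hV hI _).2
        (monomial_mem_bigradedSubmodule (reesPart_le hV _ _) hz)
    · rw [(Submodule.mem_bot k).1 hx, map_zero]
      exact zero_mem _

end ReesIdeals

/-! ### The prime ideal `𝔪𝓡(I)` -/

section ReesPrime

variable {k R : Type*} [Field k] [CommRing R] [Algebra k R] {𝒜 : ℕ → Submodule k R}
  [GradedAlgebra 𝒜] {V : Submodule k R} {d : ℕ} {I : Ideal R}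

open GradedAlgebra (proj)

variable (V d) in
/-- The part of `k[V X]` of degree `n` in `R` and of degree `i` in `X`. -/
def fiberPart (n i : ℕ) : Submodule k R := if n = i * d then V ^ i else ⊥

theorem fiberPart_le (hV : V ≤ 𝒜 d) (n i : ℕ) : fiberPart V d n i ≤ 𝒜 n := by
  rw [fiberPart]
  split_ifs with h
  · subst h
    exact pow_le_graded hV i
  · exact bot_le

omit [GradedAlgebra 𝒜] in
theorem fiberPart_mul_le (n i m l : ℕ) :
    fiberPart V d n i * fiberPart V d m l ≤ fiberPart V d (n + m) (i + l) := by
  by_cases h : n = i * d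
  · by_cases h' : m = l * d
    · rw [fiberPart, if_pos h, fiberPart, if_pos h', fiberPart, if_pos (by rw [h, h', add_mul]),
        _root_.pow_add]
    · rw [fiberPart, fiberPart, if_neg h', Submodule.mul_bot]
      exact bot_le
  · rw [fiberPart, if_neg h, Submodule.bot_mul]
    exact bot_le

theorem reesPart_le_fiberPart_sup (hstd : IsStandardGraded 𝒜) (n i : ℕ) :
    reesPart 𝒜 V d n i ≤ fiberPart V d n i ⊔ reesFiltration 𝒜 V d 0 1 n i := by
  rcases reesPart_cases d n i with hn | ⟨j, rfl⟩
  · rw [reesPart_of_lt hn]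
    exact bot_le
  · rw [reesPart_add, reesFiltration_add]
    split_ifs with h
    · exact le_sup_right
    · obtain rfl : j = 0 := by omega
      rw [fiberPart, if_pos (zero_add _), ← hstd.pow_one, _root_.pow_zero, one_mul]
      exact le_sup_left

theorem exists_fiber_add (hstd : IsStandardGraded 𝒜) (hV : V ≤ 𝒜 d)
    (hI : Ideal.span (V : Set R) = I) (F : reesAlgebra I) :
    ∃ F₀ ∈ bigradedSubmodule 𝒜 (fiberPart V d),
      ∃ F₁ ∈ (extendToRees I (homogeneousMaximalIdeal 𝒜)).toSubmodule k, F₀ + F₁ = (F : R[X]) := by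
  have h := (mem_reesAlgebra_iff_mem_bigradedSubmodule hV hI _).1 F.2
  have h1 := bigradedSubmodule_mono (𝒜 := 𝒜) (reesPart_le_fiberPart_sup hstd) h
  rw [← bigradedSubmodule_sup (fiberPart_le hV) (reesFiltration_le hV 0 1),
    ← toSubmodule_extendToRees_pow hstd hV hI, _root_.pow_one] at h1
  exact Submodule.mem_sup.1 h1

/-- `𝓡(I)` is the direct sum of the subring `k[VX]`, the pieces with `j = 0`, and the ideal `𝔪𝓡(I)`.
So the quotient is a subring of the domain `R[X]`: if a product lies in the ideal, then the product
of the two fiber components vanishes. -/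
theorem isPrime_extendToRees [IsDomain R] (hstd : IsStandardGraded 𝒜) (hV : V ≤ 𝒜 d)
    (hI : Ideal.span (V : Set R) = I) :
    (extendToRees I (homogeneousMaximalIdeal 𝒜)).IsPrime := by
  have hP := toSubmodule_extendToRees_pow hstd hV hI 1
  rw [_root_.pow_one] at hP
  have hcomp : ∀ F ∈ (extendToRees I (homogeneousMaximalIdeal 𝒜)).toSubmodule k, ∀ i,
      proj 𝒜 (i * d) (F.coeff i) = 0 := by
    intro F hF i
    rw [hP] at hF
    have := mem_bigradedSubmodule.1 hF (0 + i * d) i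
    rwa [reesFiltration_add, if_neg (by omega), zero_add, Submodule.mem_bot] at this
  have hfib : ∀ F ∈ bigradedSubmodule 𝒜 (fiberPart V d), (∀ i, proj 𝒜 (i * d) (F.coeff i) = 0) →
      F = 0 := by
    intro F hF h
    ext i
    refine eq_zero_of_proj_eq_zero 𝒜 fun n => ?_
    by_cases hn : n = i * d
    · rw [hn]
      exact h i
    · have := mem_bigradedSubmodule.1 hF n i
      rwa [fiberPart, if_neg hn, Submodule.mem_bot] at this
  refine ⟨fun h => ?_, fun {F G} hFG => ?_⟩
  · have h1 : (1 : R[X]) ∈ (extendToRees I (homogeneousMaximalIdeal 𝒜)).toSubmodule k :=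
      ⟨one_mem _, by rw [h]; exact Submodule.mem_top⟩
    have h2 := hcomp 1 h1 0
    rw [zero_mul, coeff_one_zero, proj_of_mem 𝒜 SetLike.GradedOne.one_mem] at h2
    exact one_ne_zero h2
  · obtain ⟨F₀, hF₀, F₁, hF₁, hF⟩ := exists_fiber_add hstd hV hI F
    obtain ⟨G₀, hG₀, G₁, hG₁, hG⟩ := exists_fiber_add hstd hV hI G
    have hF₀m : F₀ ∈ reesAlgebra I := by
      rw [eq_sub_of_add_eq hF]
      exact sub_mem F.2 hF₁.1
    have h0 : F₀ * G₀ ∈ (extendToRees I (homogeneousMaximalIdeal 𝒜)).toSubmodule k := by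
      have e : F₀ * G₀ = (F * G : R[X]) - (F₀ * G₁ + G * F₁) := by
        rw [← hF, ← hG]
        ring
      rw [e]
      exact sub_mem (Ideal.coe_mem_toSubmodule (F := F * G).2 hFG)
        (add_mem (Ideal.mul_mem_toSubmodule hF₀m hG₁) (Ideal.mul_mem_toSubmodule G.2 hF₁))
    have h00 : F₀ * G₀ = 0 := hfib _ (mul_mem_bigradedSubmodule (fiberPart_le hV)
      fiberPart_mul_le hF₀ hG₀) (hcomp _ h0)
    rcases mul_eq_zero.1 h00 with h | h
    · left
      rw [h, zero_add] at hF
      rw [← Ideal.coe_mem_toSubmodule (k := k), ← hF]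
      exact hF₁
    · right
      rw [h, zero_add] at hG
      rw [← Ideal.coe_mem_toSubmodule (k := k), ← hG]
      exact hG₁

end ReesPrime

/-! ### Lengths of bigraded quotients -/

/-- The length of the quotient by an ideal. -/
noncomputable def Ideal.quotientLength {S : Type*} [CommRing S] (J : Ideal S) : ℕ∞ :=
  Module.length S (S ⧸ J)

theorem length_quotient_eq_sum_finrank_sub {k S ι : Type*} [Field k] [CommRing S] [Algebra k S]
    {𝔪 : Ideal S} (hS : ∀ x : S, ∃ c : k, x - algebraMap k S c ∈ 𝔪) {n : ℕ} {J : Ideal S}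
    (hJ : 𝔪 ^ n ≤ J) [Fintype ι] {E : ι → Type*} [∀ t, AddCommGroup (E t)] [∀ t, Module k (E t)]
    [∀ t, Module.Finite k (E t)] (W : ∀ t, Submodule k (E t)) (f : S →ₗ[k] ∀ t, E t)
    (hf : Function.Surjective f) (hker : ∀ x, (∀ t, f x t ∈ W t) ↔ x ∈ J) :
    J.quotientLength = (∑ t, (Module.finrank k (E t) - Module.finrank k (W t)) : ℕ) := by
  let π : (∀ t, E t) →ₗ[k] (∀ t, E t ⧸ W t) :=
    LinearMap.pi fun t => Submodule.mkQ _ ∘ₗ LinearMap.proj t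
  have hπ : Function.Surjective π := by
    intro w
    choose v hv using fun t => Submodule.mkQ_surjective _ (w t)
    exact ⟨v, funext hv⟩
  have hs : Function.Surjective (π ∘ₗ f) := hπ.comp hf
  have h : J.quotientLength = _ := length_quotient_eq_finrank hS hJ (π ∘ₗ f) hs fun x => by
    rw [← hker, funext_iff]
    exact forall_congr' fun t => Submodule.Quotient.mk_eq_zero _
  rw [h, Module.finrank_pi_fintype]
  congr 1
  exact Finset.sum_congr rfl fun t _ => Submodule.finrank_quotient _

section ReesLength

variable {k R : Type*} [Field k] [CommRing R] [Algebra k R] {𝒜 : ℕ → Submodule k R}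
  [GradedAlgebra 𝒜] {V : Submodule k R} {d : ℕ} {I : Ideal R}

open GradedAlgebra (proj)

theorem exists_sub_algebraMap_mem (hstd : IsStandardGraded 𝒜) (F : reesAlgebra I) :
    ∃ c : k, F - algebraMap k (reesAlgebra I) c ∈
      reesHomogeneousMaximalIdeal I (homogeneousMaximalIdeal 𝒜) := by
  have h := proj_mem 𝒜 0 ((F : R[X]).coeff 0)
  rw [hstd.degree_zero] at h
  obtain ⟨c, hc⟩ := h
  refine ⟨c, ?_⟩
  rw [mem_reesHomogeneousMaximalIdeal_iff, mem_homogeneousMaximalIdeal_iff]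
  change proj 𝒜 0 (((F : R[X]) - C (algebraMap k R c)).coeff 0) = 0
  rw [coeff_sub, coeff_C_zero, map_sub, ← hc, proj_of_mem 𝒜 (n := 0), Algebra.linearMap_apply,
    sub_self]
  rw [hstd.degree_zero]
  exact ⟨c, rfl⟩

/-- The components of an element of the Rees algebra in the bidegrees in `T`. -/
noncomputable def reesComponents (hV : V ≤ 𝒜 d) (hI : Ideal.span (V : Set R) = I)
    (T : Finset (ℕ × ℕ)) :
    reesAlgebra I →ₗ[k] ((t : T) → ↥(𝒜 t.1.1 * V ^ t.1.2)) :=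
  LinearMap.pi fun t => LinearMap.codRestrict _
    (proj 𝒜 (t.1.1 + t.1.2 * d) ∘ₗ (lcoeff R t.1.2).restrictScalars k ∘ₗ
      (reesAlgebra I).val.toLinearMap.restrictScalars k) fun F => by
    have := mem_bigradedSubmodule.1 ((mem_reesAlgebra_iff_mem_bigradedSubmodule hV hI _).1 F.2)
      (t.1.1 + t.1.2 * d) t.1.2
    rwa [reesPart_add] at this

theorem coe_reesComponents (hV : V ≤ 𝒜 d) (hI : Ideal.span (V : Set R) = I)
    (T : Finset (ℕ × ℕ)) (F : reesAlgebra I) (t : T) :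
    (reesComponents hV hI T F t : R) =
      proj 𝒜 (t.1.1 + t.1.2 * d) ((F : R[X]).coeff t.1.2) := rfl

theorem reesComponents_surjective (hV : V ≤ 𝒜 d) (hI : Ideal.span (V : Set R) = I)
    (T : Finset (ℕ × ℕ)) : Function.Surjective (reesComponents hV hI T) := by
  intro w
  have hw : ∀ t : T, (w t : R) ∈ 𝒜 (t.1.1 + t.1.2 * d) := fun t => by
    have h := reesPart_le hV (t.1.1 + t.1.2 * d) t.1.2
    rw [reesPart_add] at h
    exact h (w t).2
  refine ⟨⟨∑ t, monomial t.1.2 (w t : R), sum_mem fun t _ => ?_⟩, funext fun t => Subtype.ext ?_⟩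
  · refine (mem_reesAlgebra_iff_mem_bigradedSubmodule hV hI _).2
      (monomial_mem_bigradedSubmodule (n := t.1.1 + t.1.2 * d) (reesPart_le hV _ _) ?_)
    rw [reesPart_add]
    exact (w t).2
  · rw [coe_reesComponents, finsetSum_coeff, map_sum, Finset.sum_eq_single t]
    · rw [coeff_monomial_same, proj_of_mem 𝒜 (hw t)]
    · intro u _ hu
      rw [coeff_monomial]
      split_ifs with h
      · refine proj_of_mem_ne 𝒜 (hw u) fun h' => hu (Subtype.ext (Prod.ext ?_ h))
        rw [h] at h'
        exact Nat.add_right_cancel h'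
      · exact map_zero _
    · simp

/-- The length of a quotient of the Rees algebra by a bigraded ideal. -/
theorem length_quotient_eq_sum (hstd : IsStandardGraded 𝒜) (hV : V ≤ 𝒜 d)
    (hI : Ideal.span (V : Set R) = I) {Q : ℕ → ℕ → Submodule k R} {𝔮 : Ideal (reesAlgebra I)}
    (h𝔮 : 𝔮.toSubmodule k = bigradedSubmodule 𝒜 Q) {m : ℕ}
    (hm : reesHomogeneousMaximalIdeal I (homogeneousMaximalIdeal 𝒜) ^ m ≤ 𝔮)
    (T : Finset (ℕ × ℕ)) (hQ : ∀ j i, Q (j + i * d) i ≤ 𝒜 j * V ^ i)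
    (hT : ∀ j i, (j, i) ∉ T → Q (j + i * d) i = 𝒜 j * V ^ i) :
    𝔮.quotientLength =
      (∑ t ∈ T, (Module.finrank k ↥(𝒜 t.1 * V ^ t.2) -
        Module.finrank k (Q (t.1 + t.2 * d) t.2)) : ℕ) := by
  have hfin : ∀ j i, Module.Finite k ↥(𝒜 j * V ^ i) := fun j i =>
    Module.Finite.iff_fg.2 ((hstd.fg j).mul ((hstd.fg_of_le hV).pow i))
  have h := length_quotient_eq_sum_finrank_sub (exists_sub_algebraMap_mem hstd) hm
    (fun t : T => (Q (t.1.1 + t.1.2 * d) t.1.2).submoduleOf (𝒜 t.1.1 * V ^ t.1.2))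
    (reesComponents hV hI T) (reesComponents_surjective hV hI T) ?_
  · rw [h, Finset.univ_eq_attach, ← Finset.sum_attach T]
    congr 1
    refine Finset.sum_congr rfl fun t _ => ?_
    rw [(Submodule.submoduleOfEquivOfLe (hQ _ _)).finrank_eq]
  · intro F
    have h1 : (∀ t : T, reesComponents hV hI T F t ∈
        (Q (t.1.1 + t.1.2 * d) t.1.2).submoduleOf (𝒜 t.1.1 * V ^ t.1.2)) ↔ ∀ t : T,
        proj 𝒜 (t.1.1 + t.1.2 * d) ((F : R[X]).coeff t.1.2) ∈ Q (t.1.1 + t.1.2 * d) t.1.2 :=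
      Iff.rfl
    rw [h1, ← Ideal.coe_mem_toSubmodule (k := k), h𝔮, mem_bigradedSubmodule]
    have hF := mem_bigradedSubmodule.1
      ((mem_reesAlgebra_iff_mem_bigradedSubmodule hV hI _).1 F.2)
    refine ⟨fun h n i => ?_, fun h t => h _ _⟩
    rcases reesPart_cases d n i with hn | ⟨j, rfl⟩
    · have := hF n i
      rw [reesPart_of_lt hn] at this
      rw [(Submodule.mem_bot k).1 this]
      exact zero_mem _
    · by_cases ht : (j, i) ∈ T
      · exact h ⟨(j, i), ht⟩
      · rw [hT j i ht, ← reesPart_add]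
        exact hF _ _

end ReesLength

/-! ### The Samuel function of the torsion ideal -/

/-- By the Noetherian property one power `𝔞^c` kills the saturation `N`. Artin–Rees gives `N ∩ 𝔞^J =
𝔞^(J-c') (𝔞^c' ∩ N)`, which is contained in `𝔞^c N = 0` once `c + c' ≤ J`. -/
theorem exists_forall_idealSaturation_inf_pow_eq_bot {G : Type*} [CommRing G] [IsNoetherianRing G]
    (𝔞 : Ideal G) : ∃ J₀ : ℕ, ∀ J, J₀ ≤ J → idealSaturation ⊥ 𝔞 ⊓ 𝔞 ^ J = ⊥ := by
  let f : ℕ →o Ideal G := ⟨fun n => (⊥ : Ideal G).colon ((𝔞 ^ n : Ideal G) : Set G),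
    fun n m h => Submodule.colon_mono le_rfl (Ideal.pow_le_pow_right h)⟩
  obtain ⟨c, hc⟩ := monotone_stabilizes_iff_noetherian.2 ‹IsNoetherianRing G› f
  have hN : idealSaturation ⊥ 𝔞 = f c := by
    refine le_antisymm (iSup_le fun n => ?_) (le_iSup (fun n => f n) c)
    rcases le_total n c with h | h
    · exact f.mono h
    · exact (hc n h).ge
  obtain ⟨c', hc'⟩ := Ideal.exists_pow_inf_eq_pow_smul 𝔞 (idealSaturation ⊥ 𝔞)
  refine ⟨c + c', fun J hJ => ?_⟩
  have h1 := hc' J (by omega)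
  rw [smul_eq_mul, Ideal.mul_top, inf_comm] at h1
  rw [h1, eq_bot_iff, smul_eq_mul, smul_eq_mul, Ideal.mul_top]
  refine (Ideal.mul_mono (Ideal.pow_le_pow_right (show c ≤ J - c' by omega)) inf_le_right).trans ?_
  rw [hN, Ideal.mul_le]
  intro x hx y hy
  rw [mul_comm]
  exact Submodule.mem_colon.1 hy x hx

theorem Ideal.quotientLength_anti {S : Type*} [CommRing S] {J K : Ideal S} (h : J ≤ K) :
    K.quotientLength ≤ J.quotientLength :=
  Module.length_quotient_le_of_le h

theorem Ideal.quotientLength_comap {S T : Type*} [CommRing S] [CommRing T] {f : S →+* T}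
    (hf : Function.Surjective f) (J : Ideal T) :
    (J.comap f).quotientLength = J.quotientLength := by
  have : RingHomSurjective f := ⟨hf⟩
  let g : (S ⧸ J.comap f) →ₛₗ[f] T ⧸ J :=
    { toFun := Ideal.quotientMap J f le_rfl
      map_add' := map_add _
      map_smul' := fun a x => by
        obtain ⟨x, rfl⟩ := Ideal.Quotient.mk_surjective x
        change Ideal.Quotient.mk J (f (a * x)) = Ideal.Quotient.mk J (f a * f x)
        rw [map_mul] }
  have hg : Function.Bijective g :=
    ⟨Ideal.quotientMap_injective, Ideal.quotientMap_surjective (H := le_rfl) hf⟩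
  rw [Ideal.quotientLength, Ideal.quotientLength, Module.length, Module.length, WithBot.unbot_inj,
    Order.krullDim_eq_of_orderIso (Submodule.orderIsoMapComapOfBijective g hg)]

theorem Ideal.quotientLength_map_mk {S : Type*} [CommRing S] (K J : Ideal S) :
    (J.map (Ideal.Quotient.mk K)).quotientLength = (K ⊔ J).quotientLength := by
  rw [← Ideal.quotientLength_comap Ideal.Quotient.mk_surjective, Ideal.comap_map_quotientMk]

/-- The Samuel function of an ideal `N` with `N ∩ 𝔞 ^ J = 0` and `a ∈ N` is determined by the
lengths of quotient rings. -/
theorem hasSamuelLimit_of_inf_pow_eq_bot {G : Type*} [CommRing G] [IsNoetherianRing G]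
    (𝔞 M N : Ideal G) {J : ℕ} (hN : N ⊓ 𝔞 ^ J = ⊥) {a : G} (ha : a ∈ N) {l l' : ℕ → ℕ} {s : ℕ}
    {L : ℝ} (hl : ∀ n, (𝔞 ^ J ⊔ M ^ n).quotientLength = l n)
    (hl' : ∀ n, (𝔞 ^ J ⊔ M ^ n ⊔ Ideal.span {a}).quotientLength ≤ l' n)
    (hL : Tendsto (fun n : ℕ => (l n : ℝ) / (n : ℝ) ^ s) atTop (𝓝 L))
    (hL' : Tendsto (fun n : ℕ => (l' n : ℝ) / (n : ℝ) ^ s) atTop (𝓝 0)) :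
    HasSamuelLimit G M N s (s ! * L) := by
  obtain ⟨c, hc⟩ := exists_length_quotient_pow_smul_le 𝔞 M N hN
  have hup : ∀ n, Module.length G (N ⧸ (M ^ n • ⊤ : Submodule G N)) ≤ l (n + c) := fun n =>
    (hc n).trans_eq (hl (n + c))
  have hfin : ∀ n, Module.length G (N ⧸ (M ^ n • ⊤ : Submodule G N)) ≠ ⊤ := fun n =>
    ne_top_of_le_ne_top (ENat.natCast_ne_top _) (hup n)
  refine ⟨hfin, ?_⟩
  set m : ℕ → ℕ := fun n => (Module.length G (N ⧸ (M ^ n • ⊤ : Submodule G N))).toNat with hm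
  have hcoe : ∀ n, Module.length G (N ⧸ (M ^ n • ⊤ : Submodule G N)) = m n := fun n =>
    (ENat.natCast_toNat (hfin n)).symm
  have h1 : ∀ n, m n ≤ l (n + c) := fun n => by
    have := hup n
    rw [hcoe] at this
    exact_mod_cast this
  have h2 : ∀ n, l n ≤ m n + l' n := fun n => by
    have h := (hl n).symm.trans_le ((length_quotient_sup_pow_le (𝔞 ^ J) M N ha n).trans
      (add_le_add_right (hl' n) _))
    rw [hcoe] at h
    exact_mod_cast h
  -- The squeeze is `l n - l' n ≤ m n ≤ l (n + c)`; the shift by the Artin–Rees constant does not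
  -- change the limit.
  have hlim : Tendsto (fun n : ℕ => (m n : ℝ) / (n : ℝ) ^ s) atTop (𝓝 L) := by
    have hlow := hL.sub hL'
    rw [sub_zero] at hlow
    refine tendsto_of_tendsto_of_tendsto_of_le_of_le hlow
      (tendsto_add_div_pow (a := fun n => (l n : ℝ)) hL c) (fun n => ?_) (fun n => ?_)
    · beta_reduce
      rw [← sub_div]
      gcongr
      rw [sub_le_iff_le_add]
      exact_mod_cast h2 n
    · beta_reduce
      gcongr
      exact h1 n
  exact (hlim.const_mul (s ! : ℝ)).congr fun n => (mul_div_assoc _ _ _).symm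

theorem finrank_span_singleton_mul {k R : Type*} [Field k] [CommRing R] [IsDomain R] [Algebra k R]
    {b : R} (hb : b ≠ 0) (W : Submodule k R) :
    Module.finrank k ↥(Submodule.span k {b} * W) = Module.finrank k W := by
  have h : Submodule.span k {b} * W = W.map (LinearMap.mulLeft k b) := by
    ext x
    rw [Submodule.mem_span_singleton_mul]
    rfl
  rw [h]
  exact (Submodule.equivMapOfInjective _ (mul_right_injective₀ hb) W).finrank_eq.symm

/-! ### Sums over bidegrees -/

section ReesGrowth

variable {k R : Type*} [Field k] [CommRing R] [IsDomain R] [Algebra k R] {𝒜 : ℕ → Submodule k R}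
  [GradedAlgebra 𝒜] {V : Submodule k R} {d : ℕ}

open GradedAlgebra (proj)

/-- The pairs `(j, i)` with `j < J` and `i + j < n`. -/
def bidegrees (J n : ℕ) : Finset (ℕ × ℕ) :=
  ((Finset.range J).sigma fun j => Finset.range (n - j)).map
    (Equiv.sigmaEquivProd ℕ ℕ).toEmbedding

theorem mem_bidegrees {J n j i : ℕ} : (j, i) ∈ bidegrees J n ↔ j < J ∧ j + i < n := by
  rw [bidegrees, Finset.mem_map_equiv, Finset.mem_sigma, Finset.mem_range, Finset.mem_range]
  change j < J ∧ i < n - j ↔ _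
  omega

theorem sum_bidegrees {M : Type*} [AddCommMonoid M] (f : ℕ → ℕ → M) (J n : ℕ) :
    ∑ t ∈ bidegrees J n, f t.1 t.2 =
      ∑ j ∈ Finset.range J, ∑ i ∈ Finset.range (n - j), f j i := by
  rw [bidegrees, Finset.sum_map, Finset.sum_sigma]
  rfl

variable {h : ℕ → ℕ} {e : ℝ} {s : ℕ}

/-- There are finitely many rows `j < J`; row `j` is cut off at `n - j` instead of `n`, which does
not affect its limit. -/
theorem tendsto_sum_bidegrees_sub (f g : ℕ → ℕ → ℕ) (hgf : ∀ j i, g j i ≤ f j i) {F G : ℕ → ℝ}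
    (hf : ∀ j, Tendsto (fun n : ℕ =>
      (∑ i ∈ Finset.range n, (f j i : ℝ)) / (n : ℝ) ^ s) atTop (𝓝 (F j)))
    (hg : ∀ j, Tendsto (fun n : ℕ =>
      (∑ i ∈ Finset.range n, (g j i : ℝ)) / (n : ℝ) ^ s) atTop (𝓝 (G j))) (J : ℕ) :
    Tendsto (fun n : ℕ => ((∑ t ∈ bidegrees J n, (f t.1 t.2 - g t.1 t.2) : ℕ) : ℝ) / (n : ℝ) ^ s)
      atTop (𝓝 (∑ j ∈ Finset.range J, (F j - G j))) := by
  have h1 : ∀ j, Tendsto (fun n : ℕ => (∑ i ∈ Finset.range (n - j), (f j i : ℝ)) / (n : ℝ) ^ s -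
      (∑ i ∈ Finset.range (n - j), (g j i : ℝ)) / (n : ℝ) ^ s) atTop (𝓝 (F j - G j)) := fun j =>
    (tendsto_sub_div_pow (hf j) j).sub (tendsto_sub_div_pow (hg j) j)
  refine (tendsto_finsetSum (Finset.range J) fun j _ => h1 j).congr fun n => ?_
  rw [sum_bidegrees (fun j i => f j i - g j i), Nat.cast_sum, Finset.sum_div]
  refine Finset.sum_congr rfl fun j _ => ?_
  rw [Nat.cast_sum, ← sub_div, ← Finset.sum_sub_distrib]
  congr 1
  exact Finset.sum_congr rfl fun i _ => (Nat.cast_sub (hgf j i)).symm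

/-- The two sums differ by an index shift and the single term `a 0`, which disappears after division
by `n^s` because `0 < s`. -/
theorem tendsto_sum_succ_div_pow (hs : 0 < s) {a : ℕ → ℝ} {L : ℝ}
    (ha : Tendsto (fun n : ℕ => (∑ i ∈ Finset.range n, a i) / (n : ℝ) ^ s) atTop (𝓝 L)) :
    Tendsto (fun n : ℕ => (∑ i ∈ Finset.range n, a (i + 1)) / (n : ℝ) ^ s) atTop (𝓝 L) := by
  have h1 := tendsto_add_div_pow (a := fun n => ∑ i ∈ Finset.range n, a i) ha 1
  have h2 : Tendsto (fun n : ℕ => a 0 / (n : ℝ) ^ s) atTop (𝓝 0) :=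
    tendsto_const_nhds.div_atTop
      ((tendsto_pow_atTop hs.ne').comp tendsto_natCast_atTop_atTop)
  have h3 := h1.sub h2
  rw [sub_zero] at h3
  refine h3.congr fun n => ?_
  rw [← sub_div, Finset.sum_range_succ', add_sub_cancel_right]

theorem tendsto_sum_pred_div_pow {a : ℕ → ℝ} {L : ℝ}
    (ha : Tendsto (fun n : ℕ => (∑ i ∈ Finset.range n, a i) / (n : ℝ) ^ s) atTop (𝓝 L)) (c : ℕ) :
    Tendsto (fun n : ℕ => (∑ i ∈ Finset.range n, if c ≤ i then a (i - c) else 0) / (n : ℝ) ^ s)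
      atTop (𝓝 L) := by
  refine (tendsto_sub_div_pow ha c).congr fun n => ?_
  congr 1
  rcases le_total c n with hc | hc
  · obtain ⟨m, rfl⟩ := Nat.exists_eq_add_of_le hc
    rw [Finset.sum_range_add, Finset.sum_eq_zero (s := Finset.range c), zero_add,
      Nat.add_sub_cancel_left]
    · refine Finset.sum_congr rfl fun i _ => ?_
      rw [if_pos (Nat.le_add_right _ _), Nat.add_sub_cancel_left]
    · intro i hi
      rw [if_neg (not_le.2 (Finset.mem_range.1 hi))]
  · rw [Nat.sub_eq_zero_of_le hc, Finset.range_zero, Finset.sum_empty, Finset.sum_eq_zero]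
    intro i hi
    rw [if_neg (not_le.2 ((Finset.mem_range.1 hi).trans_le hc))]

/-- Telescoping with step `d` leaves the last `d` values of `h`, with indices at least `J - d ≥ j₀`.
This is the source of the factor `d` in the formula for `j(I)`. -/
theorem sum_range_sub_ite_pred (h : ℕ → ℝ) {r : ℝ} {d j₀ J : ℕ} (hr : ∀ j, j₀ ≤ j → h j = r)
    (hJ : j₀ + d ≤ J) :
    ∑ j ∈ Finset.range J, (h j - if d ≤ j then h (j - d) else 0) = d * r := by
  obtain ⟨m, rfl⟩ := Nat.exists_eq_add_of_le (le_of_add_le_right hJ)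
  rw [Finset.sum_sub_distrib, Finset.sum_range_add (fun j => if d ≤ j then h (j - d) else 0),
    Finset.sum_eq_zero (s := Finset.range d), zero_add]
  · have h1 : ∑ x ∈ Finset.range m, (if d ≤ d + x then h (d + x - d) else 0) =
        ∑ x ∈ Finset.range m, h x := Finset.sum_congr rfl fun i _ => by
      rw [if_pos (Nat.le_add_right _ _), Nat.add_sub_cancel_left]
    rw [h1, add_comm d m, Finset.sum_range_add, add_sub_cancel_left,
      Finset.sum_congr rfl fun i _ => hr (m + i) (by omega), Finset.sum_const, Finset.card_range,
      nsmul_eq_mul]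
  · intro i hi
    rw [if_neg (not_le.2 (Finset.mem_range.1 hi))]

end ReesGrowth

theorem mem_idealSaturation_bot {G : Type*} [CommRing G] {𝔞 : Ideal G} {a : G} {c : ℕ}
    (h : ∀ y ∈ 𝔞 ^ c, y * a = 0) : a ∈ idealSaturation ⊥ 𝔞 := by
  have hle := le_iSup (fun n => (⊥ : Ideal G).colon ((𝔞 ^ n : Ideal G) : Set G)) c
  refine hle (Submodule.mem_colon.2 fun y hy => ?_)
  rw [smul_eq_mul, mul_comm, h y hy]
  exact zero_mem _

theorem hasSamuelLimit_idealSaturation {S : Type*} [CommRing S] [IsNoetherianRing S]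
    (K P M : Ideal S) {a : S} {c : ℕ} (ha : ∀ x ∈ P ^ c, x * a ∈ K) {j₁ s : ℕ} {L : ℝ}
    {l l' : ℕ → ℕ → ℕ} (hl : ∀ J, j₁ ≤ J → ∀ n, (K ⊔ (P ^ J ⊔ M ^ n)).quotientLength = l J n)
    (hl' : ∀ J n, (P ^ J ⊔ M ^ n ⊔ Ideal.span {a}).quotientLength = l' J n)
    (hL : ∀ J, j₁ ≤ J → Tendsto (fun n : ℕ => (l J n : ℝ) / (n : ℝ) ^ s) atTop (𝓝 L))
    (hL' : ∀ J, Tendsto (fun n : ℕ => (l' J n : ℝ) / (n : ℝ) ^ s) atTop (𝓝 0)) :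
    HasSamuelLimit (S ⧸ K) (M.map (Ideal.Quotient.mk K))
      (idealSaturation ⊥ (P.map (Ideal.Quotient.mk K))) s (s ! * L) := by
  obtain ⟨J₀, hJ₀⟩ := exists_forall_idealSaturation_inf_pow_eq_bot (P.map (Ideal.Quotient.mk K))
  have hmap : ∀ J n, P.map (Ideal.Quotient.mk K) ^ J ⊔ M.map (Ideal.Quotient.mk K) ^ n =
      (P ^ J ⊔ M ^ n).map (Ideal.Quotient.mk K) := fun J n => by
    rw [Ideal.map_sup, Ideal.map_pow, Ideal.map_pow]
  have haN : Ideal.Quotient.mk K a ∈ idealSaturation ⊥ (P.map (Ideal.Quotient.mk K)) := by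
    refine mem_idealSaturation_bot (c := c) fun y hy => ?_
    rw [← Ideal.map_pow] at hy
    obtain ⟨x, hx, rfl⟩ := (Ideal.mem_map_iff_of_surjective _ Ideal.Quotient.mk_surjective).1 hy
    rw [← map_mul, Ideal.Quotient.eq_zero_iff_mem]
    exact ha x hx
  -- The exponent `max J₀ j₁` makes the torsion meet `𝔞^J` trivially and puts the lengths `l` in
  -- their stable range.
  refine hasSamuelLimit_of_inf_pow_eq_bot _ _ _ (hJ₀ (max J₀ j₁) (le_max_left _ _)) haN
    (l := l (max J₀ j₁)) (l' := l' (max J₀ j₁)) (fun n => ?_) (fun n => ?_)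
    (hL _ (le_max_right _ _)) (hL' _)
  · rw [hmap, Ideal.quotientLength_map_mk, hl _ (le_max_right _ _)]
  · rw [hmap, ← Set.image_singleton, ← Ideal.map_span, ← Ideal.map_sup,
      Ideal.quotientLength_map_mk, ← hl']
    exact Ideal.quotientLength_anti le_sup_right

/-- The bidegrees missing from `𝔪^J + 𝔐^n` are those with `j < J` and `j + i < n`, which explains
`bidegrees`. -/
theorem reesFiltration_sup_add {k R : Type*} [Field k] [CommRing R] [Algebra k R]
    {𝒜 : ℕ → Submodule k R} {V : Submodule k R} {d : ℕ} (J n j i : ℕ) :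
    reesFiltration 𝒜 V d 0 J (j + i * d) i ⊔ reesFiltration 𝒜 V d 1 n (j + i * d) i =
      if (j, i) ∈ bidegrees J n then ⊥ else 𝒜 j * V ^ i := by
  rw [reesFiltration_add, reesFiltration_add, zero_mul, add_zero, one_mul]
  split_ifs with h1 h2 h3 h3 h2 h3 h3
  · rw [mem_bidegrees] at h3; omega
  · rw [sup_idem]
  · rw [mem_bidegrees] at h3; omega
  · rw [sup_bot_eq]
  · rw [mem_bidegrees] at h3; omega
  · rw [bot_sup_eq]
  · rw [bot_sup_eq]
  · rw [mem_bidegrees] at h3; omega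

theorem tendsto_sum_bidegrees_sub_succ {d : ℕ} (f : ℕ → ℕ → ℕ)
    (hle : ∀ j i, f j (i + 1) ≤ f (j + d) i) {s : ℕ} (hs : 0 < s) {F : ℕ → ℝ}
    (hf : ∀ j, Tendsto (fun n : ℕ =>
      (∑ i ∈ Finset.range n, (f j i : ℝ)) / (n : ℝ) ^ s) atTop (𝓝 (F j))) {L : ℝ} {j₀ J : ℕ}
    (hL : ∀ j, j₀ ≤ j → F j = L) (hJ : j₀ + d ≤ J) :
    Tendsto (fun n : ℕ => ((∑ t ∈ bidegrees J n,
      (f t.1 t.2 - if d ≤ t.1 then f (t.1 - d) (t.2 + 1) else 0) : ℕ) : ℝ) / (n : ℝ) ^ s) atTop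
      (𝓝 (d * L)) := by
  rw [← sum_range_sub_ite_pred F hL hJ]
  refine tendsto_sum_bidegrees_sub f (fun j i => if d ≤ j then f (j - d) (i + 1) else 0)
    (fun j i => ?_) hf (fun j => ?_) J
  · split_ifs with hj
    · obtain ⟨l, rfl⟩ := Nat.exists_eq_add_of_le' hj
      rw [Nat.add_sub_cancel]
      exact hle l i
    · exact Nat.zero_le _
  · by_cases hj : d ≤ j
    · simp only [if_pos hj]
      exact tendsto_sum_succ_div_pow (a := fun i => (f (j - d) i : ℝ)) hs (hf (j - d))
    · simp only [if_neg hj, Nat.cast_zero, Finset.sum_const_zero, zero_div]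
      exact tendsto_const_nhds

/-- Each row is compared with its own shift by `c`, so the limits cancel: multiples of `b X^c`
account for all the growth. -/
theorem tendsto_sum_bidegrees_sub_pred (f : ℕ → ℕ → ℕ) {c : ℕ}
    (hle : ∀ j i, f j i ≤ f j (i + c)) {s : ℕ} {F : ℕ → ℝ}
    (hf : ∀ j, Tendsto (fun n : ℕ =>
      (∑ i ∈ Finset.range n, (f j i : ℝ)) / (n : ℝ) ^ s) atTop (𝓝 (F j))) (J : ℕ) :
    Tendsto (fun n : ℕ => ((∑ t ∈ bidegrees J n,
      (f t.1 t.2 - if c ≤ t.2 then f t.1 (t.2 - c) else 0) : ℕ) : ℝ) / (n : ℝ) ^ s) atTop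
      (𝓝 0) := by
  have h := tendsto_sum_bidegrees_sub f (fun j i => if c ≤ i then f j (i - c) else 0)
    (fun j i => ?_) hf (G := F) (fun j => ?_) J
  · simpa only [sub_self, Finset.sum_const_zero] using h
  · split_ifs with hi
    · obtain ⟨l, rfl⟩ := Nat.exists_eq_add_of_le' hi
      rw [Nat.add_sub_cancel]
      exact hle j l
    · exact Nat.zero_le _
  · have h := tendsto_sum_pred_div_pow (a := fun i => (f j i : ℝ)) (hf j) c
    simpa only [Nat.cast_ite, Nat.cast_zero] using h

/-! ### The `j`-multiplicity -/

section JMultiplicity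

variable {k R : Type*} [Field k] [CommRing R] [Algebra k R] {𝒜 : ℕ → Submodule k R}
  [GradedAlgebra 𝒜] {V : Submodule k R} {d : ℕ} {I : Ideal R}

open GradedAlgebra (proj)

theorem homogeneousMaximalIdeal_eq_span (hstd : IsStandardGraded 𝒜) :
    homogeneousMaximalIdeal 𝒜 = Ideal.span (𝒜 1 : Set R) := by
  classical
  apply le_antisymm
  · intro x hx
    rw [← DirectSum.sum_support_decompose 𝒜 x]
    refine sum_mem fun n _ => ?_
    rcases n with _ | n
    · have : proj 𝒜 0 x = 0 := mem_homogeneousMaximalIdeal_iff.1 hx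
      change proj 𝒜 0 x ∈ _
      rw [this]
      exact zero_mem _
    · have h : 𝒜 n * 𝒜 1 ≤ (Ideal.span (𝒜 1 : Set R)).restrictScalars k :=
        Submodule.mul_le.2 fun y _ z hz => Ideal.mul_mem_left _ _ (Ideal.subset_span hz)
      rw [hstd.mul_eq] at h
      exact h (proj_mem 𝒜 (n + 1) x)
  · rw [Ideal.span_le]
    exact fun x hx => mem_homogeneousMaximalIdeal_iff.2 (proj_of_mem_ne 𝒜 hx one_ne_zero)

theorem homogeneousMaximalIdeal_pow_eq_span (hstd : IsStandardGraded 𝒜) (n : ℕ) :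
    homogeneousMaximalIdeal 𝒜 ^ n = Ideal.span (𝒜 n : Set R) := by
  rw [homogeneousMaximalIdeal_eq_span hstd, Ideal.span_submodule_pow, hstd.pow_one]

theorem extendToRees_homogeneousMaximalIdeal_pow (hstd : IsStandardGraded 𝒜) (n : ℕ) :
    extendToRees I (homogeneousMaximalIdeal 𝒜) ^ n =
      Ideal.span (algebraMap R (reesAlgebra I) '' (𝒜 n : Set R)) := by
  rw [extendToRees, ← Ideal.map_pow, homogeneousMaximalIdeal_pow_eq_span hstd, Ideal.map_span]

/-- `b R_{c+d} ⊆ R_c V^(e+1)` says that `b X^e` carries `R_{c+d}` into `I^(e+1) X^e ⊆ I 𝓡(I)`. Hence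
the class of `b X^e` in `𝒢` is killed by a power of `𝔪`. -/
theorem monomial_mul_mem_extendToRees (hstd : IsStandardGraded 𝒜) (hV : V ≤ 𝒜 d)
    (hI : Ideal.span (V : Set R) = I) {b : R} {e c : ℕ} (hmem : monomial e b ∈ reesAlgebra I)
    (h : ∀ x ∈ 𝒜 (c + d), b * x ∈ 𝒜 c * V ^ (e + 1)) :
    ∀ F ∈ extendToRees I (homogeneousMaximalIdeal 𝒜) ^ (c + d),
      F * ⟨monomial e b, hmem⟩ ∈ extendToRees I I := by
  intro F hF
  rw [extendToRees_homogeneousMaximalIdeal_pow hstd] at hF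
  induction hF using Submodule.span_induction with
  | mem F hF =>
    obtain ⟨x, hx, rfl⟩ := hF
    rw [← Ideal.coe_mem_toSubmodule (k := k), toSubmodule_extendToRees_self hV hI]
    change C x * monomial e b ∈ bigradedSubmodule 𝒜 fun n i => reesPart 𝒜 V d n (i + 1)
    rw [C_mul_monomial, mul_comm]
    refine monomial_mem_bigradedSubmodule (Q := fun n i => reesPart 𝒜 V d n (i + 1))
      (n := c + (e + 1) * d) (reesPart_le hV _ _) ?_
    rw [reesPart_add]
    exact h x hx
  | zero =>
    rw [zero_mul]
    exact zero_mem _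
  | add F G _ _ hF hG =>
    rw [add_mul]
    exact add_mem hF hG
  | smul G F _ hF =>
    rw [smul_eq_mul, mul_assoc]
    exact Ideal.mul_mem_left _ _ hF

theorem toSubmodule_pow_sup_pow (hstd : IsStandardGraded 𝒜) (hV : V ≤ 𝒜 d)
    (hI : Ideal.span (V : Set R) = I) (J n : ℕ) :
    (extendToRees I (homogeneousMaximalIdeal 𝒜) ^ J ⊔
      reesHomogeneousMaximalIdeal I (homogeneousMaximalIdeal 𝒜) ^ n).toSubmodule k =
      bigradedSubmodule 𝒜 fun m i =>
        reesFiltration 𝒜 V d 0 J m i ⊔ reesFiltration 𝒜 V d 1 n m i := by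
  rw [Ideal.toSubmodule_sup, toSubmodule_extendToRees_pow hstd hV hI,
    toSubmodule_reesHomogeneousMaximalIdeal_pow hstd hV hI,
    bigradedSubmodule_sup (reesFiltration_le hV 0 J) (reesFiltration_le hV 1 n)]

/-- The subtracted dimension is that of `I 𝓡(I)` in bidegree `(j, i)`, namely of `R_{j-d} V^(i+1)`,
which is absent when `j < d`. -/
theorem quotientLength_extendToRees_sup (hstd : IsStandardGraded 𝒜) (hV : V ≤ 𝒜 d)
    (hI : Ideal.span (V : Set R) = I) (J n : ℕ) :
    (extendToRees I I ⊔ (extendToRees I (homogeneousMaximalIdeal 𝒜) ^ J ⊔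
      reesHomogeneousMaximalIdeal I (homogeneousMaximalIdeal 𝒜) ^ n)).quotientLength =
      (∑ t ∈ bidegrees J n, (Module.finrank k ↥(𝒜 t.1 * V ^ t.2) -
        if d ≤ t.1 then Module.finrank k ↥(𝒜 (t.1 - d) * V ^ (t.2 + 1)) else 0) : ℕ) := by
  have hsup : ∀ m i, reesFiltration 𝒜 V d 0 J m i ⊔ reesFiltration 𝒜 V d 1 n m i ≤ 𝒜 m :=
    fun m i => sup_le (reesFiltration_le hV 0 J m i) (reesFiltration_le hV 1 n m i)
  have h𝔮 := (Ideal.toSubmodule_sup (k := k) (𝔮 := extendToRees I I)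
    (𝔭 := extendToRees I (homogeneousMaximalIdeal 𝒜) ^ J ⊔
      reesHomogeneousMaximalIdeal I (homogeneousMaximalIdeal 𝒜) ^ n))
  rw [toSubmodule_extendToRees_self hV hI, toSubmodule_pow_sup_pow hstd hV hI,
    bigradedSubmodule_sup (fun m i => reesPart_le hV m (i + 1)) hsup] at h𝔮
  have hle : ∀ j i, reesPart 𝒜 V d (j + i * d) (i + 1) ≤ 𝒜 j * V ^ i := fun j i => by
    rw [← reesPart_add]
    exact reesPart_succ_le hV _ i
  rw [length_quotient_eq_sum hstd hV hI h𝔮 (m := n) (le_sup_right.trans le_sup_right)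
    (bidegrees J n) (fun j i => ?_) (fun j i h => ?_)]
  · congr 1
    refine Finset.sum_congr rfl fun t ht => ?_
    rw [reesFiltration_sup_add, if_pos ht, sup_bot_eq, reesPart_succ_add]
    by_cases h : d ≤ t.1
    · rw [if_pos h, if_pos h]
    · rw [if_neg h, if_neg h, finrank_bot]
  · rw [reesFiltration_sup_add]
    refine sup_le (hle j i) ?_
    split_ifs
    exacts [bot_le, le_rfl]
  · rw [reesFiltration_sup_add, if_neg h]
    exact sup_eq_right.2 (hle j i)

theorem quotientLength_sup_span_monomial [IsDomain R] (hstd : IsStandardGraded 𝒜) (hV : V ≤ 𝒜 d)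
    (hI : Ideal.span (V : Set R) = I) {b : R} {e : ℕ} (hb : b ∈ V ^ e) (hb0 : b ≠ 0)
    (hmem : monomial e b ∈ reesAlgebra I) (J n : ℕ) :
    (extendToRees I (homogeneousMaximalIdeal 𝒜) ^ J ⊔
      reesHomogeneousMaximalIdeal I (homogeneousMaximalIdeal 𝒜) ^ n ⊔
      Ideal.span {(⟨monomial e b, hmem⟩ : reesAlgebra I)}).quotientLength =
      (∑ t ∈ bidegrees J n, (Module.finrank k ↥(𝒜 t.1 * V ^ t.2) -
        if e ≤ t.2 then Module.finrank k ↥(𝒜 t.1 * V ^ (t.2 - e)) else 0) : ℕ) := by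
  have hsup : ∀ m i, reesFiltration 𝒜 V d 0 J m i ⊔ reesFiltration 𝒜 V d 1 n m i ≤ 𝒜 m :=
    fun m i => sup_le (reesFiltration_le hV 0 J m i) (reesFiltration_le hV 1 n m i)
  have h𝔮 := (Ideal.toSubmodule_sup (k := k)
    (𝔮 := extendToRees I (homogeneousMaximalIdeal 𝒜) ^ J ⊔
      reesHomogeneousMaximalIdeal I (homogeneousMaximalIdeal 𝒜) ^ n)
    (𝔭 := Ideal.span {(⟨monomial e b, hmem⟩ : reesAlgebra I)}))
  rw [toSubmodule_span_singleton_monomial hV hI hb, toSubmodule_pow_sup_pow hstd hV hI,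
    bigradedSubmodule_sup hsup (reesMultiples_le hV hb)] at h𝔮
  have hle : ∀ j i, reesMultiples 𝒜 V d b e (j + i * d) i ≤ 𝒜 j * V ^ i := fun j i => by
    rw [reesMultiples_add]
    split_ifs with h
    · obtain ⟨l, rfl⟩ := Nat.exists_eq_add_of_le h
      rw [Nat.add_sub_cancel_left, _root_.pow_add, mul_left_comm]
      exact mul_le_mul' le_rfl
        (mul_le_mul' ((Submodule.span_singleton_le_iff_mem _ _).2 hb) le_rfl)
    · exact bot_le
  rw [length_quotient_eq_sum hstd hV hI h𝔮 (m := n) (le_sup_right.trans le_sup_left)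
    (bidegrees J n) (fun j i => ?_) (fun j i h => ?_)]
  · congr 1
    refine Finset.sum_congr rfl fun t ht => ?_
    rw [reesFiltration_sup_add, if_pos ht, bot_sup_eq, reesMultiples_add]
    by_cases h : e ≤ t.2
    · rw [if_pos h, if_pos h, finrank_span_singleton_mul hb0]
    · rw [if_neg h, if_neg h, finrank_bot]
  · rw [reesFiltration_sup_add]
    refine sup_le ?_ (hle j i)
    split_ifs
    exacts [bot_le, le_rfl]
  · rw [reesFiltration_sup_add, if_neg h]
    exact sup_eq_left.2 (hle j i)

theorem hasSamuelLimit_grTorsion [IsDomain R] [IsNoetherianRing R] (hstd : IsStandardGraded 𝒜)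
    (hd : 0 < d) (hV : V ≤ 𝒜 d) (hV0 : V ≠ ⊥) (hI : Ideal.span (V : Set R) = I) {s : ℕ}
    (hs : 0 < s) {e : ℝ} (he : Tendsto (fun n : ℕ =>
      (∑ i ∈ Finset.range n, (Module.finrank k ↥(V ^ i) : ℝ)) / (n : ℝ) ^ s) atTop (𝓝 e))
    {r j₀ : ℕ} (hr : ∀ j, j₀ ≤ j → submoduleRank (Algebra.adjoin k (V : Set R)) (𝒜 j) = r) :
    HasSamuelLimit (assocGraded I) (grHomogeneousMaximalIdeal I (homogeneousMaximalIdeal 𝒜))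
      (grTorsion I (homogeneousMaximalIdeal 𝒜)) s (s ! * (d * (r * e))) := by
  have hfin : ∀ j i, Module.Finite k ↥(𝒜 j * V ^ i) := fun j i =>
    Module.Finite.iff_fg.2 ((hstd.fg j).mul ((hstd.fg_of_le hV).pow i))
  have hgrowth := fun j => tendsto_sum_finrank_mul_pow hd hV (hstd.fg_of_le hV) (hstd.fg j) he
  obtain ⟨f, hf, hf0⟩ := V.exists_mem_ne_zero_of_ne_bot hV0
  -- The ranks are constant from `j₀` on, so `b R_{j₀+d} ⊆ V^e₀ f R_{j₀} ⊆ R_{j₀} V^(e₀+1)`; thus `b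
  -- X^e₀` is the element needed in the torsion.
  obtain ⟨e₀, b, hb, hb0, hbm⟩ := exists_mem_pow_mul_mem_mul hstd hd hV hf hf0 (j := j₀)
    (by rw [hr _ (Nat.le_add_right _ _), hr _ le_rfl])
  have hmem : monomial e₀ b ∈ reesAlgebra I :=
    reesAlgebra.monomial_mem.2 (mem_pow_of_mem_pow hI hb)
  have hbm' : ∀ x ∈ 𝒜 (j₀ + d), b * x ∈ 𝒜 j₀ * V ^ (e₀ + 1) := fun x hx => by
    have hle : (𝒜 j₀).map (LinearMap.mulLeft k f) ≤ V * 𝒜 j₀ := by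
      rintro _ ⟨y, hy, rfl⟩
      exact Submodule.mul_mem_mul hf hy
    have := (mul_le_mul' le_rfl hle : V ^ e₀ * (𝒜 j₀).map (LinearMap.mulLeft k f) ≤ _) (hbm x hx)
    rwa [← mul_assoc, ← _root_.pow_succ, mul_comm] at this
  have h1 : ∀ j i, Module.finrank k ↥(𝒜 j * V ^ (i + 1)) ≤
      Module.finrank k ↥(𝒜 (j + d) * V ^ i) := fun j i => by
    refine Submodule.finrank_mono ?_
    rw [_root_.pow_succ', ← mul_assoc]
    exact mul_le_mul' ((mul_le_mul' le_rfl hV).trans (graded_mul_le 𝒜 _ _)) le_rfl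
  have h2 : ∀ j i, Module.finrank k ↥(𝒜 j * V ^ i) ≤
      Module.finrank k ↥(𝒜 j * V ^ (i + e₀)) := fun j i => by
    rw [← finrank_span_singleton_mul hb0]
    refine Submodule.finrank_mono ?_
    rw [_root_.pow_add, mul_comm (V ^ i), mul_left_comm (𝒜 j)]
    exact mul_le_mul' ((Submodule.span_singleton_le_iff_mem _ _).2 hb) le_rfl
  have hmap : grTorsion I (homogeneousMaximalIdeal 𝒜) = idealSaturation ⊥
      ((extendToRees I (homogeneousMaximalIdeal 𝒜)).map
        (Ideal.Quotient.mk (extendToRees I I))) := by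
    exact congrArg (idealSaturation ⊥) (Ideal.map_map _ _).symm
  rw [hmap]
  refine hasSamuelLimit_idealSaturation (extendToRees I I)
    (extendToRees I (homogeneousMaximalIdeal 𝒜))
    (reesHomogeneousMaximalIdeal I (homogeneousMaximalIdeal 𝒜)) (c := j₀ + d) (j₁ := j₀ + d)
    (monomial_mul_mem_extendToRees hstd hV hI hmem hbm')
    (fun J _ n => quotientLength_extendToRees_sup hstd hV hI J n)
    (fun J n => quotientLength_sup_span_monomial hstd hV hI hb hb0 hmem J n)
    (fun J hJ => tendsto_sum_bidegrees_sub_succ (fun j i => Module.finrank k ↥(𝒜 j * V ^ i)) h1 hs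
      hgrowth (fun j hj => by rw [hr j hj]) hJ)
    (fun J => tendsto_sum_bidegrees_sub_pred (fun j i => Module.finrank k ↥(𝒜 j * V ^ i)) h2
      hgrowth J)

end JMultiplicity

/-! ### Multiplicities of one-dimensional local rings -/

/-- The hypotheses say that the classes of `g` form a basis of `𝔫^n/𝔫^(n+1)` over the field `S/𝔫`.
-/
theorem length_quotient_pow_succ_eq_add {S : Type*} [CommRing S] (𝔫 : Ideal S) [𝔫.IsMaximal]
    {n h : ℕ} (g : Fin h → S) (hg : 𝔫 ^ n = Ideal.span (Set.range g) ⊔ 𝔫 ^ (n + 1))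
    (hg' : ∀ v : Fin h → S, ∑ l, v l * g l ∈ 𝔫 ^ (n + 1) → ∀ l, v l ∈ 𝔫) :
    (𝔫 ^ (n + 1)).quotientLength = (𝔫 ^ n).quotientLength + h := by
  let f : (Fin h → S) →ₗ[S] S ⧸ 𝔫 ^ (n + 1) :=
    Submodule.mkQ (𝔫 ^ (n + 1)) ∘ₗ Fintype.linearCombination S g
  let q : (S ⧸ 𝔫 ^ (n + 1)) →ₗ[S] S ⧸ 𝔫 ^ n :=
    Submodule.factor (Ideal.pow_le_pow_right n.le_succ)
  have hgn : ∀ l, g l ∈ 𝔫 ^ n := fun l => by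
    rw [hg]
    exact (le_sup_left : Ideal.span (Set.range g) ≤ _) (Ideal.subset_span ⟨l, rfl⟩)
  have hker : LinearMap.ker q = LinearMap.range f := by
    ext x
    obtain ⟨x, rfl⟩ := Submodule.Quotient.mk_surjective _ x
    rw [LinearMap.mem_ker]
    have h1 : q (Submodule.Quotient.mk x) = 0 ↔ x ∈ 𝔫 ^ n := Submodule.Quotient.mk_eq_zero _
    rw [h1]
    constructor
    · intro hx
      rw [hg] at hx
      obtain ⟨y, hy, z, hz, rfl⟩ := Submodule.mem_sup.1 hx
      rw [Ideal.span, ← Fintype.range_linearCombination S] at hy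
      obtain ⟨v, rfl⟩ := hy
      refine ⟨v, ((Submodule.Quotient.eq _).2 ?_)⟩
      rw [sub_add_cancel_left]
      exact neg_mem hz
    · rintro ⟨v, hv⟩
      have h2 := (Submodule.Quotient.eq _).1 hv
      have h3 : Fintype.linearCombination S g v ∈ 𝔫 ^ n :=
        Fintype.linearCombination_apply S g v ▸ sum_mem fun l _ => Ideal.mul_mem_left _ _ (hgn l)
      rw [← sub_sub_cancel (Fintype.linearCombination S g v) x]
      exact sub_mem h3 (Ideal.pow_le_pow_right n.le_succ h2)
  have hkerf : LinearMap.ker f = Submodule.pi Set.univ fun _ => 𝔫 := by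
    ext v
    rw [LinearMap.mem_ker, Submodule.mem_pi]
    have h1 : f v = 0 ↔ ∑ l, v l * g l ∈ 𝔫 ^ (n + 1) := Submodule.Quotient.mk_eq_zero _
    rw [h1]
    refine ⟨fun h l _ => hg' v h l, fun h => sum_mem fun l _ => ?_⟩
    rw [_root_.pow_succ']
    exact Ideal.mul_mem_mul (h l trivial) (hgn l)
  have hrange : Module.length S (LinearMap.range f) = h := by
    rw [← (f.quotKerEquivRange).length_eq, hkerf,
      (Submodule.quotientPi fun _ : Fin h => (𝔫 : Submodule S S)).length_eq,
      Module.length_pi_of_fintype]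
    have h1 : Module.length S (S ⧸ 𝔫) = 1 := Module.length_eq_one_iff.2
      (isSimpleModule_iff_isCoatom.2 (Ideal.isMaximal_def.1 inferInstance))
    simp [h1]
  have := Module.length_eq_add_of_exact (LinearMap.ker q).subtype q
    (LinearMap.ker q).injective_subtype (Submodule.factor_surjective _)
    (LinearMap.exact_subtype_ker_map q)
  rw [hker, hrange] at this
  rw [Ideal.quotientLength, this, add_comm]
  rfl

/-- The length of `S/𝔫^n` is `∑_{j<n} h j`; divided by `n` it is a Cesàro mean of an eventually
constant sequence. -/
theorem isMultiplicity_of_quotientLength_pow_succ {S : Type*} [CommRing S] (𝔫 : Ideal S)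
    (hdim : ringKrullDim S = 1) {h : ℕ → ℕ}
    (hlen : ∀ n, (𝔫 ^ (n + 1)).quotientLength = (𝔫 ^ n).quotientLength + h n) {r j₀ : ℕ}
    (hr : ∀ j, j₀ ≤ j → h j = r) : IsMultiplicity S 𝔫 S r := by
  refine ⟨1, by rw [Module.supportDim_self_eq_ringKrullDim, hdim]; rfl, ?_⟩
  have hsum : ∀ n, (𝔫 ^ n).quotientLength = (∑ j ∈ Finset.range n, h j : ℕ) := by
    intro n
    induction n with
    | zero =>
      rw [_root_.pow_zero, Ideal.one_eq_top, Ideal.quotientLength, Finset.range_zero,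
        Finset.sum_empty, Nat.cast_zero, Module.length_eq_zero_iff]
      exact Ideal.Quotient.subsingleton_iff.2 rfl
    | succ n ih => rw [hlen, ih, Finset.sum_range_succ, Nat.cast_add]
  have hlim : Tendsto (fun n : ℕ => ((∑ j ∈ Finset.range n, h j : ℕ) : ℝ) / (n : ℝ) ^ 1) atTop
      (𝓝 r) := by
    have h1 : Tendsto (fun j => (h j : ℝ)) atTop (𝓝 r) :=
      tendsto_const_nhds.congr' (eventually_atTop.2 ⟨j₀, fun j hj => by rw [← hr j hj]⟩)
    refine h1.cesaro.congr fun n => ?_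
    rw [_root_.pow_one, Nat.cast_sum, div_eq_inv_mul]
  have := hasSamuelLimit_of_tendsto hsum hlim
  rwa [Nat.factorial_one, Nat.cast_one, one_mul] at this

section LocalizationAtPrime

variable {T : Type*} [CommRing T] (P : Ideal T) [P.IsPrime]

/-- Since `u` becomes a unit, `g` generates `P^n` after localization. Independence modulo `P^(n+1)`
descends to `T` by clearing denominators. -/
theorem quotientLength_maximalIdeal_pow_succ {n h : ℕ} (g : Fin h → T) (hg : ∀ l, g l ∈ P ^ n)
    {u : T} (hu : u ∉ P) (hug : ∀ x ∈ P ^ n, u * x ∈ Ideal.span (Set.range g))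
    (hli : ∀ w : Fin h → T, ∑ l, w l * g l ∈ P ^ (n + 1) → ∀ l, w l ∈ P) :
    (IsLocalRing.maximalIdeal (Localization.AtPrime P) ^ (n + 1)).quotientLength =
      (IsLocalRing.maximalIdeal (Localization.AtPrime P) ^ n).quotientLength + h := by
  have hmap : ∀ m, IsLocalRing.maximalIdeal (Localization.AtPrime P) ^ m =
      (P ^ m).map (algebraMap T (Localization.AtPrime P)) := fun m => by
    rw [Ideal.map_pow, Localization.AtPrime.map_eq_maximalIdeal]
  have hunit : ∀ t, t ∉ P → IsUnit (algebraMap T (Localization.AtPrime P) t) := fun t ht =>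
    IsLocalization.map_units (Localization.AtPrime P) (⟨t, ht⟩ : P.primeCompl)
  refine length_quotient_pow_succ_eq_add _ (fun l => algebraMap T (Localization.AtPrime P) (g l))
    (le_antisymm ?_ (sup_le ?_ (Ideal.pow_le_pow_right n.le_succ))) ?_
  · rw [hmap, Ideal.map_le_iff_le_comap]
    intro x hx
    rw [Ideal.mem_comap]
    refine (le_sup_left : Ideal.span (Set.range fun l => algebraMap T _ (g l)) ≤ _)
      ((Ideal.unit_mul_mem_iff_mem _ (hunit u hu)).1 ?_)
    rw [← map_mul, Set.range_comp', ← Ideal.map_span]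
    exact Ideal.mem_map_of_mem _ (hug x hx)
  · rw [hmap, Ideal.span_le]
    rintro _ ⟨l, rfl⟩
    exact Ideal.mem_map_of_mem _ (hg l)
  · intro v hv l
    obtain ⟨c, hc⟩ := IsLocalization.exist_integer_multiples_of_finite P.primeCompl v
    choose w hw using hc
    have h1 : algebraMap T (Localization.AtPrime P) (∑ l, w l * g l) =
        algebraMap T (Localization.AtPrime P) c *
          ∑ l, v l * algebraMap T (Localization.AtPrime P) (g l) := by
      rw [map_sum, Finset.mul_sum]
      refine Finset.sum_congr rfl fun l _ => ?_
      rw [map_mul, hw, Algebra.smul_def, mul_assoc]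
    have h2 := Ideal.mul_mem_left _ (algebraMap T (Localization.AtPrime P) c) hv
    rw [← h1, hmap, IsLocalization.algebraMap_mem_map_algebraMap_iff P.primeCompl] at h2
    obtain ⟨m, hm, h3⟩ := h2
    rw [Finset.mul_sum] at h3
    have h4 := hli (fun l => m * w l) (by simpa only [mul_assoc] using h3) l
    have h5 : w l ∈ P := (Ideal.IsPrime.mem_or_mem inferInstance h4).resolve_left hm
    have h6 : algebraMap T (Localization.AtPrime P) c * v l ∈
        IsLocalRing.maximalIdeal (Localization.AtPrime P) := by
      rw [← Algebra.smul_def]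
      have := (hw l) ▸ (Ideal.mem_map_of_mem (algebraMap T (Localization.AtPrime P)) h5)
      rwa [Localization.AtPrime.map_eq_maximalIdeal] at this
    exact (Ideal.unit_mul_mem_iff_mem _ (hunit c c.2)).1 h6

/-- A prime `𝔭 ⊆ P` containing `f` contains `u P^c` but not `u`, so it contains `P`. Thus `P` is
minimal over `(f)`, and Krull's principal ideal theorem bounds its height by one. -/
theorem ringKrullDim_atPrime_eq_one [IsDomain T] [IsNoetherianRing T] {f u : T} (hf : f ∈ P)
    (hf0 : f ≠ 0) {c : ℕ} (hu : u ∉ P) (h : ∀ x ∈ P ^ c, u * x ∈ Ideal.span {f}) :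
    ringKrullDim (Localization.AtPrime P) = 1 := by
  have hmin : P ∈ (Ideal.span {f}).minimalPrimes := by
    refine ⟨⟨inferInstance, (Ideal.span_singleton_le_iff_mem _).2 hf⟩, fun 𝔭 ⟨h𝔭, hle⟩ h𝔭P => ?_⟩
    refine Ideal.IsPrime.le_of_pow_le (n := c) fun x hx => ?_
    exact (h𝔭.mem_or_mem (hle (h x hx))).resolve_left fun h' => hu (h𝔭P h')
  have h1 : P.height ≤ 1 := Ideal.height_le_one_of_isPrincipal_of_mem_minimalPrimes _ _ hmin
  have h2 : P.height ≠ 0 := by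
    intro h0
    rw [Ideal.height_eq_zero_iff,
      IsDomain.minimalPrimes_eq_singleton_bot] at h0
    rw [Set.mem_singleton_iff.1 h0] at hf
    exact hf0 ((Ideal.mem_bot).1 hf)
  rw [IsLocalization.AtPrime.ringKrullDim_eq_height P, le_antisymm h1 (Order.one_le_iff_ne_zero.2 h2)]
  rfl

end LocalizationAtPrime

/-! ### The Rees algebra localized at `𝔪𝓡(I)` -/

section ReesLocalization

variable {k R : Type*} [Field k] [CommRing R] [Algebra k R] {𝒜 : ℕ → Submodule k R}
  [GradedAlgebra 𝒜] {V : Submodule k R} {d : ℕ} {I : Ideal R}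

open GradedAlgebra (proj)

theorem mem_extendToRees_iff (hstd : IsStandardGraded 𝒜) (hV : V ≤ 𝒜 d)
    (hI : Ideal.span (V : Set R) = I) (F : reesAlgebra I) :
    F ∈ extendToRees I (homogeneousMaximalIdeal 𝒜) ↔
      ∀ i, proj 𝒜 (i * d) ((F : R[X]).coeff i) = 0 := by
  have hP := toSubmodule_extendToRees_pow hstd hV hI 1
  rw [_root_.pow_one] at hP
  rw [← Ideal.coe_mem_toSubmodule (k := k), hP, mem_bigradedSubmodule]
  constructor
  · intro h i
    have := h (0 + i * d) i
    rwa [reesFiltration_add, if_neg (by omega), zero_add, Submodule.mem_bot] at this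
  · intro h n i
    have hF := mem_bigradedSubmodule.1
      ((mem_reesAlgebra_iff_mem_bigradedSubmodule hV hI _).1 F.2) n i
    rcases reesPart_cases d n i with hn | ⟨j, rfl⟩
    · rw [reesPart_of_lt hn] at hF
      rw [(Submodule.mem_bot k).1 hF]
      exact zero_mem _
    · rw [reesFiltration_add]
      split_ifs with hj
      · rwa [reesPart_add] at hF
      · obtain rfl : j = 0 := by omega
        rw [zero_add, h i]
        exact zero_mem _

theorem monomial_notMem_extendToRees (hstd : IsStandardGraded 𝒜) (hV : V ≤ 𝒜 d)
    (hI : Ideal.span (V : Set R) = I) {b : R} {e : ℕ} (hb : b ∈ V ^ e) (hb0 : b ≠ 0)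
    (hmem : monomial e b ∈ reesAlgebra I) :
    (⟨monomial e b, hmem⟩ : reesAlgebra I) ∉ extendToRees I (homogeneousMaximalIdeal 𝒜) := by
  intro h
  have := (mem_extendToRees_iff hstd hV hI _).1 h e
  rw [coeff_monomial_same, proj_of_mem 𝒜 (pow_le_graded hV e hb)] at this
  exact hb0 this

/-- The component with `j = n` of an element of `𝔪^(n+1) 𝓡(I)` vanishes. In `X`-degree `i` this is a
linear relation among the `g l` whose coefficients in `V^i ⊆ A` are the fiber components of the `w
l`, and these decide membership in `𝔪𝓡(I)`. -/
theorem mem_extendToRees_of_sum_mem (hstd : IsStandardGraded 𝒜) (hV : V ≤ 𝒜 d)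
    (hI : Ideal.span (V : Set R) = I) {n h : ℕ} {g : Fin h → R} (hg : ∀ l, g l ∈ 𝒜 n)
    (hli : LinearIndependent (Algebra.adjoin k (V : Set R)) g) (w : Fin h → reesAlgebra I)
    (hw : ∑ l, w l * algebraMap R (reesAlgebra I) (g l) ∈
      extendToRees I (homogeneousMaximalIdeal 𝒜) ^ (n + 1)) (l : Fin h) :
    w l ∈ extendToRees I (homogeneousMaximalIdeal 𝒜) := by
  rw [mem_extendToRees_iff hstd hV hI]
  intro i
  rw [← Ideal.coe_mem_toSubmodule (k := k), toSubmodule_extendToRees_pow hstd hV hI] at hw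
  have h1 := mem_bigradedSubmodule.1 hw (n + i * d) i
  rw [reesFiltration_add, if_neg (by omega), Submodule.mem_bot] at h1
  have h2 : ((∑ l, w l * algebraMap R (reesAlgebra I) (g l) : reesAlgebra I) : R[X]) =
      ∑ l, (w l : R[X]) * C (g l) := by
    rw [AddSubmonoidClass.coe_finsetSum]
    rfl
  have h3 : ∀ l, proj 𝒜 (i * d) ((w l : R[X]).coeff i) ∈ V ^ i := fun l => by
    have := mem_bigradedSubmodule.1
      ((mem_reesAlgebra_iff_mem_bigradedSubmodule hV hI _).1 (w l).2) (0 + i * d) i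
    rwa [reesPart_add, ← hstd.pow_one, _root_.pow_zero, one_mul, zero_add] at this
  rw [h2, finsetSum_coeff, map_sum] at h1
  have h4 : ∑ l, (⟨_, Algebra.pow_le_adjoin V i (h3 l)⟩ : Algebra.adjoin k (V : Set R)) • g l = 0 := by
    rw [← h1]
    refine Finset.sum_congr rfl fun l _ => ?_
    rw [coeff_mul_C, add_comm n, proj_mul_of_mem 𝒜 (hg l)]
    rfl
  exact congrArg Subtype.val (Fintype.linearIndependent_iff.1 hli _ h4 l)

/-- Translates a denominator relation `b R_n ⊆ V^e U` in `R` to the Rees algebra, where `b X^e` lies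
outside `𝔪𝓡(I)` if `b ≠ 0` and becomes a unit. -/
theorem monomial_mul_mem (hstd : IsStandardGraded 𝒜) (hI : Ideal.span (V : Set R) = I) {n e : ℕ}
    {U : Submodule k R} {b : R} (hb : ∀ x ∈ 𝒜 n, b * x ∈ V ^ e * U)
    (hmem : monomial e b ∈ reesAlgebra I) {X : Ideal (reesAlgebra I)}
    (hU : ∀ y ∈ U, algebraMap R (reesAlgebra I) y ∈ X) :
    ∀ F ∈ extendToRees I (homogeneousMaximalIdeal 𝒜) ^ n, ⟨monomial e b, hmem⟩ * F ∈ X := by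
  have key : ∀ y ∈ V ^ e * U, monomial e y ∈ X.toSubmodule k := by
    suffices V ^ e * U ≤ (X.toSubmodule k).comap ((monomial e).restrictScalars k) from
      fun y hy => this hy
    refine Submodule.mul_le.2 fun v hv y hy => ?_
    change monomial e (v * y) ∈ X.toSubmodule k
    rw [← monomial_mul_C]
    exact Ideal.mul_mem_toSubmodule (reesAlgebra.monomial_mem.2 (mem_pow_of_mem_pow hI hv))
      (Ideal.coe_mem_toSubmodule.2 (hU y hy))
  intro F hF
  rw [extendToRees_homogeneousMaximalIdeal_pow hstd] at hF
  induction hF using Submodule.span_induction with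
  | mem F hF =>
    obtain ⟨x, hx, rfl⟩ := hF
    rw [← Ideal.coe_mem_toSubmodule (k := k)]
    change monomial e b * C x ∈ X.toSubmodule k
    rw [monomial_mul_C]
    exact key _ (hb x hx)
  | zero =>
    rw [mul_zero]
    exact zero_mem _
  | add F G _ _ hF hG =>
    rw [mul_add]
    exact add_mem hF hG
  | smul G F _ hF =>
    rw [smul_eq_mul, mul_left_comm]
    exact Ideal.mul_mem_left _ _ hF

theorem algebraMap_mem_pow (hstd : IsStandardGraded 𝒜) {n : ℕ} {x : R} (hx : x ∈ 𝒜 n) :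
    algebraMap R (reesAlgebra I) x ∈ extendToRees I (homogeneousMaximalIdeal 𝒜) ^ n := by
  rw [extendToRees_homogeneousMaximalIdeal_pow hstd]
  exact Ideal.subset_span ⟨x, hx, rfl⟩

theorem isMultiplicity_localization_extendToRees [IsDomain R] [IsNoetherianRing R]
    (hstd : IsStandardGraded 𝒜) (hd : 0 < d) (hV : V ≤ 𝒜 d) (hV0 : V ≠ ⊥)
    (hI : Ideal.span (V : Set R) = I) {r j₀ : ℕ}
    (hr : ∀ j, j₀ ≤ j → submoduleRank (Algebra.adjoin k (V : Set R)) (𝒜 j) = r)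
    [(extendToRees I (homogeneousMaximalIdeal 𝒜)).IsPrime] :
    IsMultiplicity (Localization.AtPrime (extendToRees I (homogeneousMaximalIdeal 𝒜)))
      (IsLocalRing.maximalIdeal
        (Localization.AtPrime (extendToRees I (homogeneousMaximalIdeal 𝒜))))
      (Localization.AtPrime (extendToRees I (homogeneousMaximalIdeal 𝒜))) (r : ℝ) := by
  refine isMultiplicity_of_quotientLength_pow_succ _ ?_
    (h := fun j => submoduleRank (Algebra.adjoin k (V : Set R)) (𝒜 j)) (fun n => ?_) hr
  · obtain ⟨f, hf, hf0⟩ := V.exists_mem_ne_zero_of_ne_bot hV0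
    obtain ⟨e, b, hb, hb0, hbm⟩ := exists_mem_pow_mul_mem_mul hstd hd hV hf hf0 (j := j₀)
      (by rw [hr _ (Nat.le_add_right _ _), hr _ le_rfl])
    have hmem : monomial e b ∈ reesAlgebra I :=
      reesAlgebra.monomial_mem.2 (mem_pow_of_mem_pow hI hb)
    have hfP := algebraMap_mem_pow (I := I) hstd (hV hf)
    have hf1 : algebraMap R (reesAlgebra I) f ∈ extendToRees I (homogeneousMaximalIdeal 𝒜) :=
      Ideal.pow_le_self hd.ne' hfP
    have hf2 : algebraMap R (reesAlgebra I) f ≠ 0 := fun h =>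
      hf0 (C_eq_zero.1 (congrArg Subtype.val h))
    refine ringKrullDim_atPrime_eq_one _ hf1 hf2 (c := j₀ + d)
      (monomial_notMem_extendToRees hstd hV hI hb hb0 hmem) fun F hF => ?_
    refine monomial_mul_mem hstd hI hbm hmem (fun y hy => ?_) F hF
    obtain ⟨z, _, rfl⟩ := hy
    change algebraMap R (reesAlgebra I) (f * z) ∈ _
    rw [map_mul]
    exact Ideal.mul_mem_right _ _ (Ideal.mem_span_singleton_self _)
  · obtain ⟨g, hg, hli⟩ := exists_linearIndependent_submoduleRank
      (Algebra.adjoin k (V : Set R)) (hstd.fg n)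
    -- The element inverted here is `b X^e`, for a denominator `b` of `R_n` with respect to `g`.
    obtain ⟨e, b, hb, hb0, hbm⟩ := exists_denominator hd hV (hstd.fg n) hg hli
    have hmem : monomial e b ∈ reesAlgebra I :=
      reesAlgebra.monomial_mem.2 (mem_pow_of_mem_pow hI hb)
    refine quotientLength_maximalIdeal_pow_succ _ (fun l => algebraMap R (reesAlgebra I) (g l))
      (fun l => algebraMap_mem_pow hstd (hg l))
      (monomial_notMem_extendToRees hstd hV hI hb hb0 hmem)
      (monomial_mul_mem hstd hI hbm hmem fun y hy => ?_)
      (mem_extendToRees_of_sum_mem hstd hV hI hg hli)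
    have h1 := Submodule.span_le_restrictScalars k R (Set.range g) hy
    have h2 := Ideal.mem_map_of_mem (algebraMap R (reesAlgebra I)) h1
    rwa [Ideal.map_span, ← Set.range_comp] at h2

end ReesLocalization

/-! ### The case of dimension zero -/

theorem hasSamuelLimit_bot {S : Type*} [CommRing S] (h : (⊥ : Ideal S).IsMaximal) :
    HasSamuelLimit S ⊥ S 0 1 := by
  have hl : ∀ n, ((⊥ : Ideal S) ^ n).quotientLength = (if n = 0 then 0 else 1 : ℕ) := by
    intro n
    split_ifs with hn
    · rw [hn, _root_.pow_zero, Ideal.one_eq_top, Ideal.quotientLength, Nat.cast_zero,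
        Module.length_eq_zero_iff]
      exact Ideal.Quotient.subsingleton_iff.2 rfl
    · rw [← Ideal.zero_eq_bot, zero_pow hn, Ideal.zero_eq_bot, Nat.cast_one]
      exact Module.length_eq_one_iff.2 (isSimpleModule_iff_isCoatom.2 (Ideal.isMaximal_def.1 h))
  have := hasSamuelLimit_of_tendsto (s := 0) (e := 1) hl
    (tendsto_const_nhds.congr' (eventually_atTop.2 ⟨1, fun n hn => by
      beta_reduce
      rw [if_neg (by omega), Nat.cast_one, _root_.pow_zero, div_one]⟩))
  rwa [Nat.factorial_zero, Nat.cast_one, one_mul] at this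

theorem isMultiplicity_bot {S : Type*} [CommRing S] (h : IsField S) : IsMultiplicity S ⊥ S 1 := by
  have := h.nontrivial
  refine ⟨0, ?_, hasSamuelLimit_bot (Ring.isField_iff_maximal_bot.1 h)⟩
  rw [Module.supportDim_self_eq_ringKrullDim, ringKrullDim_eq_zero_of_isField h]
  rfl

theorem hasSamuelLimit_of_subsingleton {S : Type*} [CommRing S] [Subsingleton S] (𝔞 : Ideal S)
    (M : Type*) [AddCommGroup M] [Module S M] (s : ℕ) : HasSamuelLimit S 𝔞 M s 0 := by
  have h : ∀ n : ℕ, Module.length S (M ⧸ (𝔞 ^ n • ⊤ : Submodule S M)) = 0 := fun n =>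
    have := Module.subsingleton S M
    Module.length_eq_zero
  refine ⟨fun n => by rw [h]; exact ENat.zero_ne_top, ?_⟩
  simp only [h, ENat.toNat_zero, Nat.cast_zero, mul_zero, zero_div]
  exact tendsto_const_nhds

theorem IsGeneratedByForms.span_eq {k R : Type*} [Field k] [CommRing R] [Algebra k R]
    {𝒜 : ℕ → Submodule k R} {d : ℕ} {I : Ideal R} (hI : IsGeneratedByForms 𝒜 I d) :
    Ideal.span ((I.restrictScalars k ⊓ 𝒜 d : Submodule k R) : Set R) = I := by
  apply le_antisymm
  · rw [Ideal.span_le]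
    exact fun x hx => hx.1
  · obtain ⟨F, hF, rfl⟩ := hI
    rw [Ideal.span_le]
    exact fun x hx => Ideal.subset_span ⟨Ideal.subset_span hx, hF hx⟩

theorem isField_of_ringKrullDim_eq_zero {R : Type*} [CommRing R] [IsDomain R]
    (hdim : ringKrullDim R = 0) : IsField R := by
  have : Ring.KrullDimLE 0 R := Ring.krullDimLE_iff.2 hdim.le
  exact Ring.KrullDimLE.isField_of_isDomain

section Main

variable {k R : Type*} [Field k] [CommRing R] [Algebra k R]
  {𝒜 : ℕ → Submodule k R} [GradedAlgebra 𝒜]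

open GradedAlgebra (proj)

theorem IsStandardGraded.finiteType (hstd : IsStandardGraded 𝒜) : Algebra.FiniteType k R := by
  have := finiteType_adjoin (hstd.fg 1)
  refine Algebra.FiniteType.of_surjective (Algebra.adjoin k (𝒜 1 : Set R)).val fun x => ?_
  exact ⟨⟨x, by rw [hstd.generated]; exact Algebra.mem_top⟩, rfl⟩

theorem ringKrullDim_adjoin_of_le_degree_zero (hstd : IsStandardGraded 𝒜) {V : Submodule k R}
    (hV : V ≤ 𝒜 0) : ringKrullDim (Algebra.adjoin k (V : Set R)) = 0 := by
  have h : Algebra.adjoin k (V : Set R) = ⊥ := by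
    rw [eq_bot_iff, Algebra.adjoin_le_iff]
    intro x hx
    have := hV hx
    rw [hstd.degree_zero] at this
    obtain ⟨c, rfl⟩ := this
    exact Subalgebra.algebraMap_mem _ c
  rw [h, ringKrullDim_eq_of_ringEquiv
    (Algebra.botEquivOfInjective hstd.algebraMap_injective).toRingEquiv]
  exact ringKrullDim_eq_zero_of_field k

variable [IsDomain R]

theorem homogeneousMaximalIdeal_ne_top : homogeneousMaximalIdeal 𝒜 ≠ ⊤ := by
  intro h
  have h1 : (1 : R) ∈ homogeneousMaximalIdeal 𝒜 := h ▸ Submodule.mem_top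
  rw [mem_homogeneousMaximalIdeal_iff, proj_of_mem 𝒜 SetLike.GradedOne.one_mem] at h1
  exact one_ne_zero h1

theorem homogeneousMaximalIdeal_eq_bot (hR : IsField R) : homogeneousMaximalIdeal 𝒜 = ⊥ :=
  ((Ring.isField_iff_maximal_bot.1 hR).eq_of_le homogeneousMaximalIdeal_ne_top bot_le).symm

theorem degree_zero_eq_top (hR : IsField R) : 𝒜 0 = ⊤ := by
  rw [eq_top_iff]
  intro x _
  have h : x - proj 𝒜 0 x ∈ homogeneousMaximalIdeal 𝒜 := by
    rw [mem_homogeneousMaximalIdeal_iff, map_sub, proj_of_mem 𝒜 (proj_mem 𝒜 0 x), sub_self]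
  rw [homogeneousMaximalIdeal_eq_bot hR, Ideal.mem_bot, sub_eq_zero] at h
  rw [h]
  exact proj_mem 𝒜 0 x

theorem IsStandardGraded.algebraMap_surjective (hstd : IsStandardGraded 𝒜) (hR : IsField R) :
    Function.Surjective (algebraMap k R) := by
  intro x
  have : x ∈ 𝒜 0 := by
    rw [degree_zero_eq_top (𝒜 := 𝒜) hR]
    exact Submodule.mem_top
  rw [hstd.degree_zero] at this
  exact this

theorem IsStandardGraded.isField_subalgebra (hstd : IsStandardGraded 𝒜) (hR : IsField R)
    (A : Subalgebra k R) : IsField A := by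
  have hb : Function.Bijective (algebraMap k A) := by
    constructor
    · intro a b h
      exact hstd.algebraMap_injective (congrArg Subtype.val h)
    · intro x
      obtain ⟨c, hc⟩ := hstd.algebraMap_surjective hR (x : R)
      exact ⟨c, Subtype.ext hc⟩
  exact MulEquiv.isField (Field.toIsField k) (RingEquiv.ofBijective _ hb).symm.toMulEquiv

theorem card_le_one_of_linearIndependent {A : Subalgebra k R} (hA : A = ⊤) {r : ℕ} {b : Fin r → R}
    (hb : LinearIndependent A b) : r ≤ 1 := by
  by_contra hr
  have h2 : 2 ≤ r := by omega
  have h := Fintype.linearIndependent_iff.1 (hb.comp _ (Fin.castLE_injective h2))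
    ![⟨b (Fin.castLE h2 1), by rw [hA]; exact Algebra.mem_top⟩,
      ⟨-b (Fin.castLE h2 0), by rw [hA]; exact Algebra.mem_top⟩] (by
      rw [Fin.sum_univ_two]
      change b (Fin.castLE h2 1) * b (Fin.castLE h2 0) +
        -b (Fin.castLE h2 0) * b (Fin.castLE h2 1) = 0
      ring) 0
  exact hb.ne_zero _ (congrArg Subtype.val h)

end Main

theorem isMultiplicity_localization_bot {T : Type*} [CommRing T] {P : Ideal T} [P.IsPrime]
    (hP : P = ⊥) : IsMultiplicity (Localization.AtPrime P)
      (IsLocalRing.maximalIdeal (Localization.AtPrime P)) (Localization.AtPrime P) 1 := by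
  have h : IsLocalRing.maximalIdeal (Localization.AtPrime P) = ⊥ := by
    rw [← Localization.AtPrime.map_eq_maximalIdeal, eq_bot_iff, Ideal.map_le_iff_le_comap]
    intro x hx
    rw [hP, Ideal.mem_bot] at hx
    rw [hx]
    exact zero_mem _
  rw [h]
  exact isMultiplicity_bot (IsLocalRing.isField_iff_maximalIdeal_eq.2 h)

/-- `R` is a field, equal to `k`, so `𝔪 = 0`, `I = R` and `A = R`. Both multiplicities of rings are
`1`, and `j(I) = 0` agrees with the formula because `d = 0`. -/
theorem exists_multiplicities_of_ringKrullDim_eq_zero {k R : Type*} [Field k] [CommRing R]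
    [IsDomain R] [Algebra k R] {𝒜 : ℕ → Submodule k R} [GradedAlgebra 𝒜]
    (hstd : IsStandardGraded 𝒜) (hdim : ringKrullDim R = 0) {d : ℕ} {I : Ideal R} (hI0 : I ≠ ⊥)
    (hI : IsGeneratedByForms 𝒜 I d) {r : ℕ} (hr1 : ∃ b : Fin r → R,
      LinearIndependent (formSubalgebra 𝒜 I d) b)
    (hr2 : ∀ b : Fin 1 → R, (∀ i, b i ∈ veroneseSubalgebra 𝒜 d) →
      LinearIndependent (formSubalgebra 𝒜 I d) b → 1 ≤ r)
    [(extendToRees I (homogeneousMaximalIdeal 𝒜)).IsPrime] :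
    IsMultiplicity (formSubalgebra 𝒜 I d) (subalgebraMaximalIdeal 𝒜 (formSubalgebra 𝒜 I d))
        (formSubalgebra 𝒜 I d) 1 ∧
      IsMultiplicity
        (Localization.AtPrime (extendToRees I (homogeneousMaximalIdeal 𝒜)))
        (IsLocalRing.maximalIdeal
          (Localization.AtPrime (extendToRees I (homogeneousMaximalIdeal 𝒜))))
        (Localization.AtPrime (extendToRees I (homogeneousMaximalIdeal 𝒜))) (r : ℝ) ∧
      IsJMultiplicity (homogeneousMaximalIdeal 𝒜) I ((d : ℝ) * r * 1) := by
  have hR := isField_of_ringKrullDim_eq_zero hdim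
  have h𝔪 : homogeneousMaximalIdeal 𝒜 = ⊥ := homogeneousMaximalIdeal_eq_bot hR
  have hA : formSubalgebra 𝒜 I d = ⊤ := by
    refine eq_top_iff.2 fun x _ => ?_
    obtain ⟨c, rfl⟩ := hstd.algebraMap_surjective hR x
    exact Subalgebra.algebraMap_mem _ c
  have hr : r = 1 := by
    obtain ⟨b, hb⟩ := hr1
    refine le_antisymm (card_le_one_of_linearIndependent hA hb)
      (hr2 (fun _ => 1) (fun _ => one_mem _) ?_)
    exact LinearIndependent.of_subsingleton 0 one_ne_zero
  have hItop : I = ⊤ :=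
    (Ring.isField_iff_maximal_bot.1 hR).out.2 _ (bot_lt_iff_ne_bot.2 hI0)
  -- All of `R` has degree zero, so nonzero forms of positive degree do not exist.
  have hd : d = 0 := by
    by_contra hd
    obtain ⟨F, hF, rfl⟩ := hI
    refine hI0 (Ideal.span_eq_bot.2 fun x hx => ?_)
    have h0 : x ∈ 𝒜 0 := by
      rw [degree_zero_eq_top (𝒜 := 𝒜) hR]
      exact Submodule.mem_top
    rw [← proj_of_mem 𝒜 (hF hx), proj_of_mem_ne 𝒜 h0 (Ne.symm hd)]
  refine ⟨?_, ?_, ⟨0, by rw [hdim]; rfl, ?_⟩⟩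
  · have h : subalgebraMaximalIdeal 𝒜 (formSubalgebra 𝒜 I d) = ⊥ := by
      rw [subalgebraMaximalIdeal, h𝔪, eq_bot_iff]
      exact fun x hx => Subtype.ext hx
    rw [h]
    exact isMultiplicity_bot (hstd.isField_subalgebra hR _)
  · rw [hr, Nat.cast_one]
    refine isMultiplicity_localization_bot ?_
    rw [h𝔪]
    exact Ideal.map_bot
  · have : Subsingleton (assocGraded I) := by
      refine Ideal.Quotient.subsingleton_iff.2 ?_
      rw [extendToRees, hItop, Ideal.map_top]
    rw [hd, Nat.cast_zero, zero_mul, zero_mul]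
    exact hasSamuelLimit_of_subsingleton _ _ _

/-! ### The main theorem -/

theorem exists_multiplicities_of_pos {k R : Type*} [Field k] [CommRing R] [IsDomain R]
    [IsNoetherianRing R] [Algebra k R] {𝒜 : ℕ → Submodule k R} [GradedAlgebra 𝒜]
    (hstd : IsStandardGraded 𝒜) {s : ℕ} (hs : 0 < s) (hdim : ringKrullDim R = s) {d : ℕ}
    (hd : 0 < d) {V : Submodule k R} (hV : V ≤ 𝒜 d) (hV0 : V ≠ ⊥) {I : Ideal R}
    (hI : Ideal.span (V : Set R) = I)
    (hdimA : ringKrullDim (Algebra.adjoin k (V : Set R)) = s) {r : ℕ}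
    (h1 : ∃ b : Fin r → R, (∀ i, b i ∈ veroneseSubalgebra 𝒜 d) ∧
      LinearIndependent (Algebra.adjoin k (V : Set R)) b)
    (h2 : ∀ (m : ℕ) (b : Fin m → R), (∀ i, b i ∈ veroneseSubalgebra 𝒜 d) →
      LinearIndependent (Algebra.adjoin k (V : Set R)) b → m ≤ r)
    [(extendToRees I (homogeneousMaximalIdeal 𝒜)).IsPrime] :
    ∃ eA : ℝ, IsMultiplicity (Algebra.adjoin k (V : Set R))
        (subalgebraMaximalIdeal 𝒜 (Algebra.adjoin k (V : Set R)))
        (Algebra.adjoin k (V : Set R)) eA ∧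
      IsMultiplicity
        (Localization.AtPrime (extendToRees I (homogeneousMaximalIdeal 𝒜)))
        (IsLocalRing.maximalIdeal
          (Localization.AtPrime (extendToRees I (homogeneousMaximalIdeal 𝒜))))
        (Localization.AtPrime (extendToRees I (homogeneousMaximalIdeal 𝒜))) (r : ℝ) ∧
      IsJMultiplicity (homogeneousMaximalIdeal 𝒜) I ((d : ℝ) * r * eA) := by
  obtain ⟨e, he⟩ := exists_tendsto_sum_finrank_pow hd hV (hstd.fg_of_le hV) hdimA
  obtain ⟨_, j₀, hj₀⟩ := exists_forall_submoduleRank_eq hstd hd hV hV0 h1 h2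
  refine ⟨s ! * e, isMultiplicity_adjoin hd hV (hstd.fg_of_le hV) hdimA he,
    isMultiplicity_localization_extendToRees hstd hd hV hV0 hI hj₀, s, hdim, ?_⟩
  have h := hasSamuelLimit_grTorsion hstd hd hV hV0 hI hs he hj₀
  rwa [show (s ! : ℝ) * (d * (r * e)) = d * r * (s ! * e) by ring] at h

theorem finiteType_of_eq_adjoin {k R : Type*} [Field k] [CommRing R] [Algebra k R]
    {A : Subalgebra k R} {V : Submodule k R} (hA : A = Algebra.adjoin k (V : Set R)) (hV : V.FG) :
    Algebra.FiniteType k A := by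
  subst hA
  exact finiteType_adjoin hV

theorem mainTheorem5 {k R : Type*} [Field k] [CommRing R] [IsDomain R] [Algebra k R]
    (𝒜 : ℕ → Submodule k R) [GradedAlgebra 𝒜] (hstd : IsStandardGraded 𝒜)
    (s : ℕ) (hdimR : ringKrullDim R = s)
    (d : ℕ) (I : Ideal R) (hI0 : I ≠ ⊥) (hI : IsGeneratedByForms 𝒜 I d)
    (hdimA : ringKrullDim (formSubalgebra 𝒜 I d) = s) :
    ∃ (_ : (extendToRees I (homogeneousMaximalIdeal 𝒜)).IsPrime) (r : ℕ) (eA : ℝ),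
      quotDegree (formSubalgebra 𝒜 I d) (veroneseSubalgebra 𝒜 d)
        (formSubalgebra_le_veroneseSubalgebra 𝒜 I d) = r ∧
      IsMultiplicity (formSubalgebra 𝒜 I d) (subalgebraMaximalIdeal 𝒜 (formSubalgebra 𝒜 I d))
        (formSubalgebra 𝒜 I d) eA ∧
      IsMultiplicity
        (Localization.AtPrime (extendToRees I (homogeneousMaximalIdeal 𝒜)))
        (IsLocalRing.maximalIdeal
          (Localization.AtPrime (extendToRees I (homogeneousMaximalIdeal 𝒜))))
        (Localization.AtPrime (extendToRees I (homogeneousMaximalIdeal 𝒜))) (r : ℝ) ∧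
      IsJMultiplicity (homogeneousMaximalIdeal 𝒜) I ((d : ℝ) * r * eA) := by
  have hV : I.restrictScalars k ⊓ 𝒜 d ≤ 𝒜 d := inf_le_right
  have hspan : Ideal.span ((I.restrictScalars k ⊓ 𝒜 d : Submodule k R) : Set R) = I := hI.span_eq
  have hV0 : I.restrictScalars k ⊓ 𝒜 d ≠ ⊥ := fun h => hI0 (by
    rw [← hspan, h]
    exact Ideal.span_eq_bot.2 fun _ hx => hx)
  have hR : Algebra.FiniteType k R := hstd.finiteType
  have hnoeth : IsNoetherianRing R := Algebra.FiniteType.isNoetherianRing k R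
  -- By definition `formSubalgebra 𝒜 I d` is `k[V]` for `V = I ∩ R_d`, so the results on
  -- `Algebra.adjoin k V` apply to it directly.
  have hA : Algebra.FiniteType k (formSubalgebra 𝒜 I d) :=
    finiteType_of_eq_adjoin (V := I.restrictScalars k ⊓ 𝒜 d) rfl (hstd.fg_of_le hV)
  have hB : Algebra.FiniteType k (veroneseSubalgebra 𝒜 d) :=
    finiteType_of_eq_adjoin rfl (hstd.fg d)
  have halg : Algebra.IsAlgebraic (formSubalgebra 𝒜 I d) R :=
    isAlgebraic_of_ringKrullDim_eq _ hdimA hdimR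
  have hprime := isPrime_extendToRees hstd hV hspan
  obtain ⟨r, hr, hr1, hr2⟩ := exists_quotDegree_eq (formSubalgebra 𝒜 I d)
    (veroneseSubalgebra 𝒜 d) (formSubalgebra_le_veroneseSubalgebra 𝒜 I d)
  rcases Nat.eq_zero_or_pos s with rfl | hs
  · obtain ⟨b, _, hb⟩ := hr1
    exact ⟨hprime, r, 1, hr, exists_multiplicities_of_ringKrullDim_eq_zero hstd hdimR hI0 hI
      ⟨b, hb⟩ (fun b => hr2 (Fin 1) b)⟩
  -- For `d = 0` the algebra `A` is `k`, whose dimension is zero.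
  have hd : 0 < d := by
    rcases Nat.eq_zero_or_pos d with rfl | hd
    · have h0 : ringKrullDim (formSubalgebra 𝒜 I 0) = 0 :=
        ringKrullDim_adjoin_of_le_degree_zero (V := I.restrictScalars k ⊓ 𝒜 0) hstd hV
      rw [hdimA] at h0
      exact absurd (Nat.cast_eq_zero.1 h0) hs.ne'
    · exact hd
  obtain ⟨eA, h⟩ := exists_multiplicities_of_pos (V := I.restrictScalars k ⊓ 𝒜 d) hstd hs hdimR hd hV
    hV0 hspan hdimA hr1
    fun m b hb hli => (Fintype.card_fin m).symm.trans_le (hr2 (Fin m) b hb hli)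
  exact ⟨hprime, r, eA, hr, h⟩
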